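/- Let $\overline\Sigma$ be a closed (compact, connected) Riemann surface, $P\subset\overline\Sigma$ a finite set, $\Sigma=\overline\Sigma\setminus P$, and let $\boldsymbol b$ be a holomorphic cubic differential on $\Sigma$, not identically zero, having at each puncture $p\in P$ a removable singularity or a pole. Let $g$ be the smooth conformal Riemannian metric on $\Sigma$ characterized as follows: $g$ is complete (the $g$-distance to a fixed point of $\Sigma$ tends to infinity at each puncture); its curvature satisfies Wang's equation $\kappa_g=-1+2\|\boldsymbol b\|_g^2$ (where $\|\boldsymbol b\|_g^2=|f|^2/h^3$ if $\boldsymbol b=f\,dz^3$ and $g=h|dz|^2$ in a conformal coordinate); near each pole of order $\ge 3$ one has $\alpha<\kappa_g<\beta$ for some constants $-1<\alpha<\beta$; and $\kappa_g\to-1$ at each removable singularity and each pole of order $\le 2$. Put $u=\log\big(g/(2^{1/3}|\boldsymbol b|^{2/3})\big)$, and let $p\in P$. (1) Let $p$ be a pole of order $n+3\ge 4$. Let $z$ be a conformal local coordinate of $\overline\Sigma$ centered at $p$, defined on a neighborhood $\{|z|<a\}$ which contains no other puncture, in which $\boldsymbol b=z^{-(n+3)}dz^3$ if $3\nmid n$,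 and $\boldsymbol b=(z^{-l}+A/z)^3dz^3$ for some $A\in\mathbb C$ if $n+3=3l$; let $U=\{0<|z|<a\}$. A natural half-plane in $U$ is a map $\Phi:\{\mathrm{Re}\,\zeta\ge0\}\to U$ which extends holomorphically to a neighborhood of the closed half-plane, satisfies $\Phi^*\boldsymbol b=2\,d\zeta^3$, and tends to $p$ as $|\zeta|\to\infty$. Then for any natural half-planes $\Phi_k$ $(k\in\mathbb Z/n\mathbb Z)$ in $U$ there is a constant $C$ such that for all $k\in\mathbb Z/n\mathbb Z$ and all $\zeta$ with $\mathrm{Re}\,\zeta>0$, the function $u(\zeta):=u(\Phi_k(\zeta))$ satisfies $$0\le u(\zeta)\le C|\zeta|^{-1/2}e^{-2\sqrt3|\zeta|},\qquad |\partial_\zeta u(\zeta)|\le C|\zeta|^{-1/2}e^{-2\sqrt3|\zeta|}.$$ (2) Let $p$ be a pole of order $3$. Let $z$ be a conformal local coordinate centered at $p$, defined on a neighborhood $\{|z|<a\}$ with $a>1$ which contains no other puncture, in which $\boldsymbol b=Rz^{-3}dz^3$, $R\in\mathbb C^*$. Let $r$ be a cube root of $R/2$, let $H=\{-rw:\mathrm{Re}\,w>0\}$,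 and for $\zeta\in \overline H$ let $u(\zeta)$ denote the value of $u$ at the point with coordinate $z=e^{\zeta/r}$ (so that $\boldsymbol b$ pulls back to $2\,d\zeta^3$). Then there is a constant $C$ such that for all $\zeta\in H$ $$0\le u(\zeta)\le C e^{-2\sqrt3\,\mathrm{dist}(\zeta,\partial H)},\qquad |\partial_\zeta u(\zeta)|\le C e^{-2\sqrt3\,\mathrm{dist}(\zeta,\partial H)},$$ where $\mathrm{dist}$ is the Euclidean distance. -/

import Mathlib

open Set Filter Topology
open scoped Manifold ContDiff ENNReal

noncomputable section

namespace WangEq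

/-! In this file `X` is the closed Riemann surface, `P` its set of punctures, and the punctured
surface is the complement of `P`.  Values of the objects below at points of `P` are irrelevant. -/

section Tensors

variable {X : Type*} [TopologicalSpace X] [ChartedSpace ℂ X]

/-- The coefficient `f` of the pullback `f dz ^ 3` of a cubic form `b` by a map `ψ` from (part of)
the complex plane to `X`.  For `ψ` the inverse of a conformal local coordinate this is the
coefficient of `b` in that coordinate. -/
def pullCubic (b : ∀ x : X, TangentSpace 𝓘(ℂ) x → ℂ) (ψ : ℂ → X) (z : ℂ) : ℂ :=
  b (ψ z) (mfderiv 𝓘(ℂ) 𝓘(ℂ) ψ z (1 : ℂ))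

/-- The coefficient `h` of the pullback `h |dz| ^ 2` of a conformal metric (given as the squared
length of tangent vectors) by a map `ψ` from (part of) the complex plane to `X`. -/
def pullMetric (g : ∀ x : X, TangentSpace 𝓘(ℂ) x → ℝ) (ψ : ℂ → X) (z : ℂ) : ℝ :=
  g (ψ z) (mfderiv 𝓘(ℂ) 𝓘(ℂ) ψ z (1 : ℂ))

variable (X) in
/-- A holomorphic cubic differential on the complement of `P`: a complex homogeneous cubic form on
each tangent line, with holomorphic coefficient in every conformal local coordinate. -/
structure CubicDifferential (P : Set X) where
  toFun : ∀ x : X, TangentSpace 𝓘(ℂ) x → ℂ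
  homogeneous : ∀ x ∉ P, ∀ (c : ℂ) (v : TangentSpace 𝓘(ℂ) x), toFun x (c • v) = c ^ 3 * toFun x v
  holomorphic : ∀ e ∈ IsManifold.maximalAtlas 𝓘(ℂ) ω X, ∀ z ∈ e.target, e.symm z ∉ P →
    DifferentiableAt ℂ (pullCubic toFun e.symm) z

variable (X) in
/-- A smooth conformal Riemannian metric on the complement of `P`; `toFun x v` is the squared
length of the tangent vector `v` at `x`. -/
structure ConformalMetric (P : Set X) where
  toFun : ∀ x : X, TangentSpace 𝓘(ℂ) x → ℝ
  conformal : ∀ x ∉ P, ∀ (c : ℂ) (v : TangentSpace 𝓘(ℂ) x), toFun x (c • v) = ‖c‖ ^ 2 * toFun x v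
  pos : ∀ x ∉ P, ∀ v : TangentSpace 𝓘(ℂ) x, v ≠ 0 → 0 < toFun x v
  smooth : ∀ e ∈ IsManifold.maximalAtlas 𝓘(ℂ) ω X, ∀ z ∈ e.target, e.symm z ∉ P →
    ContDiffAt ℝ ∞ (pullMetric toFun e.symm) z

variable {P : Set X}

/-- `b` has at worst a pole at `p`. -/
def CubicDifferential.MeromorphicAt (b : CubicDifferential X P) (p : X) : Prop :=
  _root_.MeromorphicAt (pullCubic b.toFun (chartAt ℂ p).symm) (chartAt ℂ p p)

/-- The order of `b` at `p`; a pole of order `m` has order `-m`. -/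
def CubicDifferential.ord (b : CubicDifferential X P) (p : X) : WithTop ℤ :=
  meromorphicOrderAt (pullCubic b.toFun (chartAt ℂ p).symm) (chartAt ℂ p p)

/-- The squared pointwise norm of `b` with respect to `g`, that is `|f| ^ 2 / h ^ 3` for
`b = f dz ^ 3` and `g = h |dz| ^ 2`; it can be computed on any nonzero tangent vector. -/
def normSq (g : ConformalMetric X P) (b : CubicDifferential X P) (x : X) : ℝ :=
  ‖b.toFun x (1 : ℂ)‖ ^ 2 / g.toFun x (1 : ℂ) ^ 3

/-- The function `u = log (g / (2 ^ (1/3) |b| ^ (2/3)))` on the surface; the quotient can be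
computed on any nonzero tangent vector. -/
def logRatio (g : ConformalMetric X P) (b : CubicDifferential X P) (x : X) : ℝ :=
  Real.log (g.toFun x (1 : ℂ) /
    ((2 : ℝ) ^ (1 / 3 : ℝ) * ‖b.toFun x (1 : ℂ)‖ ^ (2 / 3 : ℝ)))

/-- The Gaussian curvature: `- Δ (log h) / (2 h)` for `g = h |dz| ^ 2` in a conformal coordinate. -/
def ConformalMetric.curvature (g : ConformalMetric X P) (x : X) : ℝ :=
  -(1 / (2 * pullMetric g.toFun (chartAt ℂ x).symm (chartAt ℂ x x))) *
    Laplacian.laplacian (fun z : ℂ => Real.log (pullMetric g.toFun (chartAt ℂ x).symm z))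
      (chartAt ℂ x x)

/-- The `g`-length of a path parametrized by the unit interval. -/
def ConformalMetric.length (g : ConformalMetric X P) (γ : ℝ → X) : ℝ≥0∞ :=
  ∫⁻ t in Icc (0 : ℝ) 1,
    ENNReal.ofReal (Real.sqrt (g.toFun (γ t) (mfderiv 𝓘(ℝ) 𝓘(ℝ, ℂ) γ t (1 : ℝ))))

/-- The distance of `g` on the complement of `P`: infimum of lengths of `C¹` paths avoiding `P`. -/
def ConformalMetric.edist (g : ConformalMetric X P) (x y : X) : ℝ≥0∞ :=
  ⨅ (γ : ℝ → X) (_ : ContMDiffOn 𝓘(ℝ) 𝓘(ℝ, ℂ) 1 γ (Icc 0 1))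
    (_ : ∀ t ∈ Icc (0 : ℝ) 1, γ t ∉ P) (_ : γ 0 = x) (_ : γ 1 = y), g.length γ

/-- Completeness: the distance to any point of the surface tends to infinity at every puncture.
(The closed surface being compact, this is completeness of `g` in the usual sense.) -/
def ConformalMetric.IsComplete (g : ConformalMetric X P) : Prop :=
  ∀ p ∈ P, ∀ y ∉ P, Tendsto (fun x => g.edist y x) (𝓝[Pᶜ] p) (𝓝 ⊤)

/-- `g` is the (unique) complete conformal metric solving Wang's equation `κ = -1 + 2 ‖b‖²` with
curvature pinched between constants `> -1` at the poles of order at least `3`, and tending to `-1`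
at the other punctures. -/
structure IsWangMetric (g : ConformalMetric X P) (b : CubicDifferential X P) : Prop where
  complete : g.IsComplete
  wang : ∀ x ∉ P, g.curvature x = -1 + 2 * normSq g b x
  pinched : ∀ p ∈ P, b.ord p ≤ ((-3 : ℤ) : WithTop ℤ) → ∃ α β : ℝ, -1 < α ∧ α < β ∧
    ∀ᶠ x in 𝓝[Pᶜ] p, α < g.curvature x ∧ g.curvature x < β
  cuspidal : ∀ p ∈ P, ((-2 : ℤ) : WithTop ℤ) ≤ b.ord p →
    Tendsto g.curvature (𝓝[Pᶜ] p) (𝓝 (-1))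

/-- `e` is a conformal local coordinate of the closed surface centered at `p`, whose image contains
the disk of radius `a`, and the punctured disk `0 < |z| < a` corresponds to a subset of the
punctured surface. -/
structure IsCoordinate (P : Set X) (p : X) (e : OpenPartialHomeomorph X ℂ) (a : ℝ) : Prop where
  mem_atlas : e ∈ IsManifold.maximalAtlas 𝓘(ℂ) ω X
  mem_source : p ∈ e.source
  map_center : e p = 0
  radius_pos : 0 < a
  ball_subset : Metric.ball 0 a ⊆ e.target
  notMem : ∀ z : ℂ, 0 < ‖z‖ → ‖z‖ < a → e.symm z ∉ P

/-- The punctured neighborhood `0 < |z| < a`. -/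
def puncturedDisk (e : OpenPartialHomeomorph X ℂ) (a : ℝ) : Set X :=
  e.symm '' {z : ℂ | 0 < ‖z‖ ∧ ‖z‖ < a}

/-- On `0 < |z| < a` the cubic differential has the normal form of a pole of order `n + 3 ≥ 4`:
`z ^ (-(n + 3)) dz ^ 3` if `3 ∤ n`, and `(z ^ (-l) + A / z) ^ 3 dz ^ 3` if `n + 3 = 3 l`. -/
def HasNormalForm (b : CubicDifferential X P) (n : ℕ) (e : OpenPartialHomeomorph X ℂ) (a : ℝ) :
    Prop :=
  (¬ 3 ∣ n → ∀ z : ℂ, 0 < ‖z‖ → ‖z‖ < a → pullCubic b.toFun e.symm z = 1 / z ^ (n + 3)) ∧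
  (∀ l : ℕ, n + 3 = 3 * l → ∃ A : ℂ, ∀ z : ℂ, 0 < ‖z‖ → ‖z‖ < a →
    pullCubic b.toFun e.symm z = (1 / z ^ l + A / z) ^ 3)

/-- On `0 < |z| < a` the cubic differential is `R z ^ (-3) dz ^ 3`. -/
def HasNormalFormThree (b : CubicDifferential X P) (R : ℂ) (e : OpenPartialHomeomorph X ℂ)
    (a : ℝ) : Prop :=
  ∀ z : ℂ, 0 < ‖z‖ → ‖z‖ < a → pullCubic b.toFun e.symm z = R / z ^ 3

/-- A natural half-plane at `p` in `U`: a conformal map from the closed right half-plane to `U`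
which pulls `b` back to `2 dζ ^ 3` and tends to `p` at infinity. -/
structure IsNaturalHalfPlane (b : CubicDifferential X P) (p : X) (U : Set X) (Φ : ℂ → X) :
    Prop where
  holomorphic : ∃ V : Set ℂ, IsOpen V ∧ {ζ : ℂ | 0 ≤ ζ.re} ⊆ V ∧ MDifferentiableOn 𝓘(ℂ) 𝓘(ℂ) Φ V
  mapsTo : MapsTo Φ {ζ : ℂ | 0 ≤ ζ.re} U
  pull_eq : ∀ ζ : ℂ, 0 ≤ ζ.re → pullCubic b.toFun Φ ζ = 2
  tendsto : Tendsto Φ (Bornology.cobounded ℂ ⊓ 𝓟 {ζ : ℂ | 0 ≤ ζ.re}) (𝓝 p)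

end Tensors

/-- The Wirtinger derivative `∂f = (∂f/∂x - i ∂f/∂y) / 2` of a real function. -/
def dWirtinger (f : ℂ → ℝ) (ζ : ℂ) : ℂ :=
  (1 / 2 : ℂ) * ((fderiv ℝ f ζ 1 : ℝ) - Complex.I * (fderiv ℝ f ζ Complex.I : ℝ))

/-- The half-plane `-r 𝐇`, where `𝐇` is the right half-plane. -/
def rotatedHalfPlane (r : ℂ) : Set ℂ :=
  (fun w : ℂ => -r * w) '' {w : ℂ | 0 < w.re}

/-- The local model `ζ ↦ exp (ζ / r)` around a third order pole, in the coordinate `e`. -/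
def thirdOrderModel {X : Type*} [TopologicalSpace X] (e : OpenPartialHomeomorph X ℂ) (r ζ : ℂ) :
    X :=
  e.symm (Complex.exp (ζ / r))

end WangEq

end

/-! Write `|b/2|^(2/3) = μ |dw|²` in a conformal coordinate `w`. Since `log |f|` is harmonic away
from the zeros of `b`, Wang's equation becomes `Δu = 4 μ (exp u - exp (-2u))`. Its linearization at
zero is `Δu = 12 μ u`, which gives the rate `2√3` per unit of flat length.

Two global facts start the argument, both through `2‖b‖² = exp (-3u)`, that is `κ = -1 + exp (-3u)`.
First, `u ≥ 0` means `κ ≤ 0` (`normSq_le_half`). It follows from the maximum principle for `log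
‖b‖²`, with a small power of a coordinate modulus as weight to handle the poles of order at least
three. Second, `κ > α > -1` near such a pole bounds `u` above (`eventually_logRatio_le`).

The decay is local. With `z = exp (-w)` a punctured disk becomes a half-infinite cylinder on which
`u` is bounded and `2πi`-periodic. There `exp u - 1` is a subsolution of the linearized equation,
because `(x - 1)³ ≥ 0` for `x = exp u ≥ 1`. Comparison with a supersolution `exp (-φ)`
(`le_supersolution_of_periodic`) gives `u ≤ C exp (-φ)`, and an interior gradient estimate transfers
the decay to the derivative.

At a pole of order three `μ` is constant and `φ` is linear in `Re w`. At a pole of order `n + 3 ≥ 4`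
one has `μ = c² |exp (m w) + A|²` with `m = n/3`, a flat cone end perturbed by the residue `A`. The
exponent `κ (exp (m s)/m + s Re (A exp (-imθ))) + (m/2) s`, where `w = s + iθ`, becomes a
supersolution exponent after an exponentially small correction
(`eventually_coneBarrier_supersolution`). Its last term is half the logarithm of the radius and
produces `|ζ|^(-1/2)`. The comparison runs on the whole punctured neighbourhood, so the boundary of
the half-plane plays no role and the decay is in `|ζ|`.

It remains to compare `w` with the natural coordinate. On a natural half-plane the equation for `b`
integrates to `exp (m w)/m + A w = c ζ + d`. The angle `Im w` is bounded there, and hence the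
exponent is at least `2√3 |ζ| + (log |ζ|)/2` up to a constant (`IsDeveloping.exists_le_conePhase`).
Bounded `ζ` are handled by compactness. -/

noncomputable section

namespace WangEq

open Laplacian

/-! ### Calculus of the Laplacian in the plane. -/

section PlanarLaplacian

theorem laplacian_eq_fderiv_fderiv (F : ℂ → ℝ) (z : ℂ) :
    Δ F z = fderiv ℝ (fderiv ℝ F) z 1 1 + fderiv ℝ (fderiv ℝ F) z Complex.I Complex.I := by
  rw [InnerProductSpace.laplacian_eq_iteratedFDeriv_complexPlane]
  simp [iteratedFDeriv_two_apply]

theorem hasDerivAt_line (z v : ℂ) (t : ℝ) :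
    HasDerivAt (fun t : ℝ => z + t * v) v t := by
  simpa using ((Complex.ofRealCLM.hasDerivAt (x := t)).mul_const v).const_add z

theorem tendsto_line (z v : ℂ) : Tendsto (fun t : ℝ => z + t * v) (𝓝 0) (𝓝 z) := by
  have : Continuous (fun t : ℝ => z + t * v) := by fun_prop
  simpa using this.tendsto 0

theorem eventually_hasDerivAt_line {F : ℂ → ℝ} {z : ℂ} (hF : ContDiffAt ℝ 2 F z) (v : ℂ) :
    ∀ᶠ t : ℝ in 𝓝 0, HasDerivAt (fun t : ℝ => F (z + t * v)) (fderiv ℝ F (z + t * v) v) t := by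
  have h1 : ∀ᶠ y in 𝓝 z, DifferentiableAt ℝ F y := by
    filter_upwards [hF.eventually (by simp)] with y hy using hy.differentiableAt (by simp)
  filter_upwards [(tendsto_line z v).eventually h1] with t ht
  exact ht.hasFDerivAt.comp_hasDerivAt t (hasDerivAt_line z v t)

theorem hasDerivAt_fderiv_line {F : ℂ → ℝ} {z : ℂ} (hF : ContDiffAt ℝ 2 F z) (v : ℂ) :
    HasDerivAt (fun t : ℝ => fderiv ℝ F (z + t * v) v) (fderiv ℝ (fderiv ℝ F) z v v) 0 := by
  have h1 : DifferentiableAt ℝ (fderiv ℝ F) z :=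
    (hF.fderiv_right (m := 1) (by norm_num)).differentiableAt (by simp)
  have h2 : HasFDerivAt (fderiv ℝ F) (fderiv ℝ (fderiv ℝ F) z) (z + (0 : ℝ) * v) := by
    simpa using h1.hasFDerivAt
  have h3 := h2.comp_hasDerivAt (0 : ℝ) (hasDerivAt_line z v 0)
  simpa using h3.clm_apply (hasDerivAt_const (0 : ℝ) v)

/-- Reduces a diagonal Hessian entry to one-variable calculus. The Laplacians of compositions,
exponentials and barriers are obtained from it in the directions `1` and `Complex.I`. -/
theorem fderiv_fderiv_eq_of_line {F : ℂ → ℝ} {z v : ℂ} (hF : ContDiffAt ℝ 2 F z) {g : ℝ → ℝ}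
    {c : ℝ} (h : ∀ᶠ t : ℝ in 𝓝 0, HasDerivAt (fun t : ℝ => F (z + t * v)) (g t) t)
    (hg : HasDerivAt g c 0) : fderiv ℝ (fderiv ℝ F) z v v = c := by
  refine (hasDerivAt_fderiv_line hF v).unique (hg.congr_of_eventuallyEq ?_)
  filter_upwards [h, eventually_hasDerivAt_line hF v] with t h1 h2 using h2.unique h1

/-- The second derivative test along a line. -/
theorem fderiv_fderiv_nonpos_of_isLocalMax {F : ℂ → ℝ} {z : ℂ} (hF : ContDiffAt ℝ 2 F z)
    (hz : IsLocalMax F z) (v : ℂ) : fderiv ℝ (fderiv ℝ F) z v v ≤ 0 := by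
  by_contra! hpos
  set f : ℝ → ℝ := fun t => F (z + t * v) with hf
  have hd : deriv f =ᶠ[𝓝 0] fun t => fderiv ℝ F (z + t * v) v := by
    filter_upwards [eventually_hasDerivAt_line hF v] with t h using h.deriv
  have hdd : deriv (deriv f) 0 = fderiv ℝ (fderiv ℝ F) z v v := by
    rw [hd.deriv_eq]; exact (hasDerivAt_fderiv_line hF v).deriv
  have hmax : IsLocalMax f 0 := by
    have := (tendsto_line z v).eventually hz
    filter_upwards [this] with t ht
    simpa [hf] using ht
  have h0 : deriv f 0 = 0 := hmax.deriv_eq_zero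
  have hcont : ContinuousAt f 0 := (eventually_hasDerivAt_line hF v).self_of_nhds.continuousAt
  -- A positive second derivative would make the maximum also a local minimum, so `f` would be
  -- locally constant and its second derivative zero.
  have hmin := isLocalMin_of_deriv_deriv_pos (by rw [hdd]; exact hpos) h0 hcont
  have hconst : f =ᶠ[𝓝 0] fun _ => f 0 := by
    filter_upwards [hmax, hmin] with t h1 h2 using le_antisymm h1 h2
  have : deriv (deriv f) 0 = 0 := by
    rw [hconst.deriv.deriv_eq]; simp
  linarith

theorem laplacian_nonpos_of_isLocalMax {F : ℂ → ℝ} {z : ℂ} (hF : ContDiffAt ℝ 2 F z)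
    (hz : IsLocalMax F z) : Δ F z ≤ 0 := by
  rw [laplacian_eq_fderiv_fderiv]
  linarith [fderiv_fderiv_nonpos_of_isLocalMax hF hz 1,
    fderiv_fderiv_nonpos_of_isLocalMax hF hz Complex.I]

theorem contDiffAt_two_comp_analyticAt {F : ℂ → ℝ} {φ : ℂ → ℂ} {y : ℂ} {n : ℕ∞ω}
    (hF : ContDiffAt ℝ n F (φ y)) (hφ : AnalyticAt ℂ φ y) : ContDiffAt ℝ n (fun x => F (φ x)) y :=
  hF.comp y (hφ.contDiffAt.restrict_scalars ℝ)

/-- The Laplacian is conformally covariant. -/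
theorem laplacian_comp_analyticAt {F : ℂ → ℝ} {φ : ℂ → ℂ} {y : ℂ}
    (hF : ContDiffAt ℝ 2 F (φ y)) (hφ : AnalyticAt ℂ φ y) :
    Δ (fun x => F (φ x)) y = ‖deriv φ y‖ ^ 2 * Δ F (φ y) := by
  have hFφ := contDiffAt_two_comp_analyticAt hF hφ
  set D := fderiv ℝ (fderiv ℝ F) (φ y) with hD
  have key : ∀ v : ℂ, fderiv ℝ (fderiv ℝ (fun x => F (φ x))) y v v =
      D (deriv φ y * v) (deriv φ y * v) + fderiv ℝ F (φ y) (deriv (deriv φ) y * v * v) := by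
    intro v
    have hev : ∀ᶠ x in 𝓝 y, AnalyticAt ℂ φ x ∧ DifferentiableAt ℝ F (φ x) := by
      refine hφ.eventually_analyticAt.and ?_
      refine hφ.continuousAt.eventually ?_
      filter_upwards [hF.eventually (by simp)] with x hx using hx.differentiableAt (by simp)
    have hφd : ∀ t : ℝ, AnalyticAt ℂ φ (y + t * v) →
        HasDerivAt (fun t : ℝ => φ (y + t * v)) (deriv φ (y + t * v) * v) t := by
      intro t ht
      exact HasDerivAt.comp t ht.differentiableAt.hasDerivAt (hasDerivAt_line y v t)
    refine fderiv_fderiv_eq_of_line hFφ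
      (g := fun t : ℝ => fderiv ℝ F (φ (y + t * v)) (deriv φ (y + t * v) * v)) ?_ ?_
    · filter_upwards [(tendsto_line y v).eventually hev] with t ht
      exact ht.2.hasFDerivAt.comp_hasDerivAt t (hφd t ht.1)
    · have h1 : DifferentiableAt ℝ (fderiv ℝ F) (φ y) :=
        (hF.fderiv_right (m := 1) (by norm_num)).differentiableAt (by simp)
      have h2 : HasFDerivAt (fderiv ℝ F) D (φ (y + (0 : ℝ) * v)) := by
        simpa using h1.hasFDerivAt
      have h3 := h2.comp_hasDerivAt (0 : ℝ) (hφd 0 (by simpa using hφ))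
      have h4 : HasDerivAt (fun t : ℝ => deriv φ (y + t * v) * v)
          (deriv (deriv φ) y * v * v) 0 := by
        have h5 : HasDerivAt (deriv φ) (deriv (deriv φ) y) (y + (0 : ℝ) * v) := by
          simpa using hφ.deriv.differentiableAt.hasDerivAt
        exact (HasDerivAt.comp (0 : ℝ) h5 (hasDerivAt_line y v 0)).mul_const v
      simpa using h3.clm_apply h4
  rw [laplacian_eq_fderiv_fderiv, laplacian_eq_fderiv_fderiv, key, key, ← hD]
  -- The first-order terms carry `φ'' v²`, and they cancel because `1² + i² = 0`.
  have h1 : fderiv ℝ F (φ y) (deriv (deriv φ) y * 1 * 1) +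
      fderiv ℝ F (φ y) (deriv (deriv φ) y * Complex.I * Complex.I) = 0 := by
    rw [← map_add, mul_assoc _ Complex.I, Complex.I_mul_I]; simp
  obtain ⟨a, b, hab⟩ : ∃ a b : ℝ, deriv φ y = a + b * Complex.I :=
    ⟨_, _, (Complex.re_add_im _).symm⟩
  have e1 : deriv φ y * 1 = a • (1 : ℂ) + b • Complex.I := by simp [hab]
  have e2 : deriv φ y * Complex.I = (-b) • (1 : ℂ) + a • Complex.I := by
    simp only [hab, Complex.real_smul]; push_cast; ring_nf; simp; ring
  have e3 : ‖deriv φ y‖ ^ 2 = a ^ 2 + b ^ 2 := by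
    rw [hab, ← Complex.normSq_eq_norm_sq, Complex.normSq_add_mul_I]
  rw [e1, e2, e3]
  simp only [map_add, map_smul, add_apply, smul_apply, smul_eq_mul]
  linear_combination h1

theorem fderiv_fderiv_exp {u : ℂ → ℝ} {z : ℂ} (hu : ContDiffAt ℝ 2 u z) (v : ℂ) :
    fderiv ℝ (fderiv ℝ (fun x => Real.exp (u x))) z v v =
      Real.exp (u z) * (fderiv ℝ u z v ^ 2 + fderiv ℝ (fderiv ℝ u) z v v) := by
  refine fderiv_fderiv_eq_of_line hu.exp
    (g := fun t : ℝ => Real.exp (u (z + t * v)) * fderiv ℝ u (z + t * v) v) ?_ ?_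
  · filter_upwards [eventually_hasDerivAt_line hu v] with t ht using ht.exp
  · have h := (eventually_hasDerivAt_line hu v).self_of_nhds.exp.mul (hasDerivAt_fderiv_line hu v)
    refine h.congr_deriv ?_
    simp only [Complex.ofReal_zero, zero_mul, add_zero]
    ring

theorem laplacian_exp {u : ℂ → ℝ} {z : ℂ} (hu : ContDiffAt ℝ 2 u z) :
    Δ (fun x => Real.exp (u x)) z =
      Real.exp (u z) * (fderiv ℝ u z 1 ^ 2 + fderiv ℝ u z Complex.I ^ 2 + Δ u z) := by
  simp only [laplacian_eq_fderiv_fderiv, fderiv_fderiv_exp hu]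
  ring

theorem laplacian_fun_add {f g : ℂ → ℝ} {z : ℂ} (hf : ContDiffAt ℝ 2 f z)
    (hg : ContDiffAt ℝ 2 g z) : Δ (fun x => f x + g x) z = Δ f z + Δ g z :=
  hf.laplacian_add hg

theorem laplacian_fun_sub {f g : ℂ → ℝ} {z : ℂ} (hf : ContDiffAt ℝ 2 f z)
    (hg : ContDiffAt ℝ 2 g z) : Δ (fun x => f x - g x) z = Δ f z - Δ g z :=
  hf.laplacian_sub hg

theorem laplacian_const_mul {f : ℂ → ℝ} {z : ℂ} (c : ℝ) (hf : ContDiffAt ℝ 2 f z) :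
    Δ (fun x => c * f x) z = c * Δ f z :=
  InnerProductSpace.laplacian_smul c hf

theorem laplacian_sub_const {f : ℂ → ℝ} {z : ℂ} (c : ℝ) (hf : ContDiffAt ℝ 2 f z) :
    Δ (fun x => f x - c) z = Δ f z := by
  rw [laplacian_fun_sub hf contDiffAt_const]; simp

end PlanarLaplacian

/-! ### Comparison principle on a half-infinite cylinder. -/

section MaximumPrinciple

theorem contDiff_re {n : ℕ∞ω} : ContDiff ℝ n (fun z : ℂ => z.re) := Complex.reCLM.contDiff

theorem contDiff_im {n : ℕ∞ω} : ContDiff ℝ n (fun z : ℂ => z.im) := Complex.imCLM.contDiff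

theorem laplacian_re (z : ℂ) : Δ (fun z : ℂ => z.re) z = 0 := by
  have h := (analyticAt_id (𝕜 := ℂ) (z := z)).harmonicAt_re.2.self_of_nhds
  simpa using h

theorem exists_int_periodic_shift {G : ℂ → ℝ}
    (hG : ∀ w, G (w + 2 * Real.pi * Complex.I) = G w) (w : ℂ) :
    ∃ w' : ℂ, w'.re = w.re ∧ w'.im ∈ Icc 0 (2 * Real.pi) ∧ G w' = G w := by
  have hp : Function.Periodic G (2 * Real.pi * Complex.I) := hG
  refine ⟨w - (toIcoDiv Real.two_pi_pos 0 w.im : ℤ) * (2 * Real.pi * Complex.I), ?_, ?_, ?_⟩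
  · simp
  · have h := toIcoMod_mem_Ico Real.two_pi_pos 0 w.im
    rw [toIcoMod, zero_add] at h
    have e : (w - (toIcoDiv Real.two_pi_pos 0 w.im : ℤ) * (2 * Real.pi * Complex.I)).im =
        w.im - toIcoDiv Real.two_pi_pos 0 w.im • (2 * Real.pi) := by
      simp
    rw [e]; exact ⟨h.1, h.2.le⟩
  · simpa using hp.sub_zsmul_eq (x := w) (toIcoDiv Real.two_pi_pos 0 w.im)

/-- Comparison principle on a half-infinite cylinder for bounded subsolutions of `Δ Y = c Y`. -/
theorem le_supersolution_of_periodic {Y v c : ℂ → ℝ} {s M : ℝ}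
    (hYp : ∀ w, Y (w + 2 * Real.pi * Complex.I) = Y w)
    (hvp : ∀ w, v (w + 2 * Real.pi * Complex.I) = v w)
    (hY : ∀ w : ℂ, s ≤ w.re → ContDiffAt ℝ 2 Y w) (hv : ∀ w : ℂ, s ≤ w.re → ContDiffAt ℝ 2 v w)
    (hM : ∀ w : ℂ, s ≤ w.re → Y w ≤ M) (hv0 : ∀ w : ℂ, s ≤ w.re → 0 ≤ v w)
    (hc : ∀ w : ℂ, s < w.re → 0 < c w)
    (hΔY : ∀ w : ℂ, s < w.re → c w * Y w ≤ Δ Y w) (hΔv : ∀ w : ℂ, s < w.re → Δ v w ≤ c w * v w)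
    (hb : ∀ w : ℂ, w.re = s → Y w ≤ v w) (w : ℂ) (hw : s ≤ w.re) : Y w ≤ v w := by
  by_contra! hlt
  -- The cylinder is not compact, so a small harmonic tilt is subtracted. The `+ 1` in the
  -- denominator covers the case `w.re = s`.
  obtain ⟨ε, hε, hεw⟩ : ∃ ε > 0, ε * (w.re - s) < Y w - v w := by
    refine ⟨(Y w - v w) / (w.re - s + 1), div_pos (by linarith) (by linarith), ?_⟩
    rw [div_mul_eq_mul_div, div_lt_iff₀ (by linarith)]
    nlinarith
  set G : ℂ → ℝ := fun z => Y z - v z - ε * (z.re - s) with hGdef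
  have hGp : ∀ z, G (z + 2 * Real.pi * Complex.I) = G z := by
    intro z; simp [hGdef, hYp, hvp]
  have hGw : 0 < G w := by simp only [hGdef]; linarith
  -- Beyond `S` the tilt exceeds `|M|`, so one period of a bounded strip contains the maximum.
  set S : ℝ := max w.re (s + |M| / ε) with hS
  have hGS : ∀ z : ℂ, S ≤ z.re → G z ≤ 0 := by
    intro z hz
    have h1 : s + |M| / ε ≤ z.re := (le_max_right _ _).trans hz
    have h0 : s ≤ z.re := le_trans (by have := div_nonneg (abs_nonneg M) hε.le; linarith) h1
    have h2 : |M| ≤ ε * (z.re - s) := by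
      have : |M| / ε ≤ z.re - s := by linarith
      rw [div_le_iff₀ hε] at this; linarith
    have h3 := hM z h0
    have h4 := hv0 z h0
    have h5 := le_abs_self M
    simp only [hGdef]; linarith
  have hcd : ∀ z : ℂ, s ≤ z.re → ContDiffAt ℝ 2 G z := by
    intro z hz
    exact ((hY z hz).sub (hv z hz)).sub
      (contDiffAt_const.mul (contDiff_re.contDiffAt.sub contDiffAt_const))
  have hK : IsCompact (Icc s S ×ℂ Icc 0 (2 * Real.pi)) := isCompact_Icc.reProdIm isCompact_Icc
  have hwS : w.re ≤ S := le_max_left _ _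
  obtain ⟨w', hw're, hw'im, hGw'⟩ := exists_int_periodic_shift hGp w
  obtain ⟨z, hzK, hzmax⟩ := hK.exists_isMaxOn
    ⟨w', by rw [Complex.mem_reProdIm]; exact ⟨⟨by linarith, by linarith⟩, hw'im⟩⟩
    (f := G) (fun x hx => by
      rw [Complex.mem_reProdIm] at hx
      exact (hcd x hx.1.1).continuousAt.continuousWithinAt)
  rw [Complex.mem_reProdIm] at hzK
  have hall : ∀ x : ℂ, s ≤ x.re → x.re ≤ S → G x ≤ G z := by
    intro x h1 h2
    obtain ⟨x', hx're, hx'im, hGx'⟩ := exists_int_periodic_shift hGp x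
    rw [← hGx']
    exact hzmax (by rw [Complex.mem_reProdIm]; exact ⟨⟨by linarith, by linarith⟩, hx'im⟩)
  have hGz : 0 < G z := hGw.trans_le (hall w hw hwS)
  have hz1 : s < z.re := by
    refine lt_of_le_of_ne hzK.1.1 fun h => ?_
    have := hb z h.symm
    simp only [hGdef, ← h] at hGz
    linarith
  have hz2 : z.re < S := by
    refine lt_of_le_of_ne hzK.1.2 fun h => ?_
    linarith [hGS z h.ge]
  have hmax : IsLocalMax G z := by
    have h1 : ∀ᶠ x : ℂ in 𝓝 z, s < x.re := Complex.continuous_re.continuousAt.eventually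
      (lt_mem_nhds hz1)
    have h2 : ∀ᶠ x : ℂ in 𝓝 z, x.re < S := Complex.continuous_re.continuousAt.eventually
      (gt_mem_nhds hz2)
    filter_upwards [h1, h2] with x h1 h2 using hall x h1.le h2.le
  have hΔ := laplacian_nonpos_of_isLocalMax (hcd z hz1.le) hmax
  have hΔG : Δ G z = Δ Y z - Δ v z := by
    have hr : ContDiffAt ℝ 2 (fun z : ℂ => z.re - s) z :=
      contDiff_re.contDiffAt.sub contDiffAt_const
    rw [hGdef, laplacian_fun_sub ((hY z hz1.le).sub (hv z hz1.le)) (contDiffAt_const.mul hr),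
      laplacian_fun_sub (hY z hz1.le) (hv z hz1.le), laplacian_const_mul ε hr,
      laplacian_sub_const _ contDiff_re.contDiffAt, laplacian_re]
    ring
  -- At the maximum `c (Y - v) ≤ ΔY - Δv = ΔG ≤ 0`, although `c > 0` and `Y - v > 0`.
  have h1 := hΔY z hz1
  have h2 := hΔv z hz1
  have h3 : 0 < Y z - v z := by
    have : 0 ≤ ε * (z.re - s) := mul_nonneg hε.le (by linarith)
    simp only [hGdef] at hGz; linarith
  nlinarith [mul_pos (hc z hz1) h3]

end MaximumPrinciple

/-! ### Interior gradient estimate by barriers. -/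

section GradientEstimate

theorem laplacian_comp_conj {F : ℂ → ℝ} {z : ℂ} (hF : ContDiffAt ℝ 2 F (starRingEnd ℂ z)) :
    Δ (fun x => F (starRingEnd ℂ x)) z = Δ F (starRingEnd ℂ z) := by
  have hc : ContDiffAt ℝ 2 (fun x => F (starRingEnd ℂ x)) z :=
    ContDiffAt.comp z hF Complex.conjCLE.contDiff.contDiffAt
  have key : ∀ v : ℂ, fderiv ℝ (fderiv ℝ (fun x => F (starRingEnd ℂ x))) z v v =
      fderiv ℝ (fderiv ℝ F) (starRingEnd ℂ z) (starRingEnd ℂ v) (starRingEnd ℂ v) := by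
    intro v
    refine fderiv_fderiv_eq_of_line hc ?_ (hasDerivAt_fderiv_line hF (starRingEnd ℂ v))
    filter_upwards [eventually_hasDerivAt_line hF (starRingEnd ℂ v)] with t ht
    simpa using ht
  rw [laplacian_eq_fderiv_fderiv, laplacian_eq_fderiv_fderiv, key, key]
  simp

/-- The barrier of the gradient estimate has constant Laplacian. -/
theorem laplacian_quadratic (α β γ : ℝ) (z : ℂ) :
    Δ (fun z : ℂ => α * z.re ^ 2 + β * z.im + γ * z.im ^ 2) z = 2 * α + 2 * γ := by
  have hc : ContDiffAt ℝ 2 (fun z : ℂ => α * z.re ^ 2 + β * z.im + γ * z.im ^ 2) z :=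
    (((contDiff_const.mul (contDiff_re.pow 2)).add (contDiff_const.mul contDiff_im)).add
      (contDiff_const.mul (contDiff_im.pow 2))).contDiffAt
  rw [laplacian_eq_fderiv_fderiv]
  congr 1
  · refine fderiv_fderiv_eq_of_line hc (g := fun t => 2 * α * (z.re + t)) (.of_forall ?_) ?_
    · intro t
      have h : HasDerivAt (fun t : ℝ => α * (z.re + t) ^ 2 + β * z.im + γ * z.im ^ 2)
          (α * (2 * (z.re + t) ^ (2 - 1) * 1)) t :=
        (((((hasDerivAt_id t).const_add z.re).pow 2).const_mul α).add_const _).add_const _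
      convert h using 1
      · ext t; simp
      · ring
    · simpa using ((hasDerivAt_id (0 : ℝ)).const_add z.re).const_mul (2 * α)
  · refine fderiv_fderiv_eq_of_line hc (g := fun t => β + 2 * γ * (z.im + t)) (.of_forall ?_) ?_
    · intro t
      have h : HasDerivAt (fun t : ℝ => α * z.re ^ 2 + β * (z.im + t) + γ * (z.im + t) ^ 2)
          (β * 1 + γ * (2 * (z.im + t) ^ (2 - 1) * 1)) t :=
        ((((hasDerivAt_id t).const_add z.im).const_mul β).const_add _).add
          ((((hasDerivAt_id t).const_add z.im).pow 2).const_mul γ)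
      convert h using 1
      · ext t; simp
      · ring
    · simpa using (((hasDerivAt_id (0 : ℝ)).const_add z.im).const_mul (2 * γ)).const_add β

/-- The part of `F` odd under conjugation vanishes on the real axis and is at most `M`. The barrier
`ψ` has Laplacian `-N`, is nonnegative on the real side of the half-square and at least `M` on the
other three sides. Thus `G`, the odd part minus `ψ`, has positive Laplacian and is nonpositive on
the boundary, hence nonpositive inside. Comparing slopes at `0` gives the bound. -/
theorem fderiv_I_le_of_laplacian_lt {F : ℂ → ℝ} {d M N : ℝ} (hd : 0 < d)
    (hF : ∀ z : ℂ, |z.re| ≤ d → |z.im| ≤ d → ContDiffAt ℝ 2 F z)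
    (hM : ∀ z : ℂ, |z.re| ≤ d → |z.im| ≤ d → |F z| ≤ M)
    (hN : ∀ z : ℂ, |z.re| ≤ d → |z.im| ≤ d → |Δ F z| < N) :
    fderiv ℝ F 0 Complex.I ≤ 2 * M / d + N * d / 2 := by
  set ψ : ℂ → ℝ := fun z => (M / d ^ 2) * z.re ^ 2 + (2 * M / d + N * d / 2) * z.im +
    (-(M / d ^ 2) - N / 2) * z.im ^ 2 with hψ
  have hψc : ContDiff ℝ 2 ψ :=
    ((contDiff_const.mul (contDiff_re.pow 2)).add (contDiff_const.mul contDiff_im)).add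
      (contDiff_const.mul (contDiff_im.pow 2))
  set G : ℂ → ℝ := fun z => 1 / 2 * (F z - F (starRingEnd ℂ z)) - ψ z with hG
  have hFc : ∀ z : ℂ, |z.re| ≤ d → |z.im| ≤ d →
      ContDiffAt ℝ 2 (fun x => F (starRingEnd ℂ x)) z := fun z h1 h2 =>
    ContDiffAt.comp z (hF _ (by simpa using h1) (by simpa using h2))
      Complex.conjCLE.contDiff.contDiffAt
  have hGc : ∀ z : ℂ, |z.re| ≤ d → |z.im| ≤ d → ContDiffAt ℝ 2 G z := fun z h1 h2 =>
    (contDiffAt_const.mul ((hF z h1 h2).sub (hFc z h1 h2))).sub hψc.contDiffAt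
  have hGΔ : ∀ z : ℂ, |z.re| ≤ d → |z.im| ≤ d → 0 < Δ G z := by
    intro z h1 h2
    have h3 : |(starRingEnd ℂ z).re| ≤ d := by simpa using h1
    have h4 : |(starRingEnd ℂ z).im| ≤ d := by simpa using h2
    have := abs_lt.1 (hN z h1 h2)
    have := abs_lt.1 (hN _ h3 h4)
    rw [hG, laplacian_fun_sub (contDiffAt_const.mul ((hF z h1 h2).sub (hFc z h1 h2)))
      hψc.contDiffAt, laplacian_const_mul _ ((hF z h1 h2).sub (hFc z h1 h2)),
      laplacian_fun_sub (hF z h1 h2) (hFc z h1 h2), laplacian_comp_conj (hF _ h3 h4), hψ,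
      laplacian_quadratic]
    linarith
  have hK : IsCompact (Icc (-d) d ×ℂ Icc 0 d) := isCompact_Icc.reProdIm isCompact_Icc
  have hKd : ∀ z ∈ Icc (-d) d ×ℂ Icc 0 d, |z.re| ≤ d ∧ |z.im| ≤ d := by
    intro z hz
    rw [Complex.mem_reProdIm] at hz
    exact ⟨abs_le.2 hz.1, abs_le.2 ⟨by linarith [hz.2.1], hz.2.2⟩⟩
  obtain ⟨z, hzK, hzmax⟩ := hK.exists_isMaxOn
    ⟨0, by rw [Complex.mem_reProdIm]; simp [hd.le]⟩
    (f := G) (fun x hx => (hGc x (hKd x hx).1 (hKd x hx).2).continuousAt.continuousWithinAt)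
  have hM0 : 0 ≤ M := (abs_nonneg _).trans (hM 0 (by simp [hd.le]) (by simp [hd.le]))
  have hN0 : 0 ≤ N := (abs_nonneg _).trans (hN 0 (by simp [hd.le]) (by simp [hd.le])).le
  have hGz : G z ≤ 0 := by
    obtain ⟨hz1, hz2⟩ := hKd z hzK
    have hzK' := hzK
    rw [Complex.mem_reProdIm] at hzK'
    obtain ⟨⟨ha, hb⟩, hc, he⟩ := hzK'
    have hb1 := abs_le.1 (hM z hz1 hz2)
    have hb2 := abs_le.1 (hM (starRingEnd ℂ z) (by simpa using hz1) (by simpa using hz2))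
    have hGle : G z ≤ M - ψ z := by
      simp only [hG]
      linarith
    -- In this form the first bracket is visibly at least `d ^ 2` on the top and lateral sides.
    have hψeq : ψ z = M / d ^ 2 * (z.re ^ 2 + z.im * (2 * d - z.im)) +
        N / 2 * (z.im * (d - z.im)) := by
      simp only [hψ]; field_simp; ring
    have hq : 0 ≤ N / 2 * (z.im * (d - z.im)) :=
      mul_nonneg (by linarith) (mul_nonneg hc (by linarith))
    have hMd : M / d ^ 2 * d ^ 2 = M := by field_simp
    have hMd0 : 0 ≤ M / d ^ 2 := by positivity
    rcases eq_or_lt_of_le hc with h | h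
    · have hzc : starRingEnd ℂ z = z := Complex.conj_eq_iff_im.2 h.symm
      have : ψ z = M / d ^ 2 * z.re ^ 2 := by rw [hψeq, ← h]; ring
      have h0 : 0 ≤ M / d ^ 2 * z.re ^ 2 := by positivity
      simp only [hG, hzc]
      linarith
    · rcases eq_or_lt_of_le he with h' | h'
      · have : d ^ 2 ≤ z.re ^ 2 + z.im * (2 * d - z.im) := by rw [h']; nlinarith [sq_nonneg z.re]
        nlinarith [mul_le_mul_of_nonneg_left this hMd0]
      · by_cases hre : |z.re| = d
        · have h2 : z.re ^ 2 = d ^ 2 := by rw [← sq_abs, hre]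
          have : d ^ 2 ≤ z.re ^ 2 + z.im * (2 * d - z.im) := by
            nlinarith [mul_nonneg hc (by linarith : 0 ≤ 2 * d - z.im)]
          nlinarith [mul_le_mul_of_nonneg_left this hMd0]
        · exfalso
          have hre' := abs_lt.1 (lt_of_le_of_ne hz1 hre)
          have hnhds : Icc (-d) d ×ℂ Icc 0 d ∈ 𝓝 z := by
            have e1 : ∀ᶠ x : ℂ in 𝓝 z, x.re ∈ Icc (-d) d :=
              Complex.continuous_re.continuousAt.eventually (Icc_mem_nhds hre'.1 hre'.2)
            have e2 : ∀ᶠ x : ℂ in 𝓝 z, x.im ∈ Icc 0 d :=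
              Complex.continuous_im.continuousAt.eventually (Icc_mem_nhds h h')
            filter_upwards [e1, e2] with x h1 h2
            rw [Complex.mem_reProdIm]; exact ⟨h1, h2⟩
          have := laplacian_nonpos_of_isLocalMax (hGc z hz1 hz2) (hzmax.isLocalMax hnhds)
          linarith [hGΔ z hz1 hz2]
  have hF0 : HasDerivAt (fun t : ℝ => F (0 + t * Complex.I)) (fderiv ℝ F 0 Complex.I) 0 := by
    simpa using (eventually_hasDerivAt_line (hF 0 (by simp [hd.le]) (by simp [hd.le]))
      Complex.I).self_of_nhds
  have hF1 : HasDerivAt (fun t : ℝ => F (0 + t * -Complex.I)) (-fderiv ℝ F 0 Complex.I) 0 := by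
    simpa using (eventually_hasDerivAt_line (hF 0 (by simp [hd.le]) (by simp [hd.le]))
      (-Complex.I)).self_of_nhds
  -- The right slope at `0` of `t ↦ F (ti) - F (-ti)` is twice the wanted derivative, and `G ≤ 0`
  -- bounds it by twice the slope of `ψ`.
  have hsl := (hF0.sub hF1).tendsto_slope_zero_right
  have hle : ∀ᶠ t : ℝ in 𝓝[>] 0, t⁻¹ • (((fun t : ℝ => F (0 + t * Complex.I)) -
      fun t : ℝ => F (0 + t * -Complex.I)) (0 + t) - ((fun t : ℝ => F (0 + t * Complex.I)) -
      fun t : ℝ => F (0 + t * -Complex.I)) 0) ≤ 2 * (2 * M / d + N * d / 2) := by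
    filter_upwards [Ioc_mem_nhdsGT hd] with t ht
    have h1 : G (t * Complex.I) ≤ 0 := by
      refine (hzmax ?_).trans hGz
      rw [Complex.mem_reProdIm]; simp [hd.le, ht.1.le, ht.2]
    simp only [hG, hψ] at h1
    simp only [Pi.sub_apply, smul_eq_mul, zero_add]
    simp only [map_mul, Complex.conj_ofReal, Complex.conj_I, Complex.mul_re, Complex.ofReal_re,
      Complex.I_re, Complex.ofReal_im, Complex.I_im, Complex.mul_im] at h1
    rw [inv_mul_le_iff₀ ht.1]
    have : 0 ≤ (M / d ^ 2 + N / 2) * t ^ 2 := by positivity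
    simp at h1 ⊢
    nlinarith
  have := le_of_tendsto hsl hle
  linarith

/-- Interior gradient estimate for Poisson's equation. -/
theorem norm_fderiv_le_of_laplacian_lt {F : ℂ → ℝ} {w : ℂ} {d M N : ℝ} (hd : 0 < d)
    (hF : ∀ z : ℂ, |(z - w).re| ≤ d → |(z - w).im| ≤ d → ContDiffAt ℝ 2 F z)
    (hM : ∀ z : ℂ, |(z - w).re| ≤ d → |(z - w).im| ≤ d → |F z| ≤ M)
    (hN : ∀ z : ℂ, |(z - w).re| ≤ d → |(z - w).im| ≤ d → |Δ F z| < N) :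
    ‖fderiv ℝ F w‖ ≤ 4 * M / d + N * d := by
  -- Rotations by powers of `i` preserve the square, so the one-sided bound in one direction yields
  -- both signs of both partial derivatives.
  have key : ∀ c : ℂ, (c = 1 ∨ c = -1 ∨ c = Complex.I ∨ c = -Complex.I) →
      fderiv ℝ F w (c * Complex.I) ≤ 2 * M / d + N * d / 2 := by
    intro c hc
    have hcn : ‖c‖ = 1 := by rcases hc with rfl | rfl | rfl | rfl <;> simp
    have hsq : ∀ z : ℂ, |z.re| ≤ d → |z.im| ≤ d →
        |(w + c * z - w).re| ≤ d ∧ |(w + c * z - w).im| ≤ d := by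
      intro z h1 h2
      rcases hc with rfl | rfl | rfl | rfl <;> simp [h1, h2]
    have han : ∀ z : ℂ, AnalyticAt ℂ (fun z : ℂ => w + c * z) z := fun z => by fun_prop
    have hder : ∀ z : ℂ, deriv (fun z : ℂ => w + c * z) z = c := fun z => by simp
    have hFw : DifferentiableAt ℝ F w :=
      (hF w (by simp [hd.le]) (by simp [hd.le])).differentiableAt (by simp)
    have h := fderiv_I_le_of_laplacian_lt (F := fun z => F (w + c * z)) (M := M) (N := N) hd
      (fun z h1 h2 => contDiffAt_two_comp_analyticAt
        (hF _ (hsq z h1 h2).1 (hsq z h1 h2).2) (han z))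
      (fun z h1 h2 => hM _ (hsq z h1 h2).1 (hsq z h1 h2).2)
      (fun z h1 h2 => by
        rw [laplacian_comp_analyticAt (φ := fun z => w + c * z)
          (hF _ (hsq z h1 h2).1 (hsq z h1 h2).2) (han z), hder, hcn]
        simpa using hN _ (hsq z h1 h2).1 (hsq z h1 h2).2)
    have hl : HasDerivAt (fun t : ℝ => F (w + c * (0 + t * Complex.I)))
        (fderiv ℝ F w (c * Complex.I)) 0 := by
      have h1 : HasFDerivAt F (fderiv ℝ F w) (w + c * (0 + (0 : ℝ) * Complex.I)) := by
        simpa using hFw.hasFDerivAt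
      exact h1.comp_hasDerivAt (0 : ℝ) (((hasDerivAt_line 0 Complex.I 0).const_mul c).const_add w)
    have hl' := (eventually_hasDerivAt_line (F := fun z => F (w + c * z)) (z := 0)
      (contDiffAt_two_comp_analyticAt (by simpa using hF w (by simp [hd.le]) (by simp [hd.le]))
        (han 0)) Complex.I).self_of_nhds
    have he := hl.unique hl'
    rw [he]
    simpa using h
  set K := 2 * M / d + N * d / 2 with hK
  have k1 : |fderiv ℝ F w Complex.I| ≤ K := by
    have h1 := key 1 (by simp)
    have h2 := key (-1) (by simp)
    simp at h1 h2
    exact abs_le.2 ⟨by linarith, h1⟩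
  have k2 : |fderiv ℝ F w 1| ≤ K := by
    have h1 := key Complex.I (by simp)
    have h2 := key (-Complex.I) (by simp)
    simp at h1 h2
    exact abs_le.2 ⟨by linarith, h2⟩
  have hK0 : 0 ≤ K := (abs_nonneg _).trans k1
  have e : 4 * M / d + N * d = 2 * K := by rw [hK]; ring
  rw [e]
  refine ContinuousLinearMap.opNorm_le_bound _ (by linarith) fun v => ?_
  have hv : v = v.re • (1 : ℂ) + v.im • Complex.I := by simp [Complex.re_add_im]
  have h1 : fderiv ℝ F w v = v.re * fderiv ℝ F w 1 + v.im * fderiv ℝ F w Complex.I := by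
    conv_lhs => rw [hv]
    simp only [map_add, map_smul, smul_eq_mul]
  rw [h1, Real.norm_eq_abs]
  calc _ ≤ |v.re| * |fderiv ℝ F w 1| + |v.im| * |fderiv ℝ F w Complex.I| := by
        rw [← abs_mul, ← abs_mul]; exact abs_add_le _ _
    _ ≤ ‖v‖ * K + ‖v‖ * K := by
        gcongr
        · exact Complex.abs_re_le_norm v
        · exact Complex.abs_im_le_norm v
    _ = 2 * K * ‖v‖ := by ring

theorem norm_fderiv_le_of_laplacian_le {F : ℂ → ℝ} {w : ℂ} {d M N : ℝ} (hd : 0 < d)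
    (hF : ∀ z : ℂ, |(z - w).re| ≤ d → |(z - w).im| ≤ d → ContDiffAt ℝ 2 F z)
    (hM : ∀ z : ℂ, |(z - w).re| ≤ d → |(z - w).im| ≤ d → |F z| ≤ M)
    (hN : ∀ z : ℂ, |(z - w).re| ≤ d → |(z - w).im| ≤ d → |Δ F z| ≤ N) :
    ‖fderiv ℝ F w‖ ≤ 4 * M / d + N * d := by
  refine le_of_forall_pos_le_add fun ε hε => ?_
  have h := norm_fderiv_le_of_laplacian_lt (N := N + ε / d) hd hF hM fun z h1 h2 =>
    (hN z h1 h2).trans_lt (by linarith [div_pos hε hd])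
  have e : (N + ε / d) * d = N * d + ε := by field_simp
  rw [e] at h; linarith

end GradientEstimate

/-! ### Nonnegative solutions of `Δu = 4 μ (exp u - exp (-2u))`. -/

section WangFunctions

theorem exp_sub_exp_le_mul (t : ℝ) :
    Real.exp t - Real.exp (-2 * t) ≤ 3 * Real.exp t * t := by
  have h : 1 - Real.exp (-(3 * t)) ≤ 3 * t := by linarith [Real.add_one_le_exp (-(3 * t))]
  have e : Real.exp (-2 * t) = Real.exp t * Real.exp (-(3 * t)) := by
    rw [← Real.exp_add]; ring_nf
  rw [e]
  nlinarith [Real.exp_pos t]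

theorem exp_sub_exp_nonneg {t : ℝ} (ht : 0 ≤ t) : 0 ≤ Real.exp t - Real.exp (-2 * t) := by
  have : Real.exp (-2 * t) ≤ Real.exp t := Real.exp_le_exp.2 (by linarith)
  linarith

/-- The nonlinearity of Wang's equation, in terms of `exp u - 1`, dominates its linearization. -/
theorem three_mul_exp_sub_one_le {t : ℝ} (ht : 0 ≤ t) :
    3 * (Real.exp t - 1) ≤ Real.exp t * (Real.exp t - Real.exp (-2 * t)) := by
  have e : Real.exp (-2 * t) * Real.exp t ^ 2 = 1 := by
    rw [← Real.exp_nat_mul, ← Real.exp_add]; simp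
  have hx : 1 ≤ Real.exp t := Real.one_le_exp ht
  generalize Real.exp (-2 * t) = y at *
  generalize Real.exp t = x at *
  -- Multiplied by `x`, the two sides become `3x² - 3x` and `x³ - 1`, which differ by `(x - 1)³`.
  have h1 : 0 ≤ (x - 1) ^ 3 := pow_nonneg (by linarith) 3
  have h2 : x * (x * (x - y)) = x * x ^ 2 - 1 := by linear_combination -e
  have h3 : x * (3 * (x - 1)) ≤ x * (x * (x - y)) := by rw [h2]; nlinarith
  exact le_of_mul_le_mul_left h3 (by linarith)

/-- A nonnegative solution at `w` of `Δ u = 4 μ (exp u - exp (-2 u))`. -/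
structure IsWangSolutionAt (μ u : ℂ → ℝ) (w : ℂ) : Prop where
  contDiffAt : ContDiffAt ℝ 2 u w
  nonneg : 0 ≤ u w
  eqn : Δ u w = 4 * μ w * (Real.exp (u w) - Real.exp (-2 * u w))

/-- The function `u` itself would not do, since `exp u - exp (-2u) < 3u` for small `u > 0`. Passing
to `exp u - 1` multiplies the nonlinearity by `exp u` and adds a nonnegative gradient term, which
restores the inequality. -/
theorem IsWangSolutionAt.subsolution {μ u : ℂ → ℝ} {w : ℂ} (h : IsWangSolutionAt μ u w)
    (hμ : 0 ≤ μ w) :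
    12 * μ w * (Real.exp (u w) - 1) ≤ Δ (fun z => Real.exp (u z) - 1) w := by
  rw [laplacian_sub_const _ h.contDiffAt.exp, laplacian_exp h.contDiffAt, h.eqn]
  have h1 := mul_le_mul_of_nonneg_left (three_mul_exp_sub_one_le h.nonneg) hμ
  have h2 : 0 ≤ Real.exp (u w) * (fderiv ℝ u w 1 ^ 2 + fderiv ℝ u w Complex.I ^ 2) := by positivity
  nlinarith

/-- Bounding `Δu` by a multiple of `u` lets the gradient estimate inherit the decay of `u`. -/
theorem IsWangSolutionAt.abs_laplacian_le {μ u : ℂ → ℝ} {w : ℂ} {M : ℝ}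
    (h : IsWangSolutionAt μ u w) (hμ : 0 ≤ μ w) (hM : u w ≤ M) :
    |Δ u w| ≤ 12 * μ w * Real.exp M * u w := by
  rw [h.eqn, abs_of_nonneg (by have := exp_sub_exp_nonneg h.nonneg; positivity)]
  calc _ ≤ 4 * μ w * (3 * Real.exp (u w) * u w) := by gcongr; exact exp_sub_exp_le_mul _
    _ ≤ 4 * μ w * (3 * Real.exp M * u w) := by
        have := h.nonneg
        gcongr
    _ = _ := by ring

/-- Bounded solutions on a half-infinite cylinder are dominated by supersolutions of the
linearized equation. -/
theorem wangSolution_le_exp_neg {μ u φ : ℂ → ℝ} {s M D : ℝ}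
    (hu : ∀ w : ℂ, s ≤ w.re → IsWangSolutionAt μ u w)
    (hup : ∀ w, u (w + 2 * Real.pi * Complex.I) = u w)
    (hM : ∀ w : ℂ, s ≤ w.re → u w ≤ M) (hμ : ∀ w : ℂ, s < w.re → 0 < μ w)
    (hφ : ContDiff ℝ 2 φ) (hφp : ∀ w, φ (w + 2 * Real.pi * Complex.I) = φ w)
    (hφΔ : ∀ w : ℂ, s < w.re →
      Δ (fun z => Real.exp (-φ z)) w ≤ 12 * μ w * Real.exp (-φ w))
    (hD : ∀ w : ℂ, w.re = s → φ w ≤ D) (w : ℂ) (hw : s ≤ w.re) :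
    u w ≤ Real.exp (M + D) * Real.exp (-φ w) := by
  have hφc : ContDiff ℝ 2 fun z => Real.exp (-φ z) := hφ.neg.exp
  -- The factor `exp (M + D)` lifts the barrier to at least `exp M` on the boundary circle, where `φ
  -- ≤ D`. The conclusion then uses `u ≤ exp u - 1`.
  have h := le_supersolution_of_periodic (Y := fun z => Real.exp (u z) - 1)
    (v := fun z => Real.exp (M + D) * Real.exp (-φ z)) (c := fun z => 12 * μ z) (s := s)
    (M := Real.exp M) (fun z => by simp only [hup]) (fun z => by simp only [hφp])
    (fun z hz => (hu z hz).contDiffAt.exp.sub contDiffAt_const)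
    (fun z _ => contDiffAt_const.mul hφc.contDiffAt)
    (fun z hz => by linarith [Real.exp_le_exp.2 (hM z hz)])
    (fun z _ => by positivity) (fun z hz => by linarith [hμ z hz])
    (fun z hz => (hu z hz.le).subsolution (hμ z hz).le)
    (fun z hz => by
      rw [laplacian_const_mul _ hφc.contDiffAt]
      have := mul_le_mul_of_nonneg_left (hφΔ z hz) (Real.exp_pos (M + D)).le
      linarith)
    (fun z hz => by
      have h1 := Real.exp_le_exp.2 (hM z hz.ge)
      have h2 : Real.exp M ≤ Real.exp (M + D) * Real.exp (-φ z) := by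
        rw [← Real.exp_add]; exact Real.exp_le_exp.2 (by linarith [hD z hz])
      linarith) w hw
  have h2 := Real.add_one_le_exp (u w)
  linarith

/-- Two bounds on `u` are kept apart: `M` enters only through the factor `exp M`, while `B` is the
local bound carrying the decay. -/
theorem norm_fderiv_wangSolution_le {μ u : ℂ → ℝ} {w : ℂ} {d M B Q : ℝ} (hd : 0 < d)
    (hu : ∀ z : ℂ, |(z - w).re| ≤ d → |(z - w).im| ≤ d → IsWangSolutionAt μ u z)
    (hM : ∀ z : ℂ, |(z - w).re| ≤ d → |(z - w).im| ≤ d → u z ≤ M)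
    (hB : ∀ z : ℂ, |(z - w).re| ≤ d → |(z - w).im| ≤ d → u z ≤ B)
    (hμ : ∀ z : ℂ, |(z - w).re| ≤ d → |(z - w).im| ≤ d → 0 ≤ μ z ∧ μ z ≤ Q) :
    ‖fderiv ℝ u w‖ ≤ 4 * B / d + 12 * Q * Real.exp M * B * d := by
  refine norm_fderiv_le_of_laplacian_le hd (fun z h1 h2 => (hu z h1 h2).contDiffAt)
    (fun z h1 h2 => ?_) (fun z h1 h2 => ?_)
  · rw [abs_of_nonneg (hu z h1 h2).nonneg]; exact hB z h1 h2
  · refine ((hu z h1 h2).abs_laplacian_le (hμ z h1 h2).1 (hM z h1 h2)).trans ?_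
    have h3 := (hμ z h1 h2).1
    have h4 := (hμ z h1 h2).2
    have h5 := hB z h1 h2
    have h6 := (hu z h1 h2).nonneg
    have h7 : 0 ≤ Q := h3.trans h4
    gcongr

end WangFunctions

/-! ### Decay on a flat cylinder. -/

section ConstantCoefficient

/-- Decay of solutions on a half-infinite cylinder with a flat product metric. -/
theorem exists_decay_of_const {u : ℂ → ℝ} {ρ s M δ : ℝ} (hρ : 0 < ρ) (hδ : 0 < δ)
    (hu : ∀ w : ℂ, s ≤ w.re → IsWangSolutionAt (fun _ => ρ ^ 2) u w)
    (hup : ∀ w, u (w + 2 * Real.pi * Complex.I) = u w)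
    (hM : ∀ w : ℂ, s ≤ w.re → u w ≤ M) :
    ∃ C : ℝ, ∀ w : ℂ, s + δ ≤ w.re →
      u w ≤ C * Real.exp (-(2 * Real.sqrt 3 * (ρ * w.re))) ∧
      ‖fderiv ℝ u w‖ ≤ C * Real.exp (-(2 * Real.sqrt 3 * (ρ * w.re))) := by
  set κ := 2 * Real.sqrt 3 * ρ with hκ
  have hκ2 : κ ^ 2 = 12 * ρ ^ 2 := by
    rw [hκ, mul_pow, mul_pow, Real.sq_sqrt (by norm_num)]; ring
  have hκ0 : 0 < κ := by positivity
  have hφ : ContDiff ℝ 2 fun w : ℂ => κ * w.re := contDiff_const.mul contDiff_re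
  have hlap : ∀ w : ℂ, Δ (fun z : ℂ => Real.exp (-(κ * z.re))) w =
      12 * ρ ^ 2 * Real.exp (-(κ * w.re)) := by
    intro w
    have hn : (fun z : ℂ => -(κ * z.re)) = fun z : ℂ => (-κ) * z.re := by ext; ring
    have hd : ∀ v : ℂ, fderiv ℝ (fun z : ℂ => -(κ * z.re)) w v = -κ * v.re := by
      intro v
      have : HasFDerivAt (fun z : ℂ => (-κ) * z.re) ((-κ) • Complex.reCLM) w :=
        Complex.reCLM.hasFDerivAt.const_mul (-κ)
      rw [hn, this.fderiv]; simp
    rw [laplacian_exp hφ.neg.contDiffAt, hd, hd, hn,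
      laplacian_const_mul _ contDiff_re.contDiffAt, laplacian_re, ← hκ2]
    simp; ring
  have hle := wangSolution_le_exp_neg (φ := fun w => κ * w.re) (D := κ * s) hu hup hM
    (fun _ _ => by positivity) hφ (fun w => by simp)
    (fun w _ => (hlap w).le) (fun w hw => by rw [hw])
  set B := Real.exp (M + κ * s) with hB
  have hδe : 1 ≤ Real.exp (κ * δ) := Real.one_le_exp (by positivity)
  -- The first two summands come from the gradient estimate on a square of half-side `δ`, over which
  -- the decay factor grows at most by `exp (κ δ)`. The last one covers `u` itself.
  refine ⟨4 * (B * Real.exp (κ * δ)) / δ + 12 * ρ ^ 2 * Real.exp M * (B * Real.exp (κ * δ)) * δ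
    + B, fun w hw => ?_⟩
  have e : 2 * Real.sqrt 3 * (ρ * w.re) = κ * w.re := by rw [hκ]; ring
  rw [e]
  have hs : ∀ z : ℂ, |(z - w).re| ≤ δ → w.re - δ ≤ z.re := fun z hz => by
    have := (abs_le.1 hz).1
    simp at this; linarith
  constructor
  · refine (hle w (by linarith)).trans ?_
    gcongr
    have : 0 ≤ 4 * (B * Real.exp (κ * δ)) / δ +
      12 * ρ ^ 2 * Real.exp M * (B * Real.exp (κ * δ)) * δ := by positivity
    linarith
  · have := norm_fderiv_wangSolution_le (u := u) (w := w) (μ := fun _ => ρ ^ 2) (M := M)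
      (B := B * Real.exp (κ * δ) * Real.exp (-(κ * w.re))) (Q := ρ ^ 2) hδ
      (fun z h1 _ => hu z (by linarith [hs z h1])) (fun z h1 _ => hM z (by linarith [hs z h1]))
      (fun z h1 _ => by
        refine (hle z (by linarith [hs z h1])).trans ?_
        have h3 : Real.exp (-(κ * z.re)) ≤ Real.exp (κ * δ) * Real.exp (-(κ * w.re)) := by
          rw [← Real.exp_add]
          exact Real.exp_le_exp.2 (by nlinarith [hs z h1])
        calc _ ≤ B * (Real.exp (κ * δ) * Real.exp (-(κ * w.re))) := by gcongr
          _ = _ := by ring)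
      (fun z _ _ => ⟨by positivity, le_rfl⟩)
    refine this.trans ?_
    have h0 : 0 ≤ B * Real.exp (-(κ * w.re)) := by positivity
    have e2 : (4 * (B * Real.exp (κ * δ)) / δ +
      12 * ρ ^ 2 * Real.exp M * (B * Real.exp (κ * δ)) * δ + B) * Real.exp (-(κ * w.re)) =
      4 * (B * Real.exp (κ * δ) * Real.exp (-(κ * w.re))) / δ + 12 * ρ ^ 2 * Real.exp M *
      (B * Real.exp (κ * δ) * Real.exp (-(κ * w.re))) * δ + B * Real.exp (-(κ * w.re)) := by ring
    linarith

end ConstantCoefficient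

/-! ### A supersolution on a cone end with residue. -/

section ConeSupersolution

/-- The angular part `Re (A exp (-i m θ))` of the logarithmic correction. -/
def coneAngle (m : ℝ) (A : ℂ) (θ : ℝ) : ℝ :=
  A.re * Real.cos (m * θ) + A.im * Real.sin (m * θ)

/-- The exponent `κ ρ + log σ / 2` of the decay, where `ρ` is the distance to the core and `σ` the
radius, in the coordinate `w` in which the flat metric is a multiple of
`|exp (m w) + A| ^ 2 |dw| ^ 2`. -/
def conePhase (κ m : ℝ) (A : ℂ) (w : ℂ) : ℝ :=
  κ * (Real.exp (m * w.re) / m + w.re * coneAngle m A w.im) + m / 2 * w.re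

/-- The exponent `conePhase` together with a bounded correction which makes `exp (-φ)` a
supersolution. -/
def coneBarrier (κ m : ℝ) (A : ℂ) (w : ℂ) : ℝ :=
  conePhase κ m A w + 2 / m * Real.exp (-(m / 2) * w.re)

theorem contDiff_coneBarrier (κ m : ℝ) (A : ℂ) : ContDiff ℝ 2 (coneBarrier κ m A) := by
  have h1 : ContDiff ℝ 2 (fun z : ℂ => z.re) := contDiff_re
  have h2 : ContDiff ℝ 2 (fun z : ℂ => z.im) := contDiff_im
  unfold coneBarrier conePhase coneAngle
  fun_prop

/-- When `3 ∤ n` the exponent `m = n/3` is not an integer, but then `A = 0`; a residue occurs only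
together with an integer `m`. -/
theorem coneAngle_periodic {m : ℝ} {A : ℂ} (hA : A ≠ 0 → ∃ k : ℕ, m = k) (θ : ℝ) :
    coneAngle m A (θ + 2 * Real.pi) = coneAngle m A θ := by
  by_cases h : A = 0
  · simp [coneAngle, h]
  · obtain ⟨k, rfl⟩ := hA h
    simp only [coneAngle, mul_add]
    rw [Real.cos_add_nat_mul_two_pi, Real.sin_add_nat_mul_two_pi]

theorem coneBarrier_periodic {κ m : ℝ} {A : ℂ} (hA : A ≠ 0 → ∃ k : ℕ, m = k) (w : ℂ) :
    coneBarrier κ m A (w + 2 * Real.pi * Complex.I) = coneBarrier κ m A w := by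
  have h1 : (w + 2 * Real.pi * Complex.I).re = w.re := by simp
  have h2 : (w + 2 * Real.pi * Complex.I).im = w.im + 2 * Real.pi := by simp
  simp only [coneBarrier, conePhase, h1, h2, coneAngle_periodic hA]

theorem abs_coneAngle_le (m : ℝ) (A : ℂ) (θ : ℝ) : |coneAngle m A θ| ≤ |A.re| + |A.im| := by
  refine (abs_add_le _ _).trans ?_
  rw [abs_mul, abs_mul]
  gcongr
  · exact mul_le_of_le_one_right (abs_nonneg _) (Real.abs_cos_le_one _)
  · exact mul_le_of_le_one_right (abs_nonneg _) (Real.abs_sin_le_one _)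

/-- Differentiating `Re (A exp (-imθ))` in `θ` multiplies `A` by `-im`. The vector `⟨A.im, -A.re⟩`
is `-iA`, whose angular part is `Im (A exp (-imθ))`. -/
theorem hasDerivAt_coneAngle (m : ℝ) (A : ℂ) (θ : ℝ) :
    HasDerivAt (coneAngle m A) (m * coneAngle m (⟨A.im, -A.re⟩ : ℂ) θ) θ := by
  have h : HasDerivAt (fun t : ℝ => m * t) (m * 1) θ := (hasDerivAt_id θ).const_mul m
  refine ((h.cos.const_mul A.re).add (h.sin.const_mul A.im)).congr_deriv ?_
  simp only [coneAngle]; ring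

theorem normSq_exp_add (m : ℝ) (A w : ℂ) : ‖Complex.exp (m * w) + A‖ ^ 2 =
    Real.exp (m * w.re) ^ 2 + 2 * Real.exp (m * w.re) * coneAngle m A w.im + ‖A‖ ^ 2 := by
  rw [← Complex.normSq_eq_norm_sq, ← Complex.normSq_eq_norm_sq, Complex.normSq_apply,
    Complex.normSq_apply]
  simp only [Complex.add_re, Complex.add_im, Complex.exp_re, Complex.exp_im, Complex.re_ofReal_mul,
    Complex.im_ofReal_mul, coneAngle]
  linear_combination Real.exp (m * w.re) ^ 2 * Real.cos_sq_add_sin_sq (m * w.im)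

theorem coneAngle_sq_add (m : ℝ) (A : ℂ) (θ : ℝ) :
    coneAngle m A θ ^ 2 + coneAngle m (⟨A.im, -A.re⟩ : ℂ) θ ^ 2 = ‖A‖ ^ 2 := by
  rw [← Complex.normSq_eq_norm_sq, Complex.normSq_apply]
  simp only [coneAngle]
  linear_combination (A.re ^ 2 + A.im ^ 2) * Real.cos_sq_add_sin_sq (m * θ)

/-- This is `Δ exp (-φ) = exp (-φ) (|∇φ|² - Δφ)` written out. In the radial square the cross term of
`κ exp (m s)` with `m/2` cancels `-κ m exp (m s)`, which is what fixes the coefficient `m/2` of the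
logarithmic term. -/
theorem laplacian_exp_neg_coneBarrier {κ m : ℝ} (hm : 0 < m) (A w : ℂ) :
    Δ (fun z => Real.exp (-coneBarrier κ m A z)) w = Real.exp (-coneBarrier κ m A w) *
      ((κ * (Real.exp (m * w.re) + coneAngle m A w.im) + m / 2
          - Real.exp (-(m / 2) * w.re)) ^ 2
        + (κ * w.re * m * coneAngle m (⟨A.im, -A.re⟩ : ℂ) w.im) ^ 2
        - κ * m * Real.exp (m * w.re) - m / 2 * Real.exp (-(m / 2) * w.re)
        + κ * w.re * m ^ 2 * coneAngle m A w.im) := by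
  have hφ := contDiff_coneBarrier κ m A
  have hE : ∀ c s : ℝ, HasDerivAt (fun t : ℝ => Real.exp (c * (s + t))) (c * Real.exp (c * s)) 0 := by
    intro c s
    have h := ((((hasDerivAt_id (0 : ℝ)).const_add s).const_mul c).exp)
    refine h.congr_deriv ?_
    simp [mul_comm]
  have hE' : ∀ c s t : ℝ,
      HasDerivAt (fun t : ℝ => Real.exp (c * (s + t))) (c * Real.exp (c * (s + t))) t := by
    intro c s t
    have h := ((((hasDerivAt_id t).const_add s).const_mul c).exp)
    refine h.congr_deriv ?_
    simp [mul_comm]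
  have l1 : ∀ t : ℝ, HasDerivAt (fun t : ℝ => -coneBarrier κ m A (w + t * 1))
      (-(κ * (Real.exp (m * (w.re + t)) + coneAngle m A w.im) + m / 2
          - Real.exp (-(m / 2) * (w.re + t)))) t := by
    intro t
    have h := (((((hE' m w.re t).div_const m).add
      (((hasDerivAt_id t).const_add w.re).mul_const (coneAngle m A w.im))).const_mul κ).add
      (((hasDerivAt_id t).const_add w.re).const_mul (m / 2))).add
      ((hE' (-(m / 2)) w.re t).const_mul (2 / m))
    refine (h.neg.congr_deriv ?_).congr_of_eventuallyEq (.of_forall fun t => ?_)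
    · field_simp; ring
    · simp [coneBarrier, conePhase]
  have l1' : HasDerivAt (fun t : ℝ => -(κ * (Real.exp (m * (w.re + t)) + coneAngle m A w.im) + m / 2
          - Real.exp (-(m / 2) * (w.re + t))))
      (-(κ * m * Real.exp (m * w.re) + m / 2 * Real.exp (-(m / 2) * w.re))) 0 := by
    have h := (((((hE m w.re).add_const (coneAngle m A w.im)).const_mul κ).add_const (m / 2)).sub
      (hE (-(m / 2)) w.re)).neg
    refine h.congr_deriv ?_
    ring
  have hθ : ∀ (B : ℂ) (t : ℝ), HasDerivAt (fun t : ℝ => coneAngle m B (w.im + t))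
      (m * coneAngle m (⟨B.im, -B.re⟩ : ℂ) (w.im + t)) t := by
    intro B t
    exact (hasDerivAt_coneAngle m B (w.im + t)).comp_const_add w.im t
  have l2 : ∀ t : ℝ, HasDerivAt (fun t : ℝ => -coneBarrier κ m A (w + t * Complex.I))
      (-(κ * w.re * m * coneAngle m (⟨A.im, -A.re⟩ : ℂ) (w.im + t))) t := by
    intro t
    have h := ((((hθ A t).const_mul w.re).const_add (Real.exp (m * w.re) / m)).const_mul κ).add_const
      (m / 2 * w.re + 2 / m * Real.exp (-(m / 2) * w.re))
    refine (h.neg.congr_deriv ?_).congr_of_eventuallyEq (.of_forall fun t => ?_)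
    · ring
    · simp [coneBarrier, conePhase]; ring
  have l2' : HasDerivAt (fun t : ℝ => -(κ * w.re * m * coneAngle m (⟨A.im, -A.re⟩ : ℂ) (w.im + t)))
      (κ * w.re * m ^ 2 * coneAngle m A w.im) 0 := by
    have h := ((hθ ⟨A.im, -A.re⟩ 0).const_mul (κ * w.re * m)).neg
    refine h.congr_deriv ?_
    simp only [coneAngle, add_zero]; ring
  have f1 : fderiv ℝ (fun z => -coneBarrier κ m A z) w 1 =
      -(κ * (Real.exp (m * w.re) + coneAngle m A w.im) + m / 2
          - Real.exp (-(m / 2) * w.re)) := by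
    have h := (eventually_hasDerivAt_line hφ.neg.contDiffAt 1).self_of_nhds.unique (l1 0)
    simpa only [Complex.ofReal_zero, zero_mul, add_zero] using h
  have f2 : fderiv ℝ (fun z => -coneBarrier κ m A z) w Complex.I =
      -(κ * w.re * m * coneAngle m (⟨A.im, -A.re⟩ : ℂ) w.im) := by
    have h := (eventually_hasDerivAt_line hφ.neg.contDiffAt Complex.I).self_of_nhds.unique (l2 0)
    simpa only [Complex.ofReal_zero, zero_mul, add_zero] using h
  rw [laplacian_exp hφ.neg.contDiffAt, laplacian_eq_fderiv_fderiv,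
    fderiv_fderiv_eq_of_line hφ.neg.contDiffAt (.of_forall l1) l1',
    fderiv_fderiv_eq_of_line hφ.neg.contDiffAt (.of_forall l2) l2', f1, f2]
  ring

/-- For large real parts, `exp (-coneBarrier)` is a supersolution of the linearized equation. -/
theorem eventually_coneBarrier_supersolution {κ m : ℝ} (hκ : 0 < κ) (hm : 0 < m) (A : ℂ) :
    ∀ᶠ s : ℝ in atTop, ∀ w : ℂ, w.re = s →
      Δ (fun z => Real.exp (-coneBarrier κ m A z)) w ≤
        κ ^ 2 * ‖Complex.exp (m * w) + A‖ ^ 2 * Real.exp (-coneBarrier κ m A w) := by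
  set L := |A.re| + |A.im| with hL
  have hL0 : 0 ≤ L := by positivity
  -- The total coefficient of the error terms, each of which is `O(s²)`; the bounds `b1` to `b4`
  -- below supply its four summands.
  set K := 2 * κ * L * (m / 2 + 1) + (m / 2 + 1) ^ 2 + κ ^ 2 * m ^ 2 * ‖A‖ ^ 2 + κ * m ^ 2 * L
    with hK
  have hK0 : 0 ≤ K := by positivity
  have hlim : Tendsto (fun s : ℝ => Real.exp (m / 2 * s) / s ^ (2 : ℝ)) atTop atTop :=
    tendsto_exp_mul_div_rpow_atTop 2 (m / 2) (by positivity)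
  filter_upwards [eventually_ge_atTop 1, hlim.eventually_ge_atTop (K / (2 * κ))] with s hs hsK w hw
  rw [laplacian_exp_neg_coneBarrier hm, normSq_exp_add, hw, mul_comm (κ ^ 2 * _)]
  refine mul_le_mul_of_nonneg_left ?_ (Real.exp_pos _).le
  have hEx : Real.exp (m * s) * Real.exp (-(m / 2) * s) = Real.exp (m / 2 * s) := by
    rw [← Real.exp_add]; ring_nf
  have hbig : K * s ^ 2 ≤ 2 * κ * Real.exp (m / 2 * s) := by
    rw [Real.rpow_two, div_le_div_iff₀ (by positivity) (by positivity)] at hsK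
    linarith
  have hx0 : 0 < Real.exp (-(m / 2) * s) := Real.exp_pos _
  have hx1 : Real.exp (-(m / 2) * s) ≤ 1 := by
    rw [Real.exp_le_one_iff]; nlinarith
  have hτ := abs_le.1 (abs_coneAngle_le m A w.im)
  have hττ := coneAngle_sq_add m A w.im
  rw [← hL] at hτ
  generalize coneAngle m A w.im = τ at *
  generalize coneAngle m (⟨A.im, -A.re⟩ : ℂ) w.im = τ' at *
  generalize Real.exp (-(m / 2) * s) = x at *
  generalize Real.exp (m / 2 * s) = y at *
  generalize Real.exp (m * s) = E at *
  have hs2 : 1 ≤ s ^ 2 := by nlinarith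
  have hss : s ≤ s ^ 2 := by nlinarith
  have b0 : τ ^ 2 ≤ ‖A‖ ^ 2 := by nlinarith [sq_nonneg τ']
  have b0' : τ' ^ 2 ≤ ‖A‖ ^ 2 := by nlinarith [sq_nonneg τ]
  have hab : |m / 2 - x| ≤ m / 2 + 1 := abs_le.2 ⟨by linarith, by linarith⟩
  have b1 : 2 * κ * τ * (m / 2 - x) ≤ 2 * κ * L * (m / 2 + 1) * s ^ 2 := by
    have h1 : τ * (m / 2 - x) ≤ L * (m / 2 + 1) := by
      refine (le_abs_self _).trans ?_
      rw [abs_mul]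
      gcongr
      exact abs_le.2 hτ
    have h2 : 0 ≤ L * (m / 2 + 1) := by positivity
    have h3 : L * (m / 2 + 1) ≤ L * (m / 2 + 1) * s ^ 2 := le_mul_of_one_le_right h2 hs2
    nlinarith
  have b2 : (m / 2 - x) ^ 2 ≤ (m / 2 + 1) ^ 2 * s ^ 2 := by
    have h1 : (m / 2 - x) ^ 2 ≤ (m / 2 + 1) ^ 2 := sq_le_sq' (by linarith) (by linarith)
    exact h1.trans (le_mul_of_one_le_right (by positivity) hs2)
  have b3 : (κ * s * m * τ') ^ 2 ≤ κ ^ 2 * m ^ 2 * ‖A‖ ^ 2 * s ^ 2 := by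
    have : (κ * s * m * τ') ^ 2 = κ ^ 2 * m ^ 2 * s ^ 2 * τ' ^ 2 := by ring
    rw [this]
    have := mul_le_mul_of_nonneg_left b0' (by positivity : 0 ≤ κ ^ 2 * m ^ 2 * s ^ 2)
    linarith
  have b4 : κ * s * m ^ 2 * τ ≤ κ * m ^ 2 * L * s ^ 2 := by
    have h0 : s * τ ≤ s * L := mul_le_mul_of_nonneg_left hτ.2 (by linarith)
    have h1 : s * τ ≤ s ^ 2 * L := h0.trans (mul_le_mul_of_nonneg_right hss hL0)
    have := mul_le_mul_of_nonneg_left h1 (by positivity : 0 ≤ κ * m ^ 2)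
    linarith
  have b5 : κ ^ 2 * τ ^ 2 ≤ κ ^ 2 * ‖A‖ ^ 2 := by gcongr
  have hxm : 0 ≤ m / 2 * x := by positivity
  -- The first three terms are absorbed by `κ² |exp (m w) + A|²` and `κ m E` cancels. The correction
  -- contributes `-2κ E x = -2κ exp (m s / 2)`, which dominates `K s²`.
  have expand : (κ * (E + τ) + m / 2 - x) ^ 2 = κ ^ 2 * E ^ 2 + 2 * κ ^ 2 * E * τ + κ ^ 2 * τ ^ 2
      + κ * m * E - 2 * κ * (E * x) + 2 * κ * τ * (m / 2 - x) + (m / 2 - x) ^ 2 := by ring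
  rw [expand, hEx]
  have hKs : K * s ^ 2 = 2 * κ * L * (m / 2 + 1) * s ^ 2 + (m / 2 + 1) ^ 2 * s ^ 2 +
    κ ^ 2 * m ^ 2 * ‖A‖ ^ 2 * s ^ 2 + κ * m ^ 2 * L * s ^ 2 := by rw [hK]; ring
  linarith

end ConeSupersolution

/-! ### Decay of solutions on a cone end. -/

section ConeDecay

/-- Oscillation of the exponent at the natural scale `exp (-m s)`. -/
theorem conePhase_sub_le {κ m : ℝ} (hκ : 0 < κ) (hm : 0 < m) (A : ℂ) {w z : ℂ} (hw : 0 ≤ w.re)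
    (h1 : |(z - w).re| ≤ Real.exp (-(m * w.re))) (h2 : |(z - w).im| ≤ Real.exp (-(m * w.re))) :
    conePhase κ m A w - conePhase κ m A z ≤ κ + 2 * κ * (|A.re| + |A.im|) + m / 2 := by
  set L := |A.re| + |A.im| with hL
  set d := Real.exp (-(m * w.re)) with hd
  have hL0 : 0 ≤ L := by positivity
  have hd0 : 0 < d := Real.exp_pos _
  have hd1 : d ≤ 1 := by rw [hd, Real.exp_le_one_iff]; nlinarith
  have hEd : Real.exp (m * w.re) * d = 1 := by rw [hd, ← Real.exp_add]; simp
  have hmsd : m * w.re * d ≤ 1 := by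
    have := Real.add_one_le_exp (m * w.re)
    nlinarith
  simp only [Complex.sub_re, Complex.sub_im] at h1 h2
  obtain ⟨h1a, h1b⟩ := abs_le.1 h1
  -- By the tangent-line inequality for `exp`, a displacement of at most `exp (-m s)` lowers the
  -- radius `exp (m s)/m` by at most `1`.
  have e1 : Real.exp (m * w.re) / m - Real.exp (m * z.re) / m ≤ 1 := by
    have h3 : Real.exp (m * w.re) * (m * (z.re - w.re) + 1) ≤ Real.exp (m * z.re) := by
      have h4 := mul_le_mul_of_nonneg_left (Real.add_one_le_exp (m * (z.re - w.re)))
        (Real.exp_pos (m * w.re)).le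
      rwa [← Real.exp_add, show m * w.re + m * (z.re - w.re) = m * z.re by ring] at h4
    rw [← sub_div, div_le_one hm]
    have h5 : Real.exp (m * w.re) * (m * -d) ≤ Real.exp (m * w.re) * (m * (z.re - w.re)) := by
      gcongr
    nlinarith
  have hlip : |coneAngle m A w.im - coneAngle m A z.im| ≤ m * L * d := by
    have hb : ∀ θ : ℝ, ‖m * coneAngle m (⟨A.im, -A.re⟩ : ℂ) θ‖ ≤ m * L := by
      intro θ
      rw [norm_mul, Real.norm_of_nonneg hm.le]
      have := abs_coneAngle_le m (⟨A.im, -A.re⟩ : ℂ) θ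
      simp only [abs_neg] at this
      rw [Real.norm_eq_abs]
      gcongr
      rw [hL]; linarith
    have h := Convex.norm_image_sub_le_of_norm_hasDerivWithin_le (f := coneAngle m A)
      (fun θ _ => (hasDerivAt_coneAngle m A θ).hasDerivWithinAt) (fun θ _ => hb θ) convex_univ
      (mem_univ z.im) (mem_univ w.im)
    rw [Real.norm_eq_abs, Real.norm_eq_abs] at h
    refine h.trans ?_
    rw [abs_sub_comm] at h2
    gcongr
  have e2 : w.re * coneAngle m A w.im - z.re * coneAngle m A z.im ≤ 2 * L := by
    have h3 : w.re * coneAngle m A w.im - z.re * coneAngle m A z.im =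
      w.re * (coneAngle m A w.im - coneAngle m A z.im) + (w.re - z.re) * coneAngle m A z.im := by
      ring
    have h4 : w.re * (coneAngle m A w.im - coneAngle m A z.im) ≤ L := by
      have := mul_le_mul_of_nonneg_left ((le_abs_self _).trans hlip) hw
      nlinarith
    have h5 : (w.re - z.re) * coneAngle m A z.im ≤ L := by
      refine (le_abs_self _).trans ?_
      rw [abs_mul, ← one_mul L]
      gcongr
      · rw [abs_sub_comm]; exact h1.trans hd1
      · exact abs_coneAngle_le m A z.im
    linarith
  have e3 : m / 2 * w.re - m / 2 * z.re ≤ m / 2 := by nlinarith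
  have h6 := mul_le_mul_of_nonneg_left (add_le_add e1 e2) hκ.le
  simp only [conePhase]
  linarith

/-- Decay of solutions near a pole of order at least four. -/
theorem exists_decay_of_cone {u : ℂ → ℝ} {m c s M : ℝ} {A : ℂ} (hm : 0 < m) (hc : 0 < c)
    (hA : A ≠ 0 → ∃ k : ℕ, m = k)
    (hu : ∀ w : ℂ, s ≤ w.re →
      IsWangSolutionAt (fun w => c ^ 2 * ‖Complex.exp (m * w) + A‖ ^ 2) u w)
    (hup : ∀ w, u (w + 2 * Real.pi * Complex.I) = u w)
    (hM : ∀ w : ℂ, s ≤ w.re → u w ≤ M) :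
    ∃ C s₁ : ℝ, s ≤ s₁ ∧ 0 ≤ C ∧ ∀ w : ℂ, s₁ ≤ w.re →
      u w ≤ C * Real.exp (-conePhase (2 * Real.sqrt 3 * c) m A w) ∧
      ‖fderiv ℝ u w‖ ≤
        C * Real.exp (m * w.re) * Real.exp (-conePhase (2 * Real.sqrt 3 * c) m A w) := by
  set κ := 2 * Real.sqrt 3 * c with hκ
  have hκ2 : κ ^ 2 = 12 * c ^ 2 := by
    rw [hκ, mul_pow, mul_pow, Real.sq_sqrt (by norm_num)]; ring
  have hκ0 : 0 < κ := by positivity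
  set L := |A.re| + |A.im| with hL
  have hL0 : 0 ≤ L := by positivity
  have hexp : ∀ᶠ s : ℝ in atTop, ‖A‖ < Real.exp (m * s) :=
    (Real.tendsto_exp_atTop.comp (tendsto_id.const_mul_atTop hm)).eventually_gt_atTop ‖A‖
  obtain ⟨s₀, hs₀⟩ := eventually_atTop.1
    ((eventually_coneBarrier_supersolution hκ0 hm A).and hexp)
  set t := max (max s s₀) 0 with ht
  have hts : s ≤ t := (le_max_left _ _).trans (le_max_left _ _)
  have hts₀ : s₀ ≤ t := (le_max_right _ _).trans (le_max_left _ _)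
  have ht0 : 0 ≤ t := le_max_right _ _
  have hne : ∀ w : ℂ, t ≤ w.re → ‖Complex.exp (m * w)‖ = Real.exp (m * w.re) ∧
      ‖A‖ < Real.exp (m * w.re) := by
    intro w hw
    refine ⟨?_, (hs₀ w.re (by linarith)).2⟩
    rw [Complex.norm_exp, Complex.re_ofReal_mul]
  have hμ : ∀ w : ℂ, t ≤ w.re → 0 < c ^ 2 * ‖Complex.exp (m * w) + A‖ ^ 2 := by
    intro w hw
    have h1 := hne w hw
    have h2 : 0 < ‖Complex.exp (m * w) + A‖ := by
      have := norm_sub_le_norm_add (Complex.exp (m * w)) A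
      rw [h1.1] at this; linarith
    positivity
  set D := κ * (Real.exp (m * t) / m + t * L) + m / 2 * t + 2 / m with hD
  have hle := wangSolution_le_exp_neg (φ := coneBarrier κ m A) (D := D) (s := t)
    (fun w hw => hu w (hts.trans hw)) hup (fun w hw => hM w (hts.trans hw))
    (fun w hw => hμ w hw.le) (contDiff_coneBarrier κ m A) (coneBarrier_periodic hA)
    (fun w hw => by
      have := (hs₀ w.re (by linarith)).1 w rfl
      rw [hκ2] at this
      linarith)
    (fun w hw => by
      have h1 := (abs_le.1 (abs_coneAngle_le m A w.im)).2
      have h2 : Real.exp (-(m / 2) * t) ≤ 1 := by rw [Real.exp_le_one_iff]; nlinarith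
      have h3 : t * coneAngle m A w.im ≤ t * L := by gcongr
      have h4 : κ * (Real.exp (m * t) / m + t * coneAngle m A w.im) ≤
        κ * (Real.exp (m * t) / m + t * L) := by gcongr
      have h5 : 2 / m * Real.exp (-(m / 2) * t) ≤ 2 / m :=
        mul_le_of_le_one_right (by positivity) h2
      simp only [coneBarrier, conePhase, hw, hD]
      linarith)
  set B := Real.exp (M + D) with hB
  have hle' : ∀ w : ℂ, t ≤ w.re → u w ≤ B * Real.exp (-conePhase κ m A w) := by
    intro w hw
    refine (hle w hw).trans ?_
    have : conePhase κ m A w ≤ coneBarrier κ m A w := by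
      have : 0 ≤ 2 / m * Real.exp (-(m / 2) * w.re) := by positivity
      simp only [coneBarrier]; linarith
    gcongr
  set D' := κ + 2 * κ * L + m / 2 with hD'
  -- Here `Q E²` bounds the coefficient on the square used below, because `|exp (m z) + A| ≤ 2 exp m
  -- · E` when `Re z ≤ Re w + 1`.
  set Q := 4 * c ^ 2 * Real.exp m ^ 2 with hQ
  have hD'1 : 1 ≤ Real.exp D' := Real.one_le_exp (by positivity)
  refine ⟨4 * (B * Real.exp D') + 12 * Q * Real.exp M * (B * Real.exp D') + B, t + 1,
    by linarith, by positivity, fun w hw => ⟨?_, ?_⟩⟩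
  · refine (hle' w (by linarith)).trans ?_
    gcongr
    have : 0 ≤ 4 * (B * Real.exp D') + 12 * Q * Real.exp M * (B * Real.exp D') := by positivity
    linarith
  -- This half-side is of unit order in the flat metric, so the phase oscillates by a bounded amount
  -- over the square. Dividing by `d` produces the factor `exp (m Re w)`, compensated later by the
  -- derivative of `w` with respect to `ζ`.
  · set d := Real.exp (-(m * w.re)) with hd
    set E := Real.exp (m * w.re) with hE
    have hw0 : 0 ≤ w.re := by linarith
    have hd1 : d ≤ 1 := by rw [hd, Real.exp_le_one_iff]; nlinarith
    have hEd : E * d = 1 := by rw [hd, hE, ← Real.exp_add]; simp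
    have hd0 : 0 < d := Real.exp_pos _
    have hE0 : 0 < E := Real.exp_pos _
    have hz : ∀ z : ℂ, |(z - w).re| ≤ d → t ≤ z.re ∧ z.re ≤ w.re + 1 := by
      intro z hz
      have := abs_le.1 hz
      simp only [Complex.sub_re] at this
      exact ⟨by linarith, by linarith⟩
    have h := norm_fderiv_wangSolution_le (u := u) (w := w)
      (μ := fun w => c ^ 2 * ‖Complex.exp (m * w) + A‖ ^ 2) (M := M)
      (B := B * Real.exp D' * Real.exp (-conePhase κ m A w)) (Q := Q * E ^ 2) hd0
      (fun z h1 _ => hu z (hts.trans (hz z h1).1)) (fun z h1 _ => hM z (hts.trans (hz z h1).1))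
      (fun z h1 h2 => by
        refine (hle' z (hz z h1).1).trans ?_
        have h3 := conePhase_sub_le hκ0 hm A hw0 h1 h2
        have h4 : Real.exp (-conePhase κ m A z) ≤
            Real.exp D' * Real.exp (-conePhase κ m A w) := by
          rw [← Real.exp_add]
          exact Real.exp_le_exp.2 (by linarith)
        calc _ ≤ B * (Real.exp D' * Real.exp (-conePhase κ m A w)) := by gcongr
          _ = _ := by ring)
      (fun z h1 _ => by
        refine ⟨(hμ z (hz z h1).1).le, ?_⟩
        have h3 := hne z (hz z h1).1
        have h4 : ‖Complex.exp (m * z) + A‖ ≤ 2 * (Real.exp m * E) := by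
          have h5 := norm_add_le (Complex.exp (m * z)) A
          have h6 : Real.exp (m * z.re) ≤ Real.exp m * E := by
            rw [hE, ← Real.exp_add]
            exact Real.exp_le_exp.2 (by nlinarith [(hz z h1).2])
          rw [h3.1] at h5
          linarith
        calc c ^ 2 * ‖Complex.exp (m * z) + A‖ ^ 2 ≤ c ^ 2 * (2 * (Real.exp m * E)) ^ 2 := by
              gcongr
          _ = Q * E ^ 2 := by rw [hQ]; ring)
    refine h.trans ?_
    have hdE : d = E⁻¹ := eq_inv_of_mul_eq_one_right hEd
    have h0 : 0 ≤ B * E * Real.exp (-conePhase κ m A w) := by positivity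
    have e1 : 4 * (B * Real.exp D' * Real.exp (-conePhase κ m A w)) / d +
        12 * (Q * E ^ 2) * Real.exp M * (B * Real.exp D' * Real.exp (-conePhase κ m A w)) * d =
        (4 * (B * Real.exp D') + 12 * Q * Real.exp M * (B * Real.exp D')) * E *
          Real.exp (-conePhase κ m A w) := by
      rw [hdE]; field_simp
    rw [e1]
    linarith

end ConeDecay

/-! ### Change of conformal coordinate for `b`, `g` and Wang's equation. -/

section Coordinates

variable {X : Type*} [TopologicalSpace X] {e e' : OpenPartialHomeomorph X ℂ}

theorem coord_symm_eventuallyEq {z : ℂ} (hz : z ∈ e.target) (hz' : e.symm z ∈ e'.source) :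
    e.symm =ᶠ[𝓝 z] fun y => e'.symm (e' (e.symm y)) := by
  filter_upwards [(e.continuousAt_symm hz).eventually (e'.open_source.mem_nhds hz')] with y hy'
  exact (e'.left_inv hy').symm

theorem eventually_notMem {P : Set X} (hP : IsClosed P) {z : ℂ} (hz : z ∈ e.target)
    (hzP : e.symm z ∉ P) : ∀ᶠ y in 𝓝 z, y ∈ e.target ∧ e.symm y ∉ P :=
  (e.open_target.eventually_mem hz).and
    ((e.continuousAt_symm hz).eventually (hP.isOpen_compl.mem_nhds hzP))

variable [ChartedSpace ℂ X]

theorem metric_one_pos {P : Set X} (g : ConformalMetric X P) {x : X} (hP : x ∉ P) :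
    0 < g.toFun x (1 : ℂ) :=
  g.pos x hP (show TangentSpace 𝓘(ℂ) x from (1 : ℂ)) (one_ne_zero (α := ℂ))

/-- The tangent vector `∂/∂z` of the coordinate `e`, as a complex number. -/
def coordVec (e : OpenPartialHomeomorph X ℂ) (z : ℂ) : ℂ :=
  mfderiv 𝓘(ℂ) 𝓘(ℂ) e.symm z (1 : ℂ)

theorem mdifferentiableAt_coord (he : e ∈ IsManifold.maximalAtlas 𝓘(ℂ) ω X) {x : X}
    (hx : x ∈ e.source) : MDifferentiableAt 𝓘(ℂ) 𝓘(ℂ) e x :=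
  mdifferentiableAt_of_mem_maximalAtlas
    (IsManifold.maximalAtlas_subset_of_le (m := 1) (by simp) he) hx

theorem mdifferentiableAt_coord_symm (he : e ∈ IsManifold.maximalAtlas 𝓘(ℂ) ω X) {z : ℂ}
    (hz : z ∈ e.target) : MDifferentiableAt 𝓘(ℂ) 𝓘(ℂ) e.symm z :=
  mdifferentiableAt_symm_of_mem_maximalAtlas
    (IsManifold.maximalAtlas_subset_of_le (m := 1) (by simp) he) hz

theorem coordVec_ne_zero (he : e ∈ IsManifold.maximalAtlas 𝓘(ℂ) ω X) {z : ℂ}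
    (hz : z ∈ e.target) : coordVec e z ≠ 0 := by
  intro h0
  have hsrc : e.symm z ∈ e.source := e.map_target hz
  have h1 := mfderiv_comp_apply z (mdifferentiableAt_coord he hsrc)
    (mdifferentiableAt_coord_symm he hz) (1 : ℂ)
  have h2 : (e ∘ e.symm) =ᶠ[𝓝 z] id := by
    filter_upwards [e.open_target.eventually_mem hz] with y hy using e.right_inv hy
  have h3 : mfderiv 𝓘(ℂ) 𝓘(ℂ) e.symm z (1 : ℂ) = 0 := h0
  rw [h2.mfderiv_eq, mfderiv_id, h3, map_zero] at h1
  exact one_ne_zero (α := ℂ) h1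

/-- The chain rule for `e.symm ∘ φ`. -/
theorem mfderiv_coord_symm_comp (he : e ∈ IsManifold.maximalAtlas 𝓘(ℂ) ω X) {ψ : ℂ → X}
    {φ : ℂ → ℂ} {y : ℂ} (hψ : ψ =ᶠ[𝓝 y] fun x => e.symm (φ x)) (hφ : DifferentiableAt ℂ φ y)
    (hy : φ y ∈ e.target) :
    (mfderiv 𝓘(ℂ) 𝓘(ℂ) ψ y (1 : ℂ) : ℂ) =
      deriv φ y * coordVec e (φ y) := by
  have h1 := mfderiv_comp_apply (f := φ) (g := e.symm) y (mdifferentiableAt_coord_symm he hy)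
    (mdifferentiableAt_iff_differentiableAt.2 hφ) (1 : ℂ)
  have h2 : ψ =ᶠ[𝓝 y] e.symm ∘ φ := hψ
  rw [h2.mfderiv_eq]
  refine Eq.trans h1 ?_
  rw [mfderiv_eq_fderiv]
  have h3 : (fderiv ℂ φ y (1 : ℂ) : ℂ) = deriv φ y • (1 : ℂ) := by simp
  refine (congrArg (mfderiv 𝓘(ℂ) 𝓘(ℂ) e.symm (φ y)) h3).trans ?_
  exact map_smul (mfderiv 𝓘(ℂ) 𝓘(ℂ) e.symm (φ y)) (deriv φ y) (1 : ℂ)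

variable {P : Set X}

theorem pullCubic_comp (b : CubicDifferential X P) (he : e ∈ IsManifold.maximalAtlas 𝓘(ℂ) ω X)
    {ψ : ℂ → X} {φ : ℂ → ℂ} {y : ℂ} (hψ : ψ =ᶠ[𝓝 y] fun x => e.symm (φ x))
    (hφ : DifferentiableAt ℂ φ y) (hy : φ y ∈ e.target) (hP : ψ y ∉ P) :
    pullCubic b.toFun ψ y = deriv φ y ^ 3 * pullCubic b.toFun e.symm (φ y) := by
  have h1 := mfderiv_coord_symm_comp he hψ hφ hy
  have h2 : ψ y = e.symm (φ y) := hψ.self_of_nhds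
  have h3 : ∀ (x : X), x = e.symm (φ y) → ∀ v : ℂ, v =
      deriv φ y * coordVec e (φ y) →
      b.toFun x v = deriv φ y ^ 3 * pullCubic b.toFun e.symm (φ y) := by
    rintro x rfl v rfl
    exact b.homogeneous (e.symm (φ y)) (h2 ▸ hP) (deriv φ y)
      (mfderiv 𝓘(ℂ) 𝓘(ℂ) e.symm (φ y) (1 : ℂ))
  exact h3 (ψ y) h2 _ h1

theorem pullMetric_comp (g : ConformalMetric X P) (he : e ∈ IsManifold.maximalAtlas 𝓘(ℂ) ω X)
    {ψ : ℂ → X} {φ : ℂ → ℂ} {y : ℂ} (hψ : ψ =ᶠ[𝓝 y] fun x => e.symm (φ x))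
    (hφ : DifferentiableAt ℂ φ y) (hy : φ y ∈ e.target) (hP : ψ y ∉ P) :
    pullMetric g.toFun ψ y = ‖deriv φ y‖ ^ 2 * pullMetric g.toFun e.symm (φ y) := by
  have h1 := mfderiv_coord_symm_comp he hψ hφ hy
  have h2 : ψ y = e.symm (φ y) := hψ.self_of_nhds
  have h3 : ∀ (x : X), x = e.symm (φ y) → ∀ v : ℂ, v =
      deriv φ y * coordVec e (φ y) →
      g.toFun x v = ‖deriv φ y‖ ^ 2 * pullMetric g.toFun e.symm (φ y) := by
    rintro x rfl v rfl
    exact g.conformal (e.symm (φ y)) (h2 ▸ hP) (deriv φ y)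
      (mfderiv 𝓘(ℂ) 𝓘(ℂ) e.symm (φ y) (1 : ℂ))
  exact h3 (ψ y) h2 _ h1

theorem pullMetric_pos (g : ConformalMetric X P) (he : e ∈ IsManifold.maximalAtlas 𝓘(ℂ) ω X)
    {z : ℂ} (hz : z ∈ e.target) (hP : e.symm z ∉ P) : 0 < pullMetric g.toFun e.symm z :=
  g.pos _ hP _ (coordVec_ne_zero he hz)

/-- The vector `1` of the model tangent space and the coordinate vector of `e` differ by one nonzero
factor. It drops out of `|f|²/h³` and of `h/|f|^(2/3)` by homogeneity. -/
theorem exists_pull_eq_mul (g : ConformalMetric X P) (b : CubicDifferential X P)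
    (he : e ∈ IsManifold.maximalAtlas 𝓘(ℂ) ω X) {z : ℂ} (hz : z ∈ e.target) (hP : e.symm z ∉ P) :
    ∃ c : ℂ, c ≠ 0 ∧ pullMetric g.toFun e.symm z = ‖c‖ ^ 2 * g.toFun (e.symm z) (1 : ℂ) ∧
      pullCubic b.toFun e.symm z = c ^ 3 * b.toFun (e.symm z) (1 : ℂ) := by
  set c := coordVec e z
  have hc' : coordVec e z = c • (1 : ℂ) := by simp [c]
  refine ⟨c, coordVec_ne_zero he hz, ?_, ?_⟩
  · exact (congrArg (g.toFun (e.symm z)) hc').trans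
      (g.conformal _ hP c (show TangentSpace 𝓘(ℂ) (e.symm z) from (1 : ℂ)))
  · exact (congrArg (b.toFun (e.symm z)) hc').trans
      (b.homogeneous _ hP c (show TangentSpace 𝓘(ℂ) (e.symm z) from (1 : ℂ)))

theorem normSq_eq_pull (g : ConformalMetric X P) (b : CubicDifferential X P)
    (he : e ∈ IsManifold.maximalAtlas 𝓘(ℂ) ω X) {z : ℂ} (hz : z ∈ e.target) (hP : e.symm z ∉ P) :
    normSq g b (e.symm z) =
      ‖pullCubic b.toFun e.symm z‖ ^ 2 / pullMetric g.toFun e.symm z ^ 3 := by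
  obtain ⟨c, hc, h1, h2⟩ := exists_pull_eq_mul g b he hz hP
  have hg := metric_one_pos g hP
  have hc' : 0 < ‖c‖ := norm_pos_iff.2 hc
  rw [h1, h2, normSq, norm_mul, norm_pow]
  field_simp

theorem logRatio_eq_pull (g : ConformalMetric X P) (b : CubicDifferential X P)
    (he : e ∈ IsManifold.maximalAtlas 𝓘(ℂ) ω X) {z : ℂ} (hz : z ∈ e.target) (hP : e.symm z ∉ P)
    (hb : pullCubic b.toFun e.symm z ≠ 0) :
    logRatio g b (e.symm z) = Real.log (pullMetric g.toFun e.symm z) - Real.log 2 / 3 -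
      2 / 3 * Real.log ‖pullCubic b.toFun e.symm z‖ := by
  obtain ⟨c, hc, h1, h2⟩ := exists_pull_eq_mul g b he hz hP
  have hg := metric_one_pos g hP
  have hc' : 0 < ‖c‖ := norm_pos_iff.2 hc
  have hb1 : 0 < ‖b.toFun (e.symm z) (1 : ℂ)‖ := by
    rw [norm_pos_iff]; rintro h; exact hb (by rw [h2, h, mul_zero])
  rw [h1, h2, logRatio, norm_mul, norm_pow, Real.log_div hg.ne' (by positivity),
    Real.log_mul (by positivity) (by positivity), Real.log_mul (by positivity) hg.ne',
    Real.log_mul (by positivity) hb1.ne', Real.log_rpow (by norm_num), Real.log_rpow hb1,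
    Real.log_pow, Real.log_pow]
  push_cast
  ring

/-- The dictionary between curvature and `u`: Wang's equation reads `κ = -1 + exp (-3u)`, so upper
bounds on `κ` are lower bounds on `u` and conversely. -/
theorem normSq_eq_exp (g : ConformalMetric X P) (b : CubicDifferential X P)
    (he : e ∈ IsManifold.maximalAtlas 𝓘(ℂ) ω X) {z : ℂ} (hz : z ∈ e.target) (hP : e.symm z ∉ P)
    (hb : pullCubic b.toFun e.symm z ≠ 0) :
    2 * normSq g b (e.symm z) = Real.exp (-3 * logRatio g b (e.symm z)) := by
  have hh := pullMetric_pos g he hz hP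
  have hb1 : 0 < ‖pullCubic b.toFun e.symm z‖ := norm_pos_iff.2 hb
  rw [logRatio_eq_pull g b he hz hP hb, normSq_eq_pull g b he hz hP]
  set h := pullMetric g.toFun e.symm z
  set f := ‖pullCubic b.toFun e.symm z‖
  have hpos : 0 < 2 * (f ^ 2 / h ^ 3) := by positivity
  rw [← Real.exp_log hpos, Real.log_mul (by norm_num) (by positivity),
    Real.log_div (by positivity) (by positivity), Real.log_pow, Real.log_pow]
  congr 1
  push_cast
  ring

theorem analyticAt_pullCubic (b : CubicDifferential X P) (hP : IsClosed P)
    (he : e ∈ IsManifold.maximalAtlas 𝓘(ℂ) ω X) {z : ℂ} (hz : z ∈ e.target) (hzP : e.symm z ∉ P) :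
    AnalyticAt ℂ (pullCubic b.toFun e.symm) z := by
  rw [Complex.analyticAt_iff_eventually_differentiableAt]
  filter_upwards [eventually_notMem hP hz hzP] with y hy using b.holomorphic e he y hy.1 hy.2

theorem analyticAt_coordChange (he : e ∈ IsManifold.maximalAtlas 𝓘(ℂ) ω X)
    (he' : e' ∈ IsManifold.maximalAtlas 𝓘(ℂ) ω X) {z : ℂ} (hz : z ∈ e.target)
    (hz' : e.symm z ∈ e'.source) : AnalyticAt ℂ (fun y => e' (e.symm y)) z := by
  rw [Complex.analyticAt_iff_eventually_differentiableAt]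
  filter_upwards [e.open_target.eventually_mem hz,
    (e.continuousAt_symm hz).eventually (e'.open_source.mem_nhds hz')] with y hy hy'
  exact mdifferentiableAt_iff_differentiableAt.1
    ((mdifferentiableAt_coord he' hy').comp y (mdifferentiableAt_coord_symm he hy))

theorem deriv_coordChange_ne_zero (he : e ∈ IsManifold.maximalAtlas 𝓘(ℂ) ω X)
    (he' : e' ∈ IsManifold.maximalAtlas 𝓘(ℂ) ω X) {z : ℂ} (hz : z ∈ e.target)
    (hz' : e.symm z ∈ e'.source) : deriv (fun y => e' (e.symm y)) z ≠ 0 := by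
  intro h0
  have h1 := mfderiv_coord_symm_comp he' (coord_symm_eventuallyEq hz hz')
    (analyticAt_coordChange he he' hz hz').differentiableAt (e'.map_source hz')
  rw [h0, zero_mul] at h1
  exact coordVec_ne_zero he hz h1

theorem contDiffAt_pullMetric (g : ConformalMetric X P)
    (he : e ∈ IsManifold.maximalAtlas 𝓘(ℂ) ω X) {z : ℂ} (hz : z ∈ e.target) (hzP : e.symm z ∉ P) :
    ContDiffAt ℝ 2 (pullMetric g.toFun e.symm) z :=
  (g.smooth e he z hz hzP).of_le (WithTop.coe_le_coe.2 (le_top : (2 : ℕ∞) ≤ ⊤))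

theorem contDiffAt_log_pullMetric (g : ConformalMetric X P)
    (he : e ∈ IsManifold.maximalAtlas 𝓘(ℂ) ω X) {z : ℂ} (hz : z ∈ e.target) (hzP : e.symm z ∉ P) :
    ContDiffAt ℝ 2 (fun y => Real.log (pullMetric g.toFun e.symm y)) z :=
  (contDiffAt_pullMetric g he hz hzP).log (pullMetric_pos g he hz hzP).ne'

variable [IsManifold 𝓘(ℂ) ω X]

theorem chartAt_mem (x : X) : chartAt ℂ x ∈ IsManifold.maximalAtlas 𝓘(ℂ) ω X :=
  IsManifold.chart_mem_maximalAtlas x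

/-- Wang's equation in an arbitrary conformal coordinate. -/
theorem laplacian_log_pullMetric {g : ConformalMetric X P} {b : CubicDifferential X P}
    (hP : IsClosed P) (hg : IsWangMetric g b) (he : e ∈ IsManifold.maximalAtlas 𝓘(ℂ) ω X) {z : ℂ}
    (hz : z ∈ e.target) (hzP : e.symm z ∉ P) :
    Δ (fun y => Real.log (pullMetric g.toFun e.symm y)) z =
      2 * pullMetric g.toFun e.symm z * (1 - 2 * normSq g b (e.symm z)) := by
  set x := e.symm z with hx
  set χ := chartAt ℂ x with hχ
  have hχm : χ ∈ IsManifold.maximalAtlas 𝓘(ℂ) ω X := chartAt_mem x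
  have hxs : x ∈ e.source := e.map_target hz
  have hxχ : x ∈ χ.source := mem_chart_source ℂ x
  set y := χ x with hy
  have hyt : y ∈ χ.target := χ.map_source hxχ
  have hχy : χ.symm y = x := χ.left_inv hxχ
  set φ : ℂ → ℂ := fun w => e (χ.symm w) with hφ
  have hφy : φ y = z := by simp only [hφ, hχy, hx]; exact e.right_inv hz
  have hφa : AnalyticAt ℂ φ y := analyticAt_coordChange hχm he hyt (by rw [hχy]; exact hxs)
  have hφd : deriv φ y ≠ 0 := deriv_coordChange_ne_zero hχm he hyt (by rw [hχy]; exact hxs)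
  have hev : ∀ᶠ w in 𝓝 y, pullMetric g.toFun χ.symm w =
      ‖deriv φ w‖ ^ 2 * pullMetric g.toFun e.symm (φ w) ∧ deriv φ w ≠ 0 ∧
        0 < pullMetric g.toFun e.symm (φ w) := by
    have h1 : ∀ᶠ w in 𝓝 y, χ.symm w ∈ e.source :=
      (χ.continuousAt_symm hyt).eventually (e.open_source.mem_nhds (by rw [hχy]; exact hxs))
    filter_upwards [eventually_notMem hP hyt (by rw [hχy]; exact hzP), h1,
      hφa.deriv.continuousAt.eventually_ne hφd] with w hw hw1 hw2
    refine ⟨?_, hw2, ?_⟩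
    · exact pullMetric_comp g he (coord_symm_eventuallyEq hw.1 hw1)
        (analyticAt_coordChange hχm he hw.1 hw1).differentiableAt (e.map_source hw1) hw.2
    · exact pullMetric_pos g he (e.map_source hw1) (by
        simp only [hφ]; rw [e.left_inv hw1]; exact hw.2)
  -- The change of coordinate adds `2 log |φ'|`, harmonic because `φ'` is holomorphic and nonzero
  -- near `y`.
  have hlog : (fun w => Real.log (pullMetric g.toFun χ.symm w)) =ᶠ[𝓝 y] fun w =>
      2 * Real.log ‖deriv φ w‖ + Real.log (pullMetric g.toFun e.symm (φ w)) := by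
    filter_upwards [hev] with w hw
    have : 0 < ‖deriv φ w‖ := norm_pos_iff.2 hw.2.1
    rw [hw.1, Real.log_mul (by positivity) hw.2.2.ne', Real.log_pow]
    norm_num
  have hharm := hφa.deriv.harmonicAt_log_norm hφd
  have hcl : ContDiffAt ℝ 2 (fun y => Real.log (pullMetric g.toFun e.symm y)) (φ y) := by
    rw [hφy]; exact contDiffAt_log_pullMetric g he hz hzP
  have hΔ : Δ (fun w => Real.log (pullMetric g.toFun χ.symm w)) y =
      ‖deriv φ y‖ ^ 2 * Δ (fun y => Real.log (pullMetric g.toFun e.symm y)) z := by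
    rw [(InnerProductSpace.laplacian_congr_nhds hlog).self_of_nhds,
      laplacian_fun_add (contDiffAt_const.mul hharm.1) (contDiffAt_two_comp_analyticAt hcl hφa),
      laplacian_const_mul 2 hharm.1, laplacian_comp_analyticAt hcl hφa, hφy]
    have : Δ (fun x => Real.log ‖deriv φ x‖) y = 0 := hharm.2.self_of_nhds
    rw [this]; ring
  have hw := hg.wang x hzP
  have hh := (hev.self_of_nhds).1
  rw [hφy] at hh
  have hhe : 0 < pullMetric g.toFun e.symm z := pullMetric_pos g he hz hzP
  have hn : 0 < ‖deriv φ y‖ := norm_pos_iff.2 hφd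
  unfold ConformalMetric.curvature at hw
  rw [← hχ, ← hy, hΔ, hh] at hw
  field_simp at hw
  linarith

end Coordinates

/-! ### Nonpositivity of the curvature, hence `u ≥ 0`. -/

section NonpositiveCurvature

variable {X : Type*} [TopologicalSpace X] [ChartedSpace ℂ X] [IsManifold 𝓘(ℂ) ω X] {P : Set X}
  {g : ConformalMetric X P} {b : CubicDifferential X P}

theorem continuousAt_normSq (g : ConformalMetric X P) (b : CubicDifferential X P)
    (hP : IsClosed P) {x : X} (hx : x ∉ P) : ContinuousAt (normSq g b) x := by
  set χ := chartAt ℂ x with hχ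
  have hχm : χ ∈ IsManifold.maximalAtlas 𝓘(ℂ) ω X := chartAt_mem x
  have hxχ : x ∈ χ.source := mem_chart_source ℂ x
  have hy : χ x ∈ χ.target := χ.map_source hxχ
  have hxP : χ.symm (χ x) ∉ P := by rwa [χ.left_inv hxχ]
  set F : ℂ → ℝ := fun z => ‖pullCubic b.toFun χ.symm z‖ ^ 2 / pullMetric g.toFun χ.symm z ^ 3
  have hF : ContinuousAt F (χ x) :=
    ((analyticAt_pullCubic b hP hχm hy hxP).continuousAt.norm.pow 2).div
      ((contDiffAt_pullMetric g hχm hy hxP).continuousAt.pow 3)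
      (pow_pos (pullMetric_pos g hχm hy hxP) 3).ne'
  have hev : normSq g b =ᶠ[𝓝 x] fun y => F (χ y) := by
    filter_upwards [χ.open_source.mem_nhds hxχ, hP.isOpen_compl.mem_nhds hx] with y h1 h2
    have h3 := normSq_eq_pull g b hχm (χ.map_source h1) (by rwa [χ.left_inv h1])
    rwa [χ.left_inv h1] at h3
  exact (ContinuousAt.comp hF (χ.continuousAt hxχ)).congr hev.symm

/-- The maximum principle for the norm of the cubic differential, multiplied by a power of the
modulus of a coordinate. -/
theorem normSq_le_half_of_isLocalMax (hP : IsClosed P) (hg : IsWangMetric g b)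
    {e : OpenPartialHomeomorph X ℂ} (he : e ∈ IsManifold.maximalAtlas 𝓘(ℂ) ω X) {z z₀ : ℂ}
    (hz : z ∈ e.target) (hzP : e.symm z ∉ P) (hz₀ : z ≠ z₀) {ε δ : ℝ} (hδ : 0 < δ)
    (hmax : IsLocalMax (fun y => normSq g b (e.symm y) * (‖y - z₀‖ / δ) ^ ε) z) :
    normSq g b (e.symm z) ≤ 1 / 2 := by
  by_contra! hlt
  have hb0 : pullCubic b.toFun e.symm z ≠ 0 := by
    intro h0
    rw [normSq_eq_pull g b he hz hzP, h0] at hlt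
    norm_num at hlt
  have hf := analyticAt_pullCubic b hP he hz hzP
  have hfl := hf.harmonicAt_log_norm hb0
  have hdl : InnerProductSpace.HarmonicAt (fun y : ℂ => Real.log ‖y - z₀‖) z :=
    AnalyticAt.harmonicAt_log_norm (f := fun y => y - z₀) (by fun_prop) (sub_ne_zero.2 hz₀)
  have hhc := contDiffAt_log_pullMetric g he hz hzP
  set L : ℂ → ℝ := fun y => 2 * Real.log ‖pullCubic b.toFun e.symm y‖
    - 3 * Real.log (pullMetric g.toFun e.symm y) + (ε * Real.log ‖y - z₀‖ - ε * Real.log δ) with hL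
  have hev : ∀ᶠ y in 𝓝 z, 0 < normSq g b (e.symm y) * (‖y - z₀‖ / δ) ^ ε ∧
      Real.log (normSq g b (e.symm y) * (‖y - z₀‖ / δ) ^ ε) = L y := by
    filter_upwards [eventually_notMem hP hz hzP, hf.continuousAt.eventually_ne hb0,
      continuousAt_id.eventually_ne hz₀] with y hy hy1 hy2
    have h1 : 0 < ‖pullCubic b.toFun e.symm y‖ := norm_pos_iff.2 hy1
    have h2 := pullMetric_pos g he hy.1 hy.2
    have h3 : 0 < ‖y - z₀‖ := norm_pos_iff.2 (sub_ne_zero.2 hy2)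
    have h4 : 0 < ‖y - z₀‖ / δ := by positivity
    rw [normSq_eq_pull g b he hy.1 hy.2]
    refine ⟨by positivity, ?_⟩
    rw [Real.log_mul (by positivity) (by positivity), Real.log_rpow h4,
      Real.log_div h3.ne' hδ.ne', Real.log_div (by positivity) (by positivity), Real.log_pow,
      Real.log_pow]
    simp only [hL]
    push_cast; ring
  have hLmax : IsLocalMax L z := by
    filter_upwards [hmax, hev] with y h1 h2
    rw [← h2.2, ← hev.self_of_nhds.2]
    exact Real.log_le_log h2.1 h1
  have c1 : ContDiffAt ℝ 2 (fun y => 2 * Real.log ‖pullCubic b.toFun e.symm y‖) z :=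
    contDiffAt_const.mul hfl.1
  have c2 : ContDiffAt ℝ 2 (fun y => 3 * Real.log (pullMetric g.toFun e.symm y)) z :=
    contDiffAt_const.mul hhc
  have c3 : ContDiffAt ℝ 2 (fun y => ε * Real.log ‖y - z₀‖) z := contDiffAt_const.mul hdl.1
  -- Only the metric contributes, the other terms being harmonic or constant. The value is positive
  -- where `‖b‖² > 1/2`, which is impossible at a maximum.
  have hLΔ : Δ L z = -(6 * pullMetric g.toFun e.symm z * (1 - 2 * normSq g b (e.symm z))) := by
    have e1 : Δ (fun y => Real.log ‖pullCubic b.toFun e.symm y‖) z = 0 := hfl.2.self_of_nhds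
    have e2 : Δ (fun y : ℂ => Real.log ‖y - z₀‖) z = 0 := hdl.2.self_of_nhds
    rw [hL, laplacian_fun_add (c1.sub c2) (c3.sub contDiffAt_const), laplacian_fun_sub c1 c2,
      laplacian_sub_const _ c3, laplacian_const_mul _ hfl.1, laplacian_const_mul _ hhc,
      laplacian_const_mul _ hdl.1, e1, e2, laplacian_log_pullMetric hP hg he hz hzP]
    ring
  have := laplacian_nonpos_of_isLocalMax ((c1.sub c2).add (c3.sub contDiffAt_const)) hLmax
  rw [hLΔ] at this
  nlinarith [pullMetric_pos g he hz hzP]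

/-- A bounded function obeys the maximum principle across an isolated puncture. If the bound failed
at `y`, a weight `(|z - z₀|/δ)^ε` with small `ε` would keep the value at `y` above `M`, while making
the function smaller than `M` near `z₀`. The maximum over an annulus would then be interior, where
`‖b‖² ≤ 1/2 ≤ M`. -/
theorem normSq_le_of_sphere (hP : IsClosed P) (hg : IsWangMetric g b)
    {e : OpenPartialHomeomorph X ℂ} (he : e ∈ IsManifold.maximalAtlas 𝓘(ℂ) ω X) {z₀ : ℂ} {δ B : ℝ}
    (hball : ∀ z, ‖z - z₀‖ ≤ δ → z ≠ z₀ →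
      z ∈ e.target ∧ e.symm z ∉ P ∧ normSq g b (e.symm z) ≤ B) {M : ℝ} (hM : 1 / 2 ≤ M)
    (hsphere : ∀ z, ‖z - z₀‖ = δ → normSq g b (e.symm z) ≤ M) {y : ℂ} (hy : ‖y - z₀‖ ≤ δ)
    (hy₀ : y ≠ z₀) : normSq g b (e.symm y) ≤ M := by
  by_contra! hlt
  have hr : 0 < ‖y - z₀‖ := norm_pos_iff.2 (sub_ne_zero.2 hy₀)
  have hδ : 0 < δ := hr.trans_le hy
  obtain ⟨ε, hε, hε0⟩ : ∃ ε : ℝ, M < normSq g b (e.symm y) * (‖y - z₀‖ / δ) ^ ε ∧ 0 < ε := by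
    have hc : ContinuousAt (fun ε : ℝ => normSq g b (e.symm y) * (‖y - z₀‖ / δ) ^ ε) 0 :=
      continuousAt_const.mul (Real.continuousAt_const_rpow (by positivity))
    have := hc.eventually (lt_mem_nhds (by simpa using hlt))
    exact ((this.filter_mono nhdsWithin_le_nhds).and
      (self_mem_nhdsWithin (s := Ioi (0 : ℝ)))).exists
  set F : ℂ → ℝ := fun z => normSq g b (e.symm z) * (‖z - z₀‖ / δ) ^ ε with hF
  have hqnn : ∀ z, ‖z - z₀‖ ≤ δ → z ≠ z₀ → 0 ≤ normSq g b (e.symm z) := by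
    intro z h1 h2
    obtain ⟨h3, h4, -⟩ := hball z h1 h2
    rw [normSq_eq_pull g b he h3 h4]
    have := pullMetric_pos g he h3 h4
    positivity
  have hB0 : 0 ≤ B := (hqnn y hy hy₀).trans (hball y hy hy₀).2.2
  -- The inner radius: there the weight times the a priori bound `B` is below `M`.
  obtain ⟨η, ⟨hη, hη1⟩, hη0⟩ : ∃ η : ℝ, (B * (η / δ) ^ ε < M ∧ η < ‖y - z₀‖) ∧ 0 < η := by
    have hc : ContinuousAt (fun η : ℝ => B * (η / δ) ^ ε) 0 :=
      continuousAt_const.mul (ContinuousAt.rpow_const (by fun_prop) (Or.inr hε0.le))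
    have h0 : B * (0 / δ) ^ ε < M := by
      rw [zero_div, Real.zero_rpow hε0.ne', mul_zero]; linarith
    have := hc.eventually (gt_mem_nhds h0)
    exact (((this.and (gt_mem_nhds hr)).filter_mono nhdsWithin_le_nhds).and
      (self_mem_nhdsWithin (s := Ioi (0 : ℝ)))).exists
  have hFc : ∀ z, ‖z - z₀‖ ≤ δ → z ≠ z₀ → ContinuousAt F z := by
    intro z h1 h2
    obtain ⟨h3, h4, -⟩ := hball z h1 h2
    refine ContinuousAt.mul ?_ (ContinuousAt.rpow_const (by fun_prop) (Or.inr hε0.le))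
    exact ContinuousAt.comp (f := e.symm) (continuousAt_normSq g b hP h4) (e.continuousAt_symm h3)
  have hK : IsCompact (Metric.closedBall z₀ δ \ Metric.ball z₀ η) :=
    (isCompact_closedBall z₀ δ).diff Metric.isOpen_ball
  have hmem : ∀ z, z ∈ Metric.closedBall z₀ δ \ Metric.ball z₀ η ↔
      ‖z - z₀‖ ≤ δ ∧ η ≤ ‖z - z₀‖ := by
    intro z; simp [dist_eq_norm]
  have hne : ∀ z, η ≤ ‖z - z₀‖ → z ≠ z₀ := by
    rintro z h rfl; simp at h; linarith
  obtain ⟨z, hzK, hzmax⟩ := hK.exists_isMaxOn ⟨y, (hmem y).2 ⟨hy, hη1.le⟩⟩ (f := F)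
    (fun x hx => (hFc x ((hmem x).1 hx).1 (hne x ((hmem x).1 hx).2)).continuousWithinAt)
  obtain ⟨hz1, hz2⟩ := (hmem z).1 hzK
  have hFz : M < F z := hε.trans_le (hzmax ((hmem y).2 ⟨hy, hη1.le⟩))
  have hzn := hne z hz2
  obtain ⟨hzt, hzP, hzB⟩ := hball z hz1 hzn
  have hz1' : ‖z - z₀‖ < δ := by
    refine lt_of_le_of_ne hz1 fun h => ?_
    have := hsphere z h
    simp only [hF, h, div_self hδ.ne', Real.one_rpow, mul_one] at hFz
    linarith
  have hz2' : η < ‖z - z₀‖ := by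
    refine lt_of_le_of_ne hz2 fun h => ?_
    have : F z ≤ B * (η / δ) ^ ε := by
      simp only [hF, ← h]
      gcongr
    linarith
  have hloc : IsLocalMax F z := by
    refine hzmax.isLocalMax ?_
    have hcn : ContinuousAt (fun z : ℂ => ‖z - z₀‖) z := by fun_prop
    filter_upwards [hcn.eventually (gt_mem_nhds hz1'), hcn.eventually (lt_mem_nhds hz2')]
      with x h1 h2 using (hmem x).2 ⟨h1.le, h2.le⟩
  have hhalf := normSq_le_half_of_isLocalMax hP hg he hzt hzP hzn hδ hloc
  have : F z ≤ normSq g b (e.symm z) := by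
    refine mul_le_of_le_one_right (hqnn z hz1 hzn) ?_
    exact Real.rpow_le_one (by positivity) ((div_le_one hδ).2 hz1) hε0.le
  linarith

/-- Near a cusp-type puncture `κ < 0` already suffices. At a pole of order at least three the upper
bound on `κ` bounds `‖b‖²`, and control comes from a small circle. The sets do not depend on `M`, so
a maximum over a compact set may be inserted for it. -/
theorem exists_nhds_normSq_le [T2Space X] (hP : P.Finite) (hg : IsWangMetric g b) {p : X}
    (hp : p ∈ P) : ∃ D S : Set X, IsOpen D ∧ p ∈ D ∧ IsCompact S ∧ S ⊆ Pᶜ ∧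
      ∀ M : ℝ, 1 / 2 ≤ M → (∀ x ∈ S, normSq g b x ≤ M) → ∀ x ∈ D, x ∉ P → normSq g b x ≤ M := by
  rcases le_or_gt ((-2 : ℤ) : WithTop ℤ) (b.ord p) with hord | hord
  · have h := (hg.cuspidal p hp hord).eventually (gt_mem_nhds (show (-1 : ℝ) < 0 by norm_num))
    obtain ⟨D, hDo, hpD, hD⟩ := mem_nhdsWithin.1 h
    refine ⟨D, ∅, hDo, hpD, isCompact_empty, empty_subset _, fun M hM _ x hxD hxP => ?_⟩
    have h1 : g.curvature x < 0 := hD ⟨hxD, hxP⟩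
    rw [hg.wang x hxP] at h1
    linarith
  · have hord' : b.ord p ≤ ((-3 : ℤ) : WithTop ℤ) := by
      cases h : b.ord p with
      | top => rw [h] at hord; exact absurd hord (by simp)
      | coe k =>
        rw [h] at hord
        have : k < -2 := by exact_mod_cast hord
        exact_mod_cast (by omega : k ≤ -3)
    obtain ⟨α, β, -, -, hαβ⟩ := hg.pinched p hp hord'
    obtain ⟨D, hDo, hpD, hD⟩ := mem_nhdsWithin.1 hαβ
    have hPc : IsClosed P := hP.isClosed
    set χ := chartAt ℂ p with hχ
    have hχm : χ ∈ IsManifold.maximalAtlas 𝓘(ℂ) ω X := chartAt_mem p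
    have hpχ : p ∈ χ.source := mem_chart_source ℂ p
    set z₀ := χ p with hz₀
    have hz₀t : z₀ ∈ χ.target := χ.map_source hpχ
    have hsz : χ.symm z₀ = p := χ.left_inv hpχ
    have hcont := χ.continuousAt_symm hz₀t
    rw [ContinuousAt, hsz] at hcont
    have hiso : (P \ {p})ᶜ ∈ 𝓝 p :=
      (hP.subset sdiff_subset).isClosed.isOpen_compl.mem_nhds (by simp)
    have hev : ∀ᶠ z in 𝓝 z₀, z ∈ χ.target ∧ χ.symm z ∈ (P \ {p})ᶜ ∧ χ.symm z ∈ D :=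
      (χ.open_target.eventually_mem hz₀t).and
        ((hcont.eventually hiso).and (hcont.eventually (hDo.mem_nhds hpD)))
    obtain ⟨r, hr, hball⟩ := Metric.eventually_nhds_iff_ball.1 hev
    have hb : ∀ z, ‖z - z₀‖ ≤ r / 2 → z ≠ z₀ →
        z ∈ χ.target ∧ χ.symm z ∉ P ∧ normSq g b (χ.symm z) ≤ (1 + β) / 2 := by
      intro z h1 h2
      obtain ⟨h3, h4, h5⟩ := hball z (by rw [Metric.mem_ball, dist_eq_norm]; linarith)
      have h6 : χ.symm z ∉ P := by
        intro h
        refine h4 ⟨h, fun h7 => h2 ?_⟩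
        rw [mem_singleton_iff] at h7
        rw [← χ.right_inv h3, h7]
      have h7 := (hD ⟨h5, h6⟩).2
      rw [hg.wang _ h6] at h7
      exact ⟨h3, h6, by linarith⟩
    have hne : ∀ z, ‖z - z₀‖ = r / 2 → z ≠ z₀ := by
      rintro z h rfl; simp at h; linarith
    refine ⟨χ.symm '' Metric.ball z₀ (r / 2), χ.symm '' Metric.sphere z₀ (r / 2), ?_, ?_, ?_, ?_, ?_⟩
    · refine χ.symm.isOpen_image_of_subset_source Metric.isOpen_ball fun z hz => ?_
      exact (hball z (Metric.ball_subset_ball (by linarith) hz)).1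
    · exact ⟨z₀, Metric.mem_ball_self (by linarith), hsz⟩
    · refine (isCompact_sphere z₀ (r / 2)).image_of_continuousOn fun z hz => ?_
      have hz' : ‖z - z₀‖ = r / 2 := by simpa [dist_eq_norm] using hz
      exact (χ.continuousAt_symm (hb z hz'.le (hne z hz')).1).continuousWithinAt
    · rintro _ ⟨z, hz, rfl⟩
      have hz' : ‖z - z₀‖ = r / 2 := by simpa [dist_eq_norm] using hz
      exact (hb z hz'.le (hne z hz')).2.1
    · rintro M hM hS _ ⟨z, hz, rfl⟩ hzP
      have hz' : ‖z - z₀‖ < r / 2 := by simpa [dist_eq_norm] using hz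
      refine normSq_le_of_sphere hPc hg hχm hb hM (fun y hy => ?_) hz'.le ?_
      · exact hS _ ⟨y, by simpa [dist_eq_norm] using hy, rfl⟩
      · rintro rfl; exact hzP (hsz ▸ hp)

/-- The curvature of the Wang metric is nonpositive. -/
theorem normSq_le_half [T2Space X] [CompactSpace X] (hP : P.Finite) (hg : IsWangMetric g b) {x : X}
    (hx : x ∉ P) : normSq g b x ≤ 1 / 2 := by
  have hPc : IsClosed P := hP.isClosed
  choose! D S hDo hpD hSc hSP hDS using fun p (hp : p ∈ P) => exists_nhds_normSq_le hP hg hp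
  -- A compact subset of the punctured surface controlling the supremum of `‖b‖²`: if its maximum
  -- there exceeded `1/2`, it would be a global maximum.
  set K : Set X := (⋃ p ∈ P, D p)ᶜ ∪ ⋃ p ∈ P, S p with hK
  have hKc : IsCompact K :=
    (isOpen_biUnion hDo).isClosed_compl.isCompact.union (hP.isCompact_biUnion hSc)
  have hKP : K ⊆ Pᶜ := by
    refine union_subset (fun y hy hyP => hy ?_) (iUnion₂_subset hSP)
    exact mem_biUnion hyP (hpD y hyP)
  have hall : ∀ M : ℝ, 1 / 2 ≤ M → (∀ y ∈ K, normSq g b y ≤ M) → ∀ y ∉ P, normSq g b y ≤ M := by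
    intro M hM hKM y hy
    by_cases hyD : y ∈ ⋃ p ∈ P, D p
    · obtain ⟨p, hp, hyp⟩ := mem_iUnion₂.1 hyD
      exact hDS p hp M hM (fun z hz => hKM z (Or.inr (mem_biUnion hp hz))) y hyp hy
    · exact hKM y (Or.inl hyD)
  rcases K.eq_empty_or_nonempty with hKe | hKne
  · exact hall _ le_rfl (by simp [hKe]) x hx
  · obtain ⟨y, hyK, hymax⟩ := hKc.exists_isMaxOn hKne (f := normSq g b)
      (fun z hz => (continuousAt_normSq g b hPc (hKP hz)).continuousWithinAt)
    suffices hy : normSq g b y ≤ 1 / 2 from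
      hall _ le_rfl (fun z hz => (hymax hz).trans hy) x hx
    by_contra! hlt
    have hyP : y ∉ P := hKP hyK
    have hglob := hall _ hlt.le (fun z hz => hymax hz)
    set χ := chartAt ℂ y
    have hyχ : y ∈ χ.source := mem_chart_source ℂ y
    have hyt := χ.map_source hyχ
    have hsy : χ.symm (χ y) = y := χ.left_inv hyχ
    -- No weight is needed here: the exponent is `0` and the centre is any point other than `χ y`.
    have hloc : IsLocalMax (fun z => normSq g b (χ.symm z) * (‖z - (χ y + 1)‖ / 1) ^ (0 : ℝ))
        (χ y) := by
      filter_upwards [eventually_notMem hPc hyt (by rwa [hsy])] with z hz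
      simpa [hsy] using hglob _ hz.2
    have := normSq_le_half_of_isLocalMax hPc hg (chartAt_mem y) hyt (by rwa [hsy]) (by simp)
      one_pos hloc
    rw [hsy] at this
    linarith

theorem logRatio_nonneg [T2Space X] [CompactSpace X] (hP : P.Finite) (hg : IsWangMetric g b)
    {e : OpenPartialHomeomorph X ℂ} (he : e ∈ IsManifold.maximalAtlas 𝓘(ℂ) ω X) {z : ℂ}
    (hz : z ∈ e.target) (hzP : e.symm z ∉ P) (hb : pullCubic b.toFun e.symm z ≠ 0) :
    0 ≤ logRatio g b (e.symm z) := by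
  have h1 := normSq_le_half hP hg hzP
  have h2 := normSq_eq_exp g b he hz hzP hb
  have h3 : Real.exp (-3 * logRatio g b (e.symm z)) ≤ 1 := by linarith
  rw [Real.exp_le_one_iff] at h3
  linarith

end NonpositiveCurvature

/-! ### The equation for `u` on the cylinder `z = exp (-w)`. -/

section LocalForm

variable {X : Type*} [TopologicalSpace X] [ChartedSpace ℂ X] {P : Set X}
  {g : ConformalMetric X P} {b : CubicDifferential X P} {p : X}
  {e : OpenPartialHomeomorph X ℂ} {a : ℝ}

theorem IsCoordinate.mem_target (hc : IsCoordinate P p e a) {z : ℂ} (hz : ‖z‖ < a) :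
    z ∈ e.target :=
  hc.ball_subset (by simpa using hz)

theorem IsCoordinate.symm_zero (hc : IsCoordinate P p e a) : e.symm 0 = p := by
  rw [← hc.map_center]; exact e.left_inv hc.mem_source

theorem contDiffAt_logRatio_symm (hP : IsClosed P) (g : ConformalMetric X P)
    (b : CubicDifferential X P) (he : e ∈ IsManifold.maximalAtlas 𝓘(ℂ) ω X) {z : ℂ}
    (hz : z ∈ e.target) (hzP : e.symm z ∉ P) (hb : pullCubic b.toFun e.symm z ≠ 0) :
    ContDiffAt ℝ 2 (fun y => logRatio g b (e.symm y)) z ∧ (fun y => logRatio g b (e.symm y)) =ᶠ[𝓝 z]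
      fun y => Real.log (pullMetric g.toFun e.symm y) - Real.log 2 / 3 -
        2 / 3 * Real.log ‖pullCubic b.toFun e.symm y‖ := by
  have hf := analyticAt_pullCubic b hP he hz hzP
  have hev : (fun y => logRatio g b (e.symm y)) =ᶠ[𝓝 z]
      fun y => Real.log (pullMetric g.toFun e.symm y) - Real.log 2 / 3 -
        2 / 3 * Real.log ‖pullCubic b.toFun e.symm y‖ := by
    filter_upwards [eventually_notMem hP hz hzP, hf.continuousAt.eventually_ne hb] with y h1 h2
    exact logRatio_eq_pull g b he h1.1 h1.2 h2
  refine ⟨ContDiffAt.congr_of_eventuallyEq ?_ hev, hev⟩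
  exact ((contDiffAt_log_pullMetric g he hz hzP).sub contDiffAt_const).sub
    (contDiffAt_const.mul (hf.harmonicAt_log_norm hb).1)

/-- The function `u` in the coordinate `w` with `z = exp (-w)`. -/
def cylinderRatio (g : ConformalMetric X P) (b : CubicDifferential X P)
    (e : OpenPartialHomeomorph X ℂ) (w : ℂ) : ℝ :=
  logRatio g b (e.symm (Complex.exp (-w)))

theorem analyticAt_exp_neg (w : ℂ) : AnalyticAt ℂ (fun w => Complex.exp (-w)) w := by fun_prop

theorem norm_exp_neg (w : ℂ) : ‖Complex.exp (-w)‖ = Real.exp (-w.re) := by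
  rw [Complex.norm_exp, Complex.neg_re]

theorem cylinderRatio_periodic (w : ℂ) :
    cylinderRatio g b e (w + 2 * Real.pi * Complex.I) = cylinderRatio g b e w := by
  have : Complex.exp (-(w + 2 * Real.pi * Complex.I)) = Complex.exp (-w) := by
    rw [neg_add, ← sub_eq_add_neg, Complex.exp_sub, Complex.exp_two_pi_mul_I, div_one]
  simp only [cylinderRatio, this]

/-- The pinching `κ > α > -1` gives `exp (-3u) > 1 + α > 0`. -/
theorem eventually_logRatio_le (hg : IsWangMetric g b) (hp : p ∈ P) (hc : IsCoordinate P p e a)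
    (hord : b.ord p ≤ ((-3 : ℤ) : WithTop ℤ)) :
    ∃ M δ : ℝ, 0 < δ ∧ ∀ z : ℂ, 0 < ‖z‖ → ‖z‖ < a → ‖z‖ < δ → pullCubic b.toFun e.symm z ≠ 0 →
      logRatio g b (e.symm z) ≤ M := by
  obtain ⟨α, β, hα, -, hαβ⟩ := hg.pinched p hp hord
  obtain ⟨D, hDo, hpD, hD⟩ := mem_nhdsWithin.1 hαβ
  have h0 := hc.mem_target (z := 0) (by simpa using hc.radius_pos)
  have hcont := e.continuousAt_symm h0
  rw [ContinuousAt, hc.symm_zero] at hcont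
  obtain ⟨δ, hδ, hball⟩ := Metric.eventually_nhds_iff_ball.1 (hcont.eventually (hDo.mem_nhds hpD))
  refine ⟨-(Real.log (1 + α) / 3), δ, hδ, fun z h1 h2 h3 hb => ?_⟩
  have hzP := hc.notMem z h1 h2
  have h4 := (hD ⟨hball z (by simpa using h3), hzP⟩).1
  have h5 := normSq_eq_exp g b hc.mem_atlas (hc.mem_target h2) hzP hb
  rw [hg.wang _ hzP, h5] at h4
  have h6 : Real.log (1 + α) < -3 * logRatio g b (e.symm z) := by
    rw [Real.log_lt_iff_lt_exp (by linarith)]; linarith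
  linarith

/-- The pinching controls `u` near the puncture, and continuity on a compact annulus controls the
rest. -/
theorem exists_cylinderRatio_le (hP : IsClosed P) (hg : IsWangMetric g b) (hp : p ∈ P)
    (hc : IsCoordinate P p e a) (hord : b.ord p ≤ ((-3 : ℤ) : WithTop ℤ)) {s : ℝ}
    (hs : Real.exp (-s) < a)
    (hb : ∀ z : ℂ, 0 < ‖z‖ → ‖z‖ ≤ Real.exp (-s) → pullCubic b.toFun e.symm z ≠ 0) :
    ∃ M : ℝ, ∀ w : ℂ, s ≤ w.re → cylinderRatio g b e w ≤ M := by
  obtain ⟨M, δ, hδ, hM⟩ := eventually_logRatio_le hg hp hc hord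
  have hK : IsCompact (Metric.closedBall (0 : ℂ) (Real.exp (-s)) \ Metric.ball 0 δ) :=
    (isCompact_closedBall _ _).diff Metric.isOpen_ball
  have hcont : ContinuousOn (fun z => logRatio g b (e.symm z))
      (Metric.closedBall (0 : ℂ) (Real.exp (-s)) \ Metric.ball 0 δ) := by
    intro z hz
    simp only [Set.mem_sdiff, Metric.mem_closedBall, Metric.mem_ball, dist_zero_right, not_lt] at hz
    have h1 : 0 < ‖z‖ := hδ.trans_le hz.2
    have h2 : ‖z‖ < a := hz.1.trans_lt hs
    exact (contDiffAt_logRatio_symm hP g b hc.mem_atlas (hc.mem_target h2)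
      (hc.notMem z h1 h2) (hb z h1 hz.1)).1.continuousAt.continuousWithinAt
  obtain ⟨M', hM'⟩ := hK.exists_bound_of_continuousOn hcont
  refine ⟨max M M', fun w hw => ?_⟩
  have h1 : 0 < ‖Complex.exp (-w)‖ := by rw [norm_exp_neg]; exact Real.exp_pos _
  have h2 : ‖Complex.exp (-w)‖ ≤ Real.exp (-s) := by
    rw [norm_exp_neg]; exact Real.exp_le_exp.2 (by linarith)
  by_cases h : ‖Complex.exp (-w)‖ < δ
  · exact (hM _ h1 (h2.trans_lt hs) h (hb _ h1 h2)).trans (le_max_left _ _)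
  · exact ((le_abs_self _).trans (hM' _ (by simpa using ⟨h2, not_lt.1 h⟩))).trans
      (le_max_right _ _)

variable [IsManifold 𝓘(ℂ) ω X]

/-- The order is defined in the preferred chart at `p`, the normal form in the coordinate `e`. A
coordinate change with nonzero derivative preserves the order, and the factor `(φ')³` has order
zero. -/
theorem ord_le_of_pole (hc : IsCoordinate P p e a) {k : ℕ} (hk : 3 ≤ k) {G : ℂ → ℂ}
    (hG : AnalyticAt ℂ G 0) (hG0 : G 0 ≠ 0)
    (hb : ∀ z : ℂ, 0 < ‖z‖ → ‖z‖ < a → pullCubic b.toFun e.symm z = G z / z ^ k) :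
    b.ord p ≤ ((-3 : ℤ) : WithTop ℤ) := by
  set χ := chartAt ℂ p with hχ
  have hχm : χ ∈ IsManifold.maximalAtlas 𝓘(ℂ) ω X := chartAt_mem p
  have hpχ : p ∈ χ.source := mem_chart_source ℂ p
  have hyt : χ p ∈ χ.target := χ.map_source hpχ
  have hsy : χ.symm (χ p) = p := χ.left_inv hpχ
  have hsrc : χ.symm (χ p) ∈ e.source := by rw [hsy]; exact hc.mem_source
  set φ : ℂ → ℂ := fun y => e (χ.symm y) with hφ
  have hφ0 : φ (χ p) = 0 := by simp only [hφ, hsy, hc.map_center]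
  have hφa : AnalyticAt ℂ φ (χ p) := analyticAt_coordChange hχm hc.mem_atlas hyt hsrc
  have hφd : deriv φ (χ p) ≠ 0 := deriv_coordChange_ne_zero hχm hc.mem_atlas hyt hsrc
  have hev : ∀ᶠ y in 𝓝[≠] (χ p), pullCubic b.toFun χ.symm y =
      (deriv φ y) ^ 3 * ((pullCubic b.toFun e.symm) ∘ φ) y := by
    have h1 : ∀ᶠ y in 𝓝 (χ p), χ.symm y ∈ e.source :=
      (χ.continuousAt_symm hyt).eventually (e.open_source.mem_nhds hsrc)
    have h2 : ∀ᶠ y in 𝓝 (χ p), ‖φ y‖ < a :=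
      hφa.continuousAt.norm.eventually (gt_mem_nhds (by simpa [hφ0] using hc.radius_pos))
    filter_upwards [h1.filter_mono nhdsWithin_le_nhds, h2.filter_mono nhdsWithin_le_nhds,
      (χ.open_target.eventually_mem hyt).filter_mono nhdsWithin_le_nhds,
      self_mem_nhdsWithin] with y h1 h2 h3 h4
    have h5 : φ y ≠ 0 := by
      intro h0
      refine h4 ?_
      have h6 : χ.symm y = p := by
        rw [← e.left_inv h1]
        change e.symm (φ y) = p
        rw [h0, hc.symm_zero]
      rw [mem_singleton_iff, ← h6, χ.right_inv h3]
    have h6 : χ.symm y ∉ P := by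
      rw [← e.left_inv h1]
      exact hc.notMem _ (norm_pos_iff.2 h5) h2
    exact pullCubic_comp b hc.mem_atlas (coord_symm_eventuallyEq h3 h1)
      (analyticAt_coordChange hχm hc.mem_atlas h3 h1).differentiableAt (e.map_source h1) h6
  have hfe : pullCubic b.toFun e.symm =ᶠ[𝓝[≠] 0] fun z => (z - 0) ^ (-(k : ℤ)) • G z := by
    have h1 : ∀ᶠ z : ℂ in 𝓝 0, ‖z‖ < a := by
      filter_upwards [Metric.ball_mem_nhds (0 : ℂ) hc.radius_pos] with z hz
      simpa using hz
    filter_upwards [h1.filter_mono nhdsWithin_le_nhds, self_mem_nhdsWithin] with z h1 h2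
    rw [hb z (norm_pos_iff.2 h2) h1, sub_zero, zpow_neg, zpow_natCast, smul_eq_mul, div_eq_inv_mul]
  have hmer' : MeromorphicAt (fun z : ℂ => (z - 0) ^ (-(k : ℤ)) • G z) 0 := by
    have := hG.meromorphicAt
    fun_prop
  have hmer : MeromorphicAt (pullCubic b.toFun e.symm) 0 := hmer'.congr hfe.symm
  have hord : meromorphicOrderAt (pullCubic b.toFun e.symm) 0 = ((-(k : ℤ) : ℤ) : WithTop ℤ) :=
    (meromorphicOrderAt_eq_int_iff hmer).2 ⟨G, hG, hG0, hfe⟩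
  have hd3 : meromorphicOrderAt (fun y => deriv φ y ^ 3) (χ p) = ((0 : ℤ) : WithTop ℤ) :=
    (meromorphicOrderAt_eq_int_iff (hφa.deriv.pow 3).meromorphicAt).2
      ⟨_, hφa.deriv.pow 3, pow_ne_zero 3 hφd, .of_forall fun y => by simp⟩
  have hcomp : meromorphicOrderAt (pullCubic b.toFun e.symm ∘ φ) (χ p) =
      ((-(k : ℤ) : ℤ) : WithTop ℤ) := by
    rw [meromorphicOrderAt_comp_of_deriv_ne_zero hφa hφd, hφ0, hord]
  have hmc : MeromorphicAt (pullCubic b.toFun e.symm ∘ φ) (χ p) :=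
    MeromorphicAt.comp_analyticAt (by rwa [hφ0]) hφa
  have hfin : b.ord p = ((-(k : ℤ) : ℤ) : WithTop ℤ) := by
    rw [CubicDifferential.ord, meromorphicOrderAt_congr hev]
    have := meromorphicOrderAt_mul (hφa.deriv.pow 3).meromorphicAt hmc
    rw [Pi.mul_def] at this
    refine this.trans ?_
    rw [hcomp]
    have h0 : meromorphicOrderAt (deriv φ ^ 3) (χ p) = ((0 : ℤ) : WithTop ℤ) := hd3
    rw [h0]
    norm_cast
    simp
  rw [hfin]
  exact_mod_cast (by omega : -(k : ℤ) ≤ -3)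

theorem laplacian_logRatio_symm (hP : IsClosed P) (hg : IsWangMetric g b)
    (he : e ∈ IsManifold.maximalAtlas 𝓘(ℂ) ω X) {z : ℂ} (hz : z ∈ e.target) (hzP : e.symm z ∉ P)
    (hb : pullCubic b.toFun e.symm z ≠ 0) :
    Δ (fun y => logRatio g b (e.symm y)) z =
      2 * pullMetric g.toFun e.symm z * (1 - Real.exp (-3 * logRatio g b (e.symm z))) := by
  have hf := (analyticAt_pullCubic b hP he hz hzP).harmonicAt_log_norm hb
  have hh := contDiffAt_log_pullMetric g he hz hzP
  have e1 : Δ (fun y => Real.log ‖pullCubic b.toFun e.symm y‖) z = 0 := hf.2.self_of_nhds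
  rw [(InnerProductSpace.laplacian_congr_nhds
      (contDiffAt_logRatio_symm hP g b he hz hzP hb).2).self_of_nhds,
    laplacian_fun_sub (hh.sub contDiffAt_const) (contDiffAt_const.mul hf.1),
    laplacian_sub_const _ hh, laplacian_const_mul _ hf.1, e1, laplacian_log_pullMetric hP hg he hz hzP,
    normSq_eq_exp g b he hz hzP hb]
  ring

/-- The prescribed value of `μ` is the density of the flat metric `|b/2|^(2/3)` with respect to
`|dw|²`, since `b` pulls back to `-z³ f(z) dw³`. -/
theorem cylinderRatio_isWangSolutionAt [T2Space X] [CompactSpace X] (hP : P.Finite)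
    (hg : IsWangMetric g b) (hc : IsCoordinate P p e a) {μ : ℂ → ℝ} {w : ℂ}
    (hw : Real.exp (-w.re) < a) (hb : pullCubic b.toFun e.symm (Complex.exp (-w)) ≠ 0)
    (hμ : μ w =
      (‖Complex.exp (-w) ^ 3 * pullCubic b.toFun e.symm (Complex.exp (-w))‖ / 2) ^ (2 / 3 : ℝ)) :
    IsWangSolutionAt μ (cylinderRatio g b e) w := by
  have hz1 : 0 < ‖Complex.exp (-w)‖ := by rw [norm_exp_neg]; exact Real.exp_pos _
  have hz2 : ‖Complex.exp (-w)‖ < a := by rwa [norm_exp_neg]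
  have hzt := hc.mem_target hz2
  have hzP := hc.notMem _ hz1 hz2
  have hcd := (contDiffAt_logRatio_symm hP.isClosed g b hc.mem_atlas hzt hzP hb).1
  refine ⟨contDiffAt_two_comp_analyticAt (φ := fun w => Complex.exp (-w)) hcd
    (analyticAt_exp_neg w),
    logRatio_nonneg hP hg hc.mem_atlas hzt hzP hb, ?_⟩
  have hd : deriv (fun w => Complex.exp (-w)) w = -Complex.exp (-w) := by
    simpa using ((hasDerivAt_neg w).cexp).deriv
  have h1 := laplacian_comp_analyticAt (φ := fun w => Complex.exp (-w)) hcd (analyticAt_exp_neg w)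
  rw [hd, norm_neg, laplacian_logRatio_symm hP.isClosed hg hc.mem_atlas hzt hzP hb] at h1
  refine h1.trans ?_
  have hh := pullMetric_pos g hc.mem_atlas hzt hzP
  have hf := norm_pos_iff.2 hb
  have hu := logRatio_eq_pull g b hc.mem_atlas hzt hzP hb
  change _ = 4 * μ w * (Real.exp (logRatio g b (e.symm (Complex.exp (-w)))) -
    Real.exp (-2 * logRatio g b (e.symm (Complex.exp (-w)))))
  rw [hμ, norm_mul, norm_pow]
  generalize logRatio g b (e.symm (Complex.exp (-w))) = u at *
  generalize pullMetric g.toFun e.symm (Complex.exp (-w)) = h at *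
  generalize ‖pullCubic b.toFun e.symm (Complex.exp (-w))‖ = f at *
  generalize ‖Complex.exp (-w)‖ = r at *
  have h2 : Real.exp (-2 * u) = Real.exp u * Real.exp (-3 * u) := by
    rw [← Real.exp_add]; ring_nf
  -- This is `μ exp u = |z|² h / 2`: the powers of `f` cancel because `exp u = h / (2^(1/3)
  -- f^(2/3))`.
  have h3 : (r ^ 3 * f / 2) ^ (2 / 3 : ℝ) * Real.exp u = r ^ 2 * h / 2 := by
    have hpos : 0 < r ^ 2 * h / 2 := by positivity
    rw [← Real.exp_log hpos, Real.rpow_def_of_pos (by positivity), ← Real.exp_add, hu,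
      Real.log_div (by positivity) (by norm_num), Real.log_div (by positivity) (by norm_num),
      Real.log_mul (by positivity) hf.ne', Real.log_mul (by positivity) hh.ne', Real.log_pow,
      Real.log_pow]
    congr 1
    push_cast; ring
  rw [h2]
  linear_combination (-4 * (1 - Real.exp (-3 * u))) * h3

end LocalForm

/-! ### The Wirtinger derivative of a composition. -/

section Wirtinger

theorem norm_dWirtinger_le (f : ℂ → ℝ) (ζ : ℂ) : ‖dWirtinger f ζ‖ ≤ ‖fderiv ℝ f ζ‖ := by
  have h1 : |fderiv ℝ f ζ 1| ≤ ‖fderiv ℝ f ζ‖ := by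
    simpa using (fderiv ℝ f ζ).le_opNorm 1
  have h2 : |fderiv ℝ f ζ Complex.I| ≤ ‖fderiv ℝ f ζ‖ := by
    simpa using (fderiv ℝ f ζ).le_opNorm Complex.I
  have h3 := norm_sub_le ((fderiv ℝ f ζ 1 : ℝ) : ℂ) (Complex.I * (fderiv ℝ f ζ Complex.I : ℝ))
  rw [norm_mul, Complex.norm_I, one_mul, Complex.norm_real, Complex.norm_real, Real.norm_eq_abs,
    Real.norm_eq_abs] at h3
  rw [dWirtinger, norm_mul]
  have h4 : ‖(1 / 2 : ℂ)‖ = 1 / 2 := by norm_num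
  rw [h4]
  linarith

theorem norm_dWirtinger_comp_le {f F : ℂ → ℝ} {φ : ℂ → ℂ} {ζ : ℂ}
    (hf : f =ᶠ[𝓝 ζ] fun w => F (φ w)) (hF : DifferentiableAt ℝ F (φ ζ))
    (hφ : DifferentiableAt ℂ φ ζ) :
    ‖dWirtinger f ζ‖ ≤ ‖fderiv ℝ F (φ ζ)‖ * ‖deriv φ ζ‖ := by
  refine (norm_dWirtinger_le f ζ).trans ?_
  have h1 : HasFDerivAt φ ((ContinuousLinearMap.toSpanSingleton ℂ (deriv φ ζ)).restrictScalars ℝ) ζ :=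
    hφ.hasDerivAt.hasFDerivAt.restrictScalars ℝ
  have h2 := hF.hasFDerivAt.comp ζ h1
  rw [hf.fderiv_eq, show (fun w => F (φ w)) = F ∘ φ from rfl, h2.fderiv]
  refine (ContinuousLinearMap.opNorm_comp_le _ _).trans ?_
  gcongr
  refine ContinuousLinearMap.opNorm_le_bound _ (norm_nonneg _) fun v => ?_
  simp [mul_comm]

end Wirtinger

/-! ### Primitives, logarithms and bounds on the right half-plane. -/

section HalfPlane

theorem isOpen_rightHalfPlane : IsOpen {ζ : ℂ | 0 < ζ.re} :=
  isOpen_lt continuous_const Complex.continuous_re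

theorem convex_rightHalfPlane : Convex ℝ {ζ : ℂ | 0 < ζ.re} := convex_halfSpace_re_gt 0

/-- Holomorphic functions on the right half-plane have primitives. -/
theorem exists_primitive_rightHalfPlane {F : ℂ → ℂ}
    (hF : DifferentiableOn ℂ F {ζ : ℂ | 0 < ζ.re}) :
    ∃ G : ℂ → ℂ, ∀ ζ : ℂ, 0 < ζ.re → HasDerivAt G (F ζ) ζ := by
  have hne : ∀ ξ ∈ Metric.ball (0 : ℂ) 1, 1 - ξ ≠ 0 := by
    intro ξ hξ h
    rw [← sub_eq_zero.1 h] at hξ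
    simp at hξ
  have hre : ∀ ξ ∈ Metric.ball (0 : ℂ) 1, 0 < ((1 + ξ) / (1 - ξ)).re := by
    intro ξ hξ
    have h1 : 0 < Complex.normSq (1 - ξ) := Complex.normSq_pos.2 (hne ξ hξ)
    have h2 : ‖ξ‖ < 1 := by simpa using hξ
    have h3 : ξ.re * ξ.re + ξ.im * ξ.im < 1 := by
      rw [← Complex.normSq_apply, Complex.normSq_eq_norm_sq]
      nlinarith [norm_nonneg ξ]
    rw [Complex.div_re, ← add_div]
    refine div_pos ?_ h1
    simp only [Complex.add_re, Complex.one_re, Complex.sub_re, Complex.add_im, Complex.one_im,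
      Complex.sub_im]
    nlinarith
  -- The pullback of `F dζ` by the Cayley map of the unit disk, where primitives are available;
  -- `2/(1 - ξ)²` is the derivative of that map.
  have hd : DifferentiableOn ℂ (fun ξ => F ((1 + ξ) / (1 - ξ)) * (2 / (1 - ξ) ^ 2))
      (Metric.ball 0 1) := by
    refine DifferentiableOn.mul (hF.comp ?_ fun ξ hξ => hre ξ hξ) ?_
    · exact DifferentiableOn.div (by fun_prop) (by fun_prop) hne
    · exact DifferentiableOn.div (by fun_prop) (by fun_prop) fun ξ hξ => pow_ne_zero 2 (hne ξ hξ)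
  obtain ⟨g, hg⟩ := hd.isExactOn_ball
  refine ⟨fun ζ => g ((ζ - 1) / (ζ + 1)), fun ζ hζ => ?_⟩
  have h1 : ζ + 1 ≠ 0 := by
    intro h
    have := congrArg Complex.re h
    simp at this; linarith
  have hmem : (ζ - 1) / (ζ + 1) ∈ Metric.ball (0 : ℂ) 1 := by
    rw [mem_ball_zero_iff, norm_div, div_lt_one (norm_pos_iff.2 h1)]
    refine lt_of_pow_lt_pow_left₀ 2 (norm_nonneg _) ?_
    rw [← Complex.normSq_eq_norm_sq, ← Complex.normSq_eq_norm_sq, Complex.normSq_apply,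
      Complex.normSq_apply]
    simp only [Complex.add_re, Complex.one_re, Complex.sub_re, Complex.add_im, Complex.one_im,
      Complex.sub_im]
    nlinarith
  have h2 : (1 + (ζ - 1) / (ζ + 1)) / (1 - (ζ - 1) / (ζ + 1)) = ζ := by
    have h3 : 1 - (ζ - 1) / (ζ + 1) = 2 / (ζ + 1) := by field_simp; ring
    rw [h3]; field_simp; ring
  have h3 : HasDerivAt (fun ζ : ℂ => (ζ - 1) / (ζ + 1)) (2 / (ζ + 1) ^ 2) ζ := by
    have := ((hasDerivAt_id ζ).sub_const 1).div ((hasDerivAt_id ζ).add_const 1) h1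
    refine this.congr_deriv ?_
    simp only [id]; ring
  have h4 := (hg _ hmem).comp ζ h3
  refine h4.congr_deriv ?_
  beta_reduce
  rw [h2]
  have h5 : 1 - (ζ - 1) / (ζ + 1) = 2 / (ζ + 1) := by field_simp; ring
  rw [h5]; field_simp

/-- Nonvanishing holomorphic functions on the right half-plane have logarithms. -/
theorem exists_log_rightHalfPlane {z : ℂ → ℂ} (hz : DifferentiableOn ℂ z {ζ : ℂ | 0 < ζ.re})
    (hz0 : ∀ ζ : ℂ, 0 < ζ.re → z ζ ≠ 0) :
    ∃ w : ℂ → ℂ, ∀ ζ : ℂ, 0 < ζ.re → DifferentiableAt ℂ w ζ ∧ Complex.exp (-w ζ) = z ζ := by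
  have hd : DifferentiableOn ℂ (fun ζ => deriv z ζ / z ζ) {ζ : ℂ | 0 < ζ.re} :=
    (hz.deriv isOpen_rightHalfPlane).div hz hz0
  obtain ⟨G, hG⟩ := exists_primitive_rightHalfPlane hd
  have hzd : ∀ ζ : ℂ, 0 < ζ.re → HasDerivAt z (deriv z ζ) ζ := fun ζ hζ =>
    (hz.differentiableAt (isOpen_rightHalfPlane.mem_nhds hζ)).hasDerivAt
  have hQ : ∀ ζ : ℂ, 0 < ζ.re → HasDerivAt (fun ζ => z ζ * Complex.exp (-G ζ)) 0 ζ := by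
    intro ζ hζ
    have h := (hzd ζ hζ).mul (hG ζ hζ).neg.cexp
    refine h.congr_deriv ?_
    have := hz0 ζ hζ
    field_simp; ring
  have hconst : ∀ ζ : ℂ, 0 < ζ.re → z ζ * Complex.exp (-G ζ) = z 1 * Complex.exp (-G 1) := by
    intro ζ hζ
    exact isOpen_rightHalfPlane.is_const_of_deriv_eq_zero convex_rightHalfPlane.isPreconnected
      (fun x hx => (hQ x hx).differentiableAt.differentiableWithinAt)
      (fun x hx => (hQ x hx).deriv) hζ (by simp)
  have hne : z 1 * Complex.exp (-G 1) ≠ 0 := mul_ne_zero (hz0 1 (by simp)) (Complex.exp_ne_zero _)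
  -- `G` is a primitive of `z'/z`, so `z exp (-G)` is a constant whose logarithm corrects `G`.
  refine ⟨fun ζ => -(G ζ + Complex.log (z 1 * Complex.exp (-G 1))), fun ζ hζ => ⟨?_, ?_⟩⟩
  · exact ((hG ζ hζ).differentiableAt.add_const _).neg
  · rw [neg_neg, Complex.exp_add, Complex.exp_log hne, ← hconst ζ hζ, Complex.exp_neg]
    have := Complex.exp_ne_zero (G ζ)
    field_simp

/-- The part of the right half-plane outside a disk is covered by three convex sets. -/
theorem exists_bound_of_forall_convex {R : ℝ} (hR : 0 < R) {f : ℂ → ℝ}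
    (h : ∀ S : Set ℂ, IsOpen S → Convex ℝ S → (∀ ζ ∈ S, 0 < ζ.re ∧ R < ‖ζ‖) →
      ∃ K, ∀ ζ ∈ S, f ζ ≤ K) :
    ∃ K, ∀ ζ : ℂ, 0 < ζ.re → 2 * R < ‖ζ‖ → f ζ ≤ K := by
  obtain ⟨K₁, h₁⟩ := h {ζ | R < ζ.re} (isOpen_lt continuous_const Complex.continuous_re)
    (convex_halfSpace_re_gt R) fun ζ hζ => by
      have hζ' : R < ζ.re := hζ
      exact ⟨by linarith, hζ'.trans_le ((le_abs_self _).trans (Complex.abs_re_le_norm ζ))⟩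
  obtain ⟨K₂, h₂⟩ := h ({ζ | 0 < ζ.re} ∩ {ζ | R < ζ.im})
    (isOpen_rightHalfPlane.inter (isOpen_lt continuous_const Complex.continuous_im))
    (convex_rightHalfPlane.inter (convex_halfSpace_im_gt R)) fun ζ hζ => by
      have hζ' : R < ζ.im := hζ.2
      exact ⟨hζ.1, hζ'.trans_le ((le_abs_self _).trans (Complex.abs_im_le_norm ζ))⟩
  obtain ⟨K₃, h₃⟩ := h ({ζ | 0 < ζ.re} ∩ {ζ | ζ.im < -R})
    (isOpen_rightHalfPlane.inter (isOpen_lt Complex.continuous_im continuous_const))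
    (convex_rightHalfPlane.inter (convex_halfSpace_im_lt (-R))) fun ζ hζ => by
      have hζ' : ζ.im < -R := hζ.2
      exact ⟨hζ.1, (by linarith : R < -ζ.im).trans_le
        ((neg_le_abs _).trans (Complex.abs_im_le_norm ζ))⟩
  refine ⟨max K₁ (max K₂ K₃), fun ζ hζ hn => ?_⟩
  by_cases h1 : R < ζ.re
  · exact (h₁ ζ h1).trans (le_max_left _ _)
  by_cases h2 : R < ζ.im
  · exact (h₂ ζ ⟨hζ, h2⟩).trans ((le_max_left _ _).trans (le_max_right _ _))
  by_cases h3 : ζ.im < -R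
  · exact (h₃ ζ ⟨hζ, h3⟩).trans ((le_max_right _ _).trans (le_max_right _ _))
  -- A point missed by the three sets has `Re ζ ≤ R` and `|Im ζ| ≤ R`, hence norm at most `2R`; this
  -- is the source of the factor `2`.
  exfalso
  have h4 := Complex.norm_le_abs_re_add_abs_im ζ
  rw [abs_of_pos hζ] at h4
  have h5 : |ζ.im| ≤ R := abs_le.2 ⟨by linarith, by linarith⟩
  linarith

end HalfPlane

/-! ### The cylinder coordinate `w` as a function of the natural coordinate `ζ`. -/

section DevelopingMap

/-- `w` is a coordinate on the right half-plane, tending to infinity to the right, related to the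
natural coordinate `ζ` by `exp (m w) / m + A w = c ζ + d`. -/
structure IsDeveloping (m : ℝ) (A c d : ℂ) (w : ℂ → ℂ) : Prop where
  differentiableAt : ∀ ζ : ℂ, 0 < ζ.re → DifferentiableAt ℂ w ζ
  deriv_eq : ∀ ζ : ℂ, 0 < ζ.re → (Complex.exp (m * w ζ) + A) * deriv w ζ = c
  eqn : ∀ ζ : ℂ, 0 < ζ.re → Complex.exp (m * w ζ) / m + A * w ζ = c * ζ + d
  tendsto : ∀ S : ℝ, ∃ R : ℝ, ∀ ζ : ℂ, 0 < ζ.re → R < ‖ζ‖ → S ≤ (w ζ).re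

/-- A holomorphic function on the half-plane with constant nonzero cube has derivative zero, so
`(exp (m w) + A) w'` is a constant `c`. Integrating once more gives the relation with `c ζ + d`. -/
theorem exists_isDeveloping {m : ℝ} {A k : ℂ} (hm : 0 < m) (hk : k ≠ 0) {w : ℂ → ℂ}
    (hw : ∀ ζ : ℂ, 0 < ζ.re → DifferentiableAt ℂ w ζ)
    (heq : ∀ ζ : ℂ, 0 < ζ.re → ((Complex.exp (m * w ζ) + A) * deriv w ζ) ^ 3 = k)
    (htend : ∀ S : ℝ, ∃ R : ℝ, ∀ ζ : ℂ, 0 < ζ.re → R < ‖ζ‖ → S ≤ (w ζ).re) :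
    ∃ c d : ℂ, c ^ 3 = k ∧ IsDeveloping m A c d w := by
  have hwo : DifferentiableOn ℂ w {ζ : ℂ | 0 < ζ.re} := fun ζ hζ =>
    (hw ζ hζ).differentiableWithinAt
  set G : ℂ → ℂ := fun ζ => (Complex.exp (m * w ζ) + A) * deriv w ζ with hG
  have hGd : ∀ ζ : ℂ, 0 < ζ.re → DifferentiableAt ℂ G ζ := by
    intro ζ hζ
    have h1 := hw ζ hζ
    have h2 : DifferentiableAt ℂ (deriv w) ζ :=
      (hwo.deriv isOpen_rightHalfPlane).differentiableAt (isOpen_rightHalfPlane.mem_nhds hζ)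
    exact (((differentiableAt_const _).mul h1).cexp.add_const _).mul h2
  have hG0 : ∀ ζ : ℂ, 0 < ζ.re → deriv G ζ = 0 := by
    intro ζ hζ
    have h1 : HasDerivAt (fun ζ => G ζ ^ 3) (3 * G ζ ^ 2 * deriv G ζ) ζ := by
      exact ((hGd ζ hζ).hasDerivAt.pow 3).congr_deriv (by simp)
    have h2 : (fun ζ => G ζ ^ 3) =ᶠ[𝓝 ζ] fun _ => k := by
      filter_upwards [isOpen_rightHalfPlane.mem_nhds hζ] with x hx using heq x hx
    have h3 := h1.unique ((hasDerivAt_const ζ k).congr_of_eventuallyEq h2)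
    have h4 : G ζ ≠ 0 := by
      intro h; have := heq ζ hζ
      rw [show (Complex.exp (m * w ζ) + A) * deriv w ζ = G ζ from rfl, h] at this
      exact hk (by simpa using this.symm)
    simpa [h4] using h3
  have hGc : ∀ ζ : ℂ, 0 < ζ.re → G ζ = G 1 := fun ζ hζ =>
    isOpen_rightHalfPlane.is_const_of_deriv_eq_zero convex_rightHalfPlane.isPreconnected
      (fun x hx => (hGd x hx).differentiableWithinAt) (fun x hx => hG0 x hx) hζ (by simp)
  have hQ : ∀ ζ : ℂ, 0 < ζ.re →
      HasDerivAt (fun ζ => Complex.exp (m * w ζ) / m + A * w ζ - G 1 * ζ) 0 ζ := by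
    intro ζ hζ
    have h1 := (hw ζ hζ).hasDerivAt
    have h2 := (((h1.const_mul (m : ℂ)).cexp.div_const (m : ℂ)).add (h1.const_mul A)).sub
      ((hasDerivAt_id ζ).const_mul (G 1))
    refine h2.congr_deriv ?_
    have hm' : (m : ℂ) ≠ 0 := by exact_mod_cast hm.ne'
    rw [← hGc ζ hζ]
    simp only [hG]
    field_simp; ring
  refine ⟨G 1, Complex.exp (m * w 1) / m + A * w 1 - G 1 * 1, heq 1 (by simp), hw, hGc, ?_, htend⟩
  intro ζ hζ
  have h := isOpen_rightHalfPlane.is_const_of_deriv_eq_zero convex_rightHalfPlane.isPreconnected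
      (fun x hx => (hQ x hx).differentiableAt.differentiableWithinAt)
      (fun x hx => (hQ x hx).deriv) hζ (by simp : (1 : ℂ) ∈ {ζ : ℂ | 0 < ζ.re})
  linear_combination h

variable {m : ℝ} {A c d : ℂ} {w : ℂ → ℂ}

theorem IsDeveloping.exists_norm_deriv_le (h : IsDeveloping m A c d w) (hm : 0 < m) :
    ∃ S : ℝ, ∀ ζ : ℂ, 0 < ζ.re → S ≤ (w ζ).re →
      ‖deriv w ζ‖ ≤ 2 * ‖c‖ * Real.exp (-(m * (w ζ).re)) := by
  have hexp : ∀ᶠ s : ℝ in atTop, 2 * ‖A‖ ≤ Real.exp (m * s) :=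
    (Real.tendsto_exp_atTop.comp (tendsto_id.const_mul_atTop hm)).eventually_ge_atTop _
  obtain ⟨S, hS⟩ := eventually_atTop.1 hexp
  refine ⟨S, fun ζ hζ hs => ?_⟩
  have h1 := hS _ hs
  have h2 : Real.exp (m * (w ζ).re) / 2 ≤ ‖Complex.exp (m * w ζ) + A‖ := by
    have := norm_sub_le_norm_add (Complex.exp (m * w ζ)) A
    rw [Complex.norm_exp, Complex.re_ofReal_mul] at this
    linarith
  have h3 := congrArg norm (h.deriv_eq ζ hζ)
  rw [norm_mul] at h3
  have h4 := mul_le_mul_of_nonneg_right h2 (norm_nonneg (deriv w ζ))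
  have h5 := Real.exp_pos (m * (w ζ).re)
  rw [Real.exp_neg, ← div_eq_mul_inv, le_div_iff₀ h5]
  linarith

/-- The derivative of `w` tends to zero at infinity, so `w` grows more slowly than any `ε |ζ|`, by
the mean value inequality on convex pieces. This makes `A w` negligible against `c ζ`. -/
theorem IsDeveloping.exists_norm_le (h : IsDeveloping m A c d w) (hm : 0 < m) {ε : ℝ} (hε : 0 < ε) :
    ∃ R K : ℝ, 0 < R ∧ ∀ ζ : ℂ, 0 < ζ.re → R < ‖ζ‖ → ‖w ζ‖ ≤ ε * ‖ζ‖ + K := by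
  obtain ⟨S, hS⟩ := h.exists_norm_deriv_le hm
  have hlim : Tendsto (fun s : ℝ => 2 * ‖c‖ * Real.exp (-(m * s))) atTop (𝓝 (2 * ‖c‖ * 0)) :=
    (Real.tendsto_exp_neg_atTop_nhds_zero.comp (tendsto_id.const_mul_atTop hm)).const_mul _
  rw [mul_zero] at hlim
  obtain ⟨S', hS'⟩ := eventually_atTop.1 (hlim.eventually (gt_mem_nhds hε))
  obtain ⟨R, hR⟩ := h.tendsto (max S S')
  obtain ⟨K, hK⟩ := exists_bound_of_forall_convex (R := max R 1) (by positivity)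
    (f := fun ζ => ‖w ζ‖ - ε * ‖ζ‖) (by
      intro T _ hTc hT
      rcases T.eq_empty_or_nonempty with rfl | ⟨ζ₀, hζ₀⟩
      · exact ⟨0, by simp⟩
      refine ⟨‖w ζ₀‖ + ε * ‖ζ₀‖, fun ζ hζ => ?_⟩
      have h1 := hTc.norm_image_sub_le_of_norm_deriv_le (f := w) (C := ε)
        (fun x hx => h.differentiableAt x (hT x hx).1) (fun x hx => by
          have h2 := hR x (hT x hx).1 ((le_max_left _ _).trans_lt (hT x hx).2)
          exact (hS x (hT x hx).1 ((le_max_left _ _).trans h2)).trans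
            (hS' _ ((le_max_right _ _).trans h2)).le) hζ₀ hζ
      have h2 := norm_sub_norm_le (w ζ) (w ζ₀)
      have h3 := mul_le_mul_of_nonneg_left (norm_sub_le ζ ζ₀) hε.le
      linarith)
  exact ⟨2 * max R 1, K, by positivity, fun ζ hζ hn => by linarith [hK ζ hζ hn]⟩

theorem abs_im_log_le_pi (x : ℂ) : |(Complex.log x).im| ≤ Real.pi := by
  rw [Complex.log_im]; exact Complex.abs_arg_le_pi x

/-- The angle of the coordinate `w` is bounded on a natural half-plane. -/
theorem IsDeveloping.exists_abs_im_le (h : IsDeveloping m A c d w) (hm : 0 < m) (hc : c ≠ 0) :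
    ∃ R K : ℝ, ∀ ζ : ℂ, 0 < ζ.re → R < ‖ζ‖ → |(w ζ).im| ≤ K := by
  have hc' : 0 < ‖c‖ := norm_pos_iff.2 hc
  have hm' : (m : ℂ) ≠ 0 := by exact_mod_cast hm.ne'
  -- With this `ε` and the radius `R'` below, `|d - A w|` stays under half of `|c ζ|`. Hence `exp (m
  -- w)/(m c ζ)` lies within distance `1` of `1` and has a principal logarithm.
  set ε := ‖c‖ / (4 * (‖A‖ + 1)) with hε
  have hε0 : 0 < ε := by positivity
  have hAε : ‖A‖ * ε ≤ ‖c‖ / 4 := by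
    rw [hε, mul_div_assoc', div_le_div_iff₀ (by positivity) (by norm_num)]
    nlinarith [norm_nonneg A]
  obtain ⟨R, K, hR, hK⟩ := h.exists_norm_le hm hε0
  set R' := max R (4 * (‖d‖ + ‖A‖ * |K|) / ‖c‖ + 1) with hR'
  have hR'0 : 0 < R' := lt_max_of_lt_left hR
  have hrest : ∀ ζ : ℂ, 0 < ζ.re → R' < ‖ζ‖ → ‖d - A * w ζ‖ < ‖c * ζ‖ := by
    intro ζ hζ hn
    have h1 := hK ζ hζ ((le_max_left _ _).trans_lt hn)
    have h2 : 4 * (‖d‖ + ‖A‖ * |K|) / ‖c‖ < ‖ζ‖ := by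
      have := (le_max_right R _).trans_lt hn
      linarith
    rw [div_lt_iff₀ hc'] at h2
    have h3 := norm_sub_le d (A * w ζ)
    rw [norm_mul] at h3
    have h4 : ‖A‖ * ‖w ζ‖ ≤ ‖A‖ * ε * ‖ζ‖ + ‖A‖ * |K| := by
      have := mul_le_mul_of_nonneg_left (h1.trans (add_le_add_right (le_abs_self K) _))
        (norm_nonneg A)
      linarith
    have h5 := mul_le_mul_of_nonneg_right hAε (norm_nonneg ζ)
    have h6 : 0 < ‖c‖ * ‖ζ‖ := mul_pos hc' (hR'0.trans hn)
    rw [norm_mul]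
    linarith
  have hslit : ∀ ζ : ℂ, 0 < ζ.re → R' < ‖ζ‖ →
      Complex.exp (m * w ζ) / (m * c * ζ) ∈ Complex.slitPlane := by
    intro ζ hζ hn
    have h1 := hrest ζ hζ hn
    have hζ0 : ζ ≠ 0 := by rintro rfl; simp at hζ
    have h2 : Complex.exp (m * w ζ) / (m * c * ζ) = 1 + (d - A * w ζ) / (c * ζ) := by
      have := h.eqn ζ hζ
      field_simp at this ⊢
      linear_combination this
    rw [h2]
    refine Complex.mem_slitPlane_of_norm_lt_one ?_
    rw [norm_div, div_lt_one (norm_pos_iff.2 (mul_ne_zero hc hζ0))]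
    exact h1
  obtain ⟨K', hK'⟩ := exists_bound_of_forall_convex hR'0 (f := fun ζ => |(w ζ).im|) (by
    intro T hTo hTc hT
    rcases T.eq_empty_or_nonempty with rfl | ⟨ζ₀, hζ₀⟩
    · exact ⟨0, by simp⟩
    -- The derivative of `L` vanishes, so on a convex piece `m Im w` is a constant plus two
    -- principal arguments, each at most `π` in absolute value.
    set L : ℂ → ℂ := fun ζ => m * w ζ - Complex.log ζ -
      Complex.log (Complex.exp (m * w ζ) / (m * c * ζ)) with hL
    have hL0 : ∀ ζ ∈ T, HasDerivAt L 0 ζ := by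
      intro ζ hζ
      obtain ⟨h1, h2⟩ := hT ζ hζ
      have hζ0 : ζ ≠ 0 := by rintro rfl; simp at h1
      have hw := (h.differentiableAt ζ h1).hasDerivAt.const_mul (m : ℂ)
      have hlog := Complex.hasDerivAt_log (Or.inl h1 : ζ ∈ Complex.slitPlane)
      have hq := (hw.cexp.div ((hasDerivAt_id ζ).const_mul ((m : ℂ) * c))
        (mul_ne_zero (mul_ne_zero hm' hc) hζ0)).clog (hslit ζ h1 h2)
      refine ((hw.sub hlog).sub hq).congr_deriv ?_
      have hexp := Complex.exp_ne_zero (m * w ζ)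
      simp only [id, Pi.div_apply]
      field_simp
      ring
    have hLc : ∀ ζ ∈ T, L ζ = L ζ₀ := fun ζ hζ =>
      hTo.is_const_of_deriv_eq_zero hTc.isPreconnected
        (fun x hx => (hL0 x hx).differentiableAt.differentiableWithinAt)
        (fun x hx => (hL0 x hx).deriv) hζ hζ₀
    refine ⟨(|(L ζ₀).im| + Real.pi + Real.pi) / m, fun ζ hζ => ?_⟩
    have h1 := congrArg Complex.im (hLc ζ hζ)
    simp only [hL, Complex.sub_im, Complex.im_ofReal_mul] at h1
    have h2 : m * (w ζ).im = (L ζ₀).im + (Complex.log ζ).im +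
        (Complex.log (Complex.exp (m * w ζ) / (m * c * ζ))).im := by
      simp only [hL, Complex.sub_im, Complex.im_ofReal_mul]; linarith
    rw [le_div_iff₀ hm, ← abs_of_pos hm, ← abs_mul, mul_comm, h2]
    refine (abs_add_le _ _).trans (add_le_add ((abs_add_le _ _).trans ?_) (abs_im_log_le_pi _))
    exact add_le_add le_rfl (abs_im_log_le_pi _))
  exact ⟨2 * R', K', hK'⟩

/-- After rotation by `exp (-imθ)` the first term is the positive number `exp (m s)/m`, and the
second splits into the real and imaginary parts of `s A exp (-imθ)`. -/
theorem norm_exp_div_add_sq (hm : 0 < m) (A w : ℂ) :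
    ‖Complex.exp (m * w) / m + A * w.re‖ ^ 2 =
      (Real.exp (m * w.re) / m + w.re * coneAngle m A w.im) ^ 2 +
        w.re ^ 2 * coneAngle m (⟨A.im, -A.re⟩ : ℂ) w.im ^ 2 := by
  have hm' : (m : ℂ) ≠ 0 := by exact_mod_cast hm.ne'
  have e1 : Complex.exp (m * w) / m + A * w.re =
      (Complex.exp (m * w) + ((m * w.re : ℝ) : ℂ) * A) / m := by
    push_cast; field_simp
  have e2 : coneAngle m (((m * w.re : ℝ) : ℂ) * A) w.im = m * w.re * coneAngle m A w.im := by
    simp only [coneAngle, Complex.re_ofReal_mul, Complex.im_ofReal_mul]; ring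
  rw [e1, norm_div, div_pow, normSq_exp_add, e2, norm_mul, mul_pow, ← coneAngle_sq_add m A w.im,
    Complex.norm_real, Complex.norm_real, Real.norm_eq_abs, Real.norm_eq_abs, sq_abs, sq_abs]
  field_simp
  ring

/-- On a natural half-plane, the exponent of the decay is `2 √3 |ζ| + log |ζ| / 2` up to a bounded
error. -/
theorem IsDeveloping.exists_le_conePhase (h : IsDeveloping m A c d w) (hm : 0 < m) {κ : ℝ}
    (hκ : 0 < κ) (hc : c ≠ 0) :
    ∃ R K : ℝ, ∀ ζ : ℂ, 0 < ζ.re → R < ‖ζ‖ →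
      κ * ‖c‖ * ‖ζ‖ + Real.log ‖ζ‖ / 2 - K ≤ conePhase κ m A (w ζ) := by
  have hc' : 0 < ‖c‖ := norm_pos_iff.2 hc
  obtain ⟨R₀, Θ, hΘ⟩ := h.exists_abs_im_le hm hc
  set L := |A.re| + |A.im| with hL
  have hL0 : 0 ≤ L := by positivity
  -- Additive errors: `1` from `hnorm` below, the constant `d`, and the angular part `A iθ` of `A
  -- w`, bounded because `θ` is.
  set D := 1 + ‖d‖ + ‖A‖ * |Θ| with hD
  have hD0 : 0 < D := by positivity
  set Q := m * (L + ‖A‖ ^ 2 + D) with hQ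
  have hlim : Tendsto (fun s : ℝ => Real.exp (m * s) / s ^ (2 : ℝ)) atTop atTop :=
    tendsto_exp_mul_div_rpow_atTop 2 m hm
  obtain ⟨S, hS⟩ := eventually_atTop.1 ((eventually_ge_atTop (1 : ℝ)).and
    (hlim.eventually_ge_atTop Q))
  obtain ⟨R₁, hR₁⟩ := h.tendsto S
  refine ⟨max (max R₀ R₁) 0, κ * D + Real.log (3 / (m * ‖c‖)) / 2, fun ζ hζ hn => ?_⟩
  have hn0 : 0 < ‖ζ‖ := (le_max_right _ _).trans_lt hn
  have hnR₀ : R₀ < ‖ζ‖ := ((le_max_left _ _).trans (le_max_left _ _)).trans_lt hn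
  have hnR₁ : R₁ < ‖ζ‖ := ((le_max_right _ _).trans (le_max_left _ _)).trans_lt hn
  obtain ⟨hs1, hsQ⟩ := hS _ (hR₁ ζ hζ hnR₁)
  have him := hΘ ζ hζ hnR₀
  have heq := h.eqn ζ hζ
  have hnsq := norm_exp_div_add_sq hm A (w ζ)
  have hτ := abs_le.1 (abs_coneAngle_le m A (w ζ).im)
  have hττ := coneAngle_sq_add m A (w ζ).im
  rw [← hL] at hτ
  set s := (w ζ).re with hs
  set θ := (w ζ).im with hθ
  have hwst : w ζ = s + θ * Complex.I := (Complex.re_add_im _).symm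
  have hcζ : ‖c‖ * ‖ζ‖ ≤ ‖d‖ + ‖Complex.exp (m * w ζ) / m + A * s‖ + ‖A‖ * |Θ| := by
    have e1 : c * ζ = (Complex.exp (m * w ζ) / m + A * s) + A * (θ * Complex.I) - d := by
      have : A * w ζ = A * s + A * (θ * Complex.I) := by rw [← mul_add, ← hwst]
      linear_combination -heq + this
    rw [← norm_mul, e1]
    have h1 := norm_sub_le ((Complex.exp (m * w ζ) / m + A * s) + A * (θ * Complex.I)) d
    have h2 := norm_add_le (Complex.exp (m * w ζ) / m + A * s) (A * (θ * Complex.I))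
    have h3 : ‖A * (θ * Complex.I)‖ ≤ ‖A‖ * |Θ| := by
      rw [norm_mul, norm_mul, Complex.norm_I, mul_one, Complex.norm_real, Real.norm_eq_abs]
      exact mul_le_mul_of_nonneg_left (him.trans (le_abs_self _)) (norm_nonneg _)
    linarith
  rw [Real.rpow_two, le_div_iff₀ (by positivity)] at hsQ
  have hEm : (L + ‖A‖ ^ 2 + D) * s ^ 2 ≤ Real.exp (m * s) / m := by
    rw [le_div_iff₀ hm]
    rw [hQ] at hsQ; linarith
  simp only [conePhase]
  rw [← hs, ← hθ]
  generalize coneAngle m A θ = τ at *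
  generalize coneAngle m (⟨A.im, -A.re⟩ : ℂ) θ = τ' at *
  set σ := Real.exp (m * s) / m with hσ
  have hs2 : 1 ≤ s ^ 2 := one_le_pow₀ hs1
  have hss : s ≤ s ^ 2 := le_self_pow₀ hs1 two_ne_zero
  have hLs : L * s ≤ L * s ^ 2 := mul_le_mul_of_nonneg_left hss hL0
  have hDs : D ≤ D * s ^ 2 := le_mul_of_one_le_right hD0.le hs2
  have hA2 : 0 ≤ ‖A‖ ^ 2 * s ^ 2 := by positivity
  have hs0 : 0 ≤ s := by linarith
  have hsτ1 : -(L * s) ≤ s * τ := by linarith [mul_le_mul_of_nonneg_left hτ.1 hs0]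
  have hsτ2 : s * τ ≤ L * s := by linarith [mul_le_mul_of_nonneg_left hτ.2 hs0]
  have hX0 : ‖A‖ ^ 2 * s ^ 2 ≤ σ + s * τ := by linarith
  -- The transverse part has square at most `‖A‖² s²`, which is at most the radial part. It is
  -- therefore absorbed by adding `1` to the radial part before squaring.
  have hnorm : ‖Complex.exp (m * w ζ) / m + A * s‖ ≤ σ + s * τ + 1 := by
    refine le_of_sq_le_sq ?_ (by linarith)
    rw [hnsq]
    have : s ^ 2 * τ' ^ 2 ≤ ‖A‖ ^ 2 * s ^ 2 := by
      rw [mul_comm]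
      exact mul_le_mul_of_nonneg_right (by linarith [sq_nonneg τ]) (sq_nonneg s)
    have : (σ + s * τ + 1) ^ 2 = (σ + s * τ) ^ 2 + 2 * (σ + s * τ) + 1 := by ring
    linarith
  have hmain : ‖c‖ * ‖ζ‖ ≤ σ + s * τ + D := by rw [hD]; linarith
  have hσ0 : 0 < σ := by positivity
  have hlog : Real.log ‖ζ‖ ≤ Real.log (3 / (m * ‖c‖)) + m * s := by
    have h1 : ‖ζ‖ ≤ 3 / (m * ‖c‖) * Real.exp (m * s) := by
      have h2 : ‖c‖ * ‖ζ‖ ≤ 3 * σ := by linarith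
      rw [hσ] at h2
      rw [div_mul_eq_mul_div, le_div_iff₀ (by positivity)]
      rw [mul_div_assoc', le_div_iff₀ hm] at h2
      linarith
    have h2 := Real.log_le_log hn0 h1
    rwa [Real.log_mul (by positivity) (Real.exp_pos _).ne', Real.log_exp] at h2
  have := mul_le_mul_of_nonneg_left hmain hκ.le
  linarith

end DevelopingMap

/-! ### Poles of order three. -/

section ThirdOrder

theorem dist_frontier_rotatedHalfPlane_le {r : ℂ} (hr : r ≠ 0) {w : ℂ} (hw : 0 < w.re) :
    Metric.infDist (-r * w) (frontier (rotatedHalfPlane r)) ≤ ‖r‖ * w.re := by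
  have hfr : frontier (rotatedHalfPlane r) = (fun w : ℂ => -r * w) '' {w : ℂ | w.re = 0} := by
    have h := (Homeomorph.mulLeft₀ (-r) (neg_ne_zero.2 hr)).image_frontier {w : ℂ | 0 < w.re}
    rw [Complex.frontier_setOfPred_lt_re] at h
    exact h.symm
  have hmem : -r * (w.im * Complex.I) ∈ frontier (rotatedHalfPlane r) := by
    rw [hfr]; exact ⟨w.im * Complex.I, by simp, rfl⟩
  refine (Metric.infDist_le_dist_of_mem hmem).trans ?_
  rw [dist_eq_norm, ← mul_sub, norm_mul, norm_neg]
  have : w - w.im * Complex.I = w.re := by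
    nth_rewrite 1 [← Complex.re_add_im w]; ring
  rw [this, Complex.norm_real, Real.norm_of_nonneg hw.le]

variable {X : Type*} [TopologicalSpace X] [T2Space X] [CompactSpace X] [ChartedSpace ℂ X]
  [IsManifold 𝓘(ℂ) ω X] {P : Set X} {g : ConformalMetric X P} {b : CubicDifferential X P} {p : X}
  {e : OpenPartialHomeomorph X ℂ} {a : ℝ}

/-- With `ζ = -r w` the model is `z = exp (-w)`, the flat density is the constant `|r|²`, and the
distance to the boundary is at most `|r| Re w`. Decay on the flat cylinder is thus the claim. -/
theorem exists_decay_thirdOrder (hP : P.Finite) (hg : IsWangMetric g b) (hp : p ∈ P) {R : ℂ}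
    (hR : R ≠ 0) (ha : 1 < a) (hc : IsCoordinate P p e a) (hb : HasNormalFormThree b R e a) {r : ℂ}
    (hr : r ^ 3 = R / 2) :
    ∃ C : ℝ, ∀ ζ ∈ rotatedHalfPlane r,
      0 ≤ logRatio g b (thirdOrderModel e r ζ) ∧
      logRatio g b (thirdOrderModel e r ζ) ≤
        C * Real.exp (-2 * Real.sqrt 3 * Metric.infDist ζ (frontier (rotatedHalfPlane r))) ∧
      ‖dWirtinger (fun w => logRatio g b (thirdOrderModel e r w)) ζ‖ ≤
        C * Real.exp (-2 * Real.sqrt 3 * Metric.infDist ζ (frontier (rotatedHalfPlane r))) := by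
  have hr0 : r ≠ 0 := by
    rintro rfl
    apply hR
    have : R / 2 = 0 := by rw [← hr]; simp
    simpa using this
  have hrn : 0 < ‖r‖ := norm_pos_iff.2 hr0
  have hbne : ∀ z : ℂ, 0 < ‖z‖ → ‖z‖ < a → pullCubic b.toFun e.symm z ≠ 0 := fun z h1 h2 => by
    rw [hb z h1 h2]; exact div_ne_zero hR (pow_ne_zero 3 (norm_pos_iff.1 h1))
  have hord : b.ord p ≤ ((-3 : ℤ) : WithTop ℤ) :=
    ord_le_of_pole hc le_rfl (G := fun _ => R) analyticAt_const hR hb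
  -- Because `a > 1` the coordinate covers the strip `Re w ≥ -δ`. This margin allows gradient
  -- estimates on squares of half-side `δ` up to `Re w = 0`.
  set δ := Real.log a / 2 with hδ
  have hloga : 0 < Real.log a := Real.log_pos ha
  have hδ0 : 0 < δ := by positivity
  have hexp : ∀ w : ℂ, -δ ≤ w.re → Real.exp (-w.re) < a := by
    intro w hw
    rw [← Real.lt_log_iff_exp_lt (by linarith)]
    linarith
  have hsa : Real.exp (-(-δ)) < a := by simpa using hexp (-δ : ℝ) (by simp)
  obtain ⟨M, hM⟩ := exists_cylinderRatio_le hP.isClosed hg hp hc hord hsa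
    fun z h1 h2 => hbne z h1 (h2.trans_lt hsa)
  have hz : ∀ w : ℂ, -δ ≤ w.re → 0 < ‖Complex.exp (-w)‖ ∧ ‖Complex.exp (-w)‖ < a := by
    intro w hw
    rw [norm_exp_neg]; exact ⟨Real.exp_pos _, hexp w hw⟩
  have hu : ∀ w : ℂ, -δ ≤ w.re →
      IsWangSolutionAt (fun _ => ‖r‖ ^ 2) (cylinderRatio g b e) w := by
    intro w hw
    obtain ⟨h1, h2⟩ := hz w hw
    refine cylinderRatio_isWangSolutionAt hP hg hc (hexp w hw) (hbne _ h1 h2) ?_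
    have h3 : Complex.exp (-w) ≠ 0 := Complex.exp_ne_zero _
    have h4 : ‖R‖ / 2 = ‖r‖ ^ 3 := by
      rw [← norm_pow, hr, norm_div]; simp
    rw [hb _ h1 h2, mul_div_cancel₀ _ (pow_ne_zero 3 h3), h4, ← Real.rpow_natCast ‖r‖ 3,
      ← Real.rpow_mul hrn.le, ← Real.rpow_natCast ‖r‖ 2]
    norm_num
  obtain ⟨C, hC⟩ := exists_decay_of_const hrn hδ0 hu (fun w => cylinderRatio_periodic w) hM
  refine ⟨|C| + |C| / ‖r‖, ?_⟩
  rintro _ ⟨w, hw, rfl⟩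
  have hw' : 0 < w.re := hw
  have hmodel : ∀ ζ : ℂ, logRatio g b (thirdOrderModel e r ζ) =
      cylinderRatio g b e (-(r⁻¹) * ζ) := by
    intro ζ
    rw [thirdOrderModel, cylinderRatio]
    congr 3
    field_simp
  have hcanc : -(r⁻¹) * (-r * w) = w := by field_simp
  obtain ⟨h1, h2⟩ := hC w (by linarith)
  have hdist : Real.exp (-(2 * Real.sqrt 3 * (‖r‖ * w.re))) ≤
      Real.exp (-2 * Real.sqrt 3 * Metric.infDist (-r * w) (frontier (rotatedHalfPlane r))) := by
    have h3 := dist_frontier_rotatedHalfPlane_le hr0 hw'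
    have h4 := mul_le_mul_of_nonneg_left h3 (by positivity : 0 ≤ 2 * Real.sqrt 3)
    exact Real.exp_le_exp.2 (by linarith)
  have hfin : ∀ x : ℝ, 0 ≤ x → x ≤ |C| + |C| / ‖r‖ →
      x * Real.exp (-(2 * Real.sqrt 3 * (‖r‖ * w.re))) ≤ (|C| + |C| / ‖r‖) *
        Real.exp (-2 * Real.sqrt 3 * Metric.infDist (-r * w) (frontier (rotatedHalfPlane r))) :=
    fun x h0 hx => mul_le_mul hx hdist (Real.exp_pos _).le (h0.trans hx)
  have hCr : 0 ≤ |C| / ‖r‖ := by positivity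
  have hexp0 := Real.exp_pos (-(2 * Real.sqrt 3 * (‖r‖ * w.re)))
  have hCabs := mul_le_mul_of_nonneg_right (le_abs_self C) hexp0.le
  beta_reduce
  refine ⟨?_, ?_, ?_⟩
  · rw [hmodel, hcanc]; exact (hu w (by linarith)).nonneg
  · rw [hmodel, hcanc]
    exact (h1.trans hCabs).trans (hfin _ (abs_nonneg C) (by linarith))
  · have hφ : HasDerivAt (fun ζ : ℂ => -(r⁻¹) * ζ) (-(r⁻¹)) (-r * w) := by
      simpa using (hasDerivAt_id (-r * w)).const_mul (-(r⁻¹))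
    have h3 := norm_dWirtinger_comp_le (F := cylinderRatio g b e) (φ := fun ζ : ℂ => -(r⁻¹) * ζ)
      (ζ := -r * w) (.of_forall hmodel)
      (by rw [hcanc]; exact (hu w (by linarith)).contDiffAt.differentiableAt (by simp))
      hφ.differentiableAt
    rw [hφ.deriv, hcanc, norm_neg, norm_inv] at h3
    refine h3.trans (le_trans ?_ (hfin (|C| / ‖r‖) hCr (by linarith [abs_nonneg C])))
    rw [div_mul_eq_mul_div, ← div_eq_mul_inv]
    gcongr
    exact h2.trans hCabs

end ThirdOrder

/-! ### Poles of order at least four and natural half-planes. -/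

section HigherOrder

variable {X : Type*} [TopologicalSpace X] [ChartedSpace ℂ X]
  {P : Set X} {g : ConformalMetric X P} {b : CubicDifferential X P} {p : X}
  {e : OpenPartialHomeomorph X ℂ} {a : ℝ}

/-- The two normal forms of a pole of order at least four, unified in the coordinate `w` with
`z = exp (-w)`. -/
theorem exists_cone_form [IsManifold 𝓘(ℂ) ω X] {n : ℕ} (hn : 1 ≤ n) (hc : IsCoordinate P p e a)
    (hb : HasNormalForm b n e a) :
    ∃ (m : ℝ) (A : ℂ), 0 < m ∧ (A ≠ 0 → ∃ k : ℕ, m = k) ∧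
      b.ord p ≤ ((-3 : ℤ) : WithTop ℤ) ∧
      ∀ w : ℂ, Real.exp (-w.re) < a → Complex.exp (-w) ^ 3 *
        pullCubic b.toFun e.symm (Complex.exp (-w)) = (Complex.exp (m * w) + A) ^ 3 := by
  have hz : ∀ w : ℂ, Real.exp (-w.re) < a →
      0 < ‖Complex.exp (-w)‖ ∧ ‖Complex.exp (-w)‖ < a := by
    intro w hw
    rw [norm_exp_neg]; exact ⟨Real.exp_pos _, hw⟩
  by_cases h3 : 3 ∣ n
  · obtain ⟨j, rfl⟩ := h3
    have hj : 1 ≤ j := by omega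
    -- With `n = 3j` one has `l = j + 1`, and `z (z^(-l) + A/z) = z^(-j) + A = exp (j w) + A`.
    obtain ⟨A, hA⟩ := hb.2 (j + 1) (by ring)
    refine ⟨j, A, by exact_mod_cast hj, fun _ => ⟨j, rfl⟩, ?_, fun w hw => ?_⟩
    · refine ord_le_of_pole hc (k := 3 * (j + 1)) (by omega) (G := fun z => (1 + A * z ^ j) ^ 3)
        (by fun_prop) (by simp [show j ≠ 0 by omega]) fun z h1 h2 => ?_
      have hz0 : z ≠ 0 := norm_pos_iff.1 h1
      rw [hA z h1 h2, mul_comm 3, pow_mul, ← div_pow]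
      congr 1
      field_simp
      ring
    · obtain ⟨h1, h2⟩ := hz w hw
      have hz0 : Complex.exp (-w) ≠ 0 := Complex.exp_ne_zero _
      have hexp : Complex.exp (((j : ℝ) : ℂ) * w) = (Complex.exp (-w) ^ j)⁻¹ := by
        rw [← Complex.exp_nat_mul, ← Complex.exp_neg]
        congr 1
        push_cast; ring
      rw [hA _ h1 h2, ← mul_pow, hexp]
      congr 1
      field_simp
      ring
  · refine ⟨n / 3, 0, by have : (1 : ℝ) ≤ n := by exact_mod_cast hn
                         positivity, fun h => absurd rfl h, ?_, fun w hw => ?_⟩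
    · exact ord_le_of_pole hc (k := n + 3) (by omega) (G := fun _ => 1) analyticAt_const one_ne_zero
        fun z h1 h2 => hb.1 h3 z h1 h2
    · obtain ⟨h1, h2⟩ := hz w hw
      have hz0 : Complex.exp (-w) ≠ 0 := Complex.exp_ne_zero _
      have hexp : Complex.exp (((n / 3 : ℝ) : ℂ) * w) ^ 3 = (Complex.exp (-w) ^ n)⁻¹ := by
        rw [← Complex.exp_nat_mul, ← Complex.exp_nat_mul, ← Complex.exp_neg]
        congr 1
        push_cast; ring
      rw [hb.1 h3 _ h1 h2, add_zero, hexp, pow_add]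
      field_simp

/-- A natural half-plane, expressed in the coordinate `e`. -/
theorem IsNaturalHalfPlane.coord {Φ : ℂ → X} (hc : IsCoordinate P p e a)
    (hΦ : IsNaturalHalfPlane b p (puncturedDisk e a) Φ) {ζ : ℂ} (hζ : 0 ≤ ζ.re) :
    0 < ‖e (Φ ζ)‖ ∧ ‖e (Φ ζ)‖ < a ∧ e.symm (e (Φ ζ)) = Φ ζ ∧
      DifferentiableAt ℂ (fun x => e (Φ x)) ζ ∧ (Φ =ᶠ[𝓝 ζ] fun x => e.symm (e (Φ x))) ∧
      deriv (fun x => e (Φ x)) ζ ^ 3 * pullCubic b.toFun e.symm (e (Φ ζ)) = 2 := by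
  obtain ⟨z, ⟨hz1, hz2⟩, hz⟩ := hΦ.mapsTo hζ
  have hzt := hc.mem_target hz2
  have hez : e (Φ ζ) = z := by rw [← hz]; exact e.right_inv hzt
  have hsrc : Φ ζ ∈ e.source := by rw [← hz]; exact e.map_target hzt
  obtain ⟨V, hVo, hV, hVd⟩ := hΦ.holomorphic
  have hd : MDifferentiableAt 𝓘(ℂ) 𝓘(ℂ) Φ ζ := (hVd ζ (hV hζ)).mdifferentiableAt
    (hVo.mem_nhds (hV hζ))
  have hde : DifferentiableAt ℂ (fun x => e (Φ x)) ζ := mdifferentiableAt_iff_differentiableAt.1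
    ((mdifferentiableAt_coord hc.mem_atlas hsrc).comp ζ hd)
  have hev : Φ =ᶠ[𝓝 ζ] fun x => e.symm (e (Φ x)) := by
    filter_upwards [hd.continuousAt.eventually (e.open_source.mem_nhds hsrc)] with x hx
    exact (e.left_inv hx).symm
  refine ⟨by rwa [hez], by rwa [hez], e.left_inv hsrc, hde, hev, ?_⟩
  have h := pullCubic_comp b hc.mem_atlas hev hde (e.map_source hsrc)
    (by rw [← hz]; exact hc.notMem z hz1 hz2)
  rw [← h, hΦ.pull_eq ζ hζ]

theorem IsNaturalHalfPlane.exists_norm_lt {Φ : ℂ → X} (hc : IsCoordinate P p e a)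
    (hΦ : IsNaturalHalfPlane b p (puncturedDisk e a) Φ) {δ : ℝ} (hδ : 0 < δ) :
    ∃ R : ℝ, ∀ ζ : ℂ, 0 ≤ ζ.re → R < ‖ζ‖ → ‖e (Φ ζ)‖ < δ := by
  have h1 : ∀ᶠ x in 𝓝 p, ‖e x‖ < δ :=
    (e.continuousAt hc.mem_source).norm.eventually (gt_mem_nhds (by simpa [hc.map_center] using hδ))
  have h2 := hΦ.tendsto.eventually h1
  rw [eventually_inf_principal, ← comap_norm_atTop, eventually_comap] at h2
  obtain ⟨R, hR⟩ := eventually_atTop.1 h2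
  exact ⟨R, fun ζ hζ hn => hR ‖ζ‖ hn.le ζ rfl hζ⟩

/-- Regularity is needed up to the boundary line, where compactness handles bounded `ζ`. -/
theorem IsNaturalHalfPlane.contDiffAt_logRatio {Φ : ℂ → X} (hP : IsClosed P)
    (hc : IsCoordinate P p e a) (hΦ : IsNaturalHalfPlane b p (puncturedDisk e a) Φ) {ζ : ℂ}
    (hζ : 0 ≤ ζ.re) : ContDiffAt ℝ 2 (fun x => logRatio g b (Φ x)) ζ := by
  obtain ⟨h1, h2, h3, h4, h5, h6⟩ := hΦ.coord hc hζ
  have hb : pullCubic b.toFun e.symm (e (Φ ζ)) ≠ 0 := by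
    intro h; rw [h, mul_zero] at h6; exact two_ne_zero h6.symm
  have h7 := (contDiffAt_logRatio_symm hP g b hc.mem_atlas (hc.mem_target h2)
    (hc.notMem _ h1 h2) hb).1
  have han : AnalyticAt ℂ (fun x => e (Φ x)) ζ := by
    rw [Complex.analyticAt_iff_eventually_differentiableAt]
    obtain ⟨V, hVo, hV, hVd⟩ := hΦ.holomorphic
    have hsrc : Φ ζ ∈ e.source := by
      rw [← h3]; exact e.map_target (hc.mem_target h2)
    have hd : MDifferentiableAt 𝓘(ℂ) 𝓘(ℂ) Φ ζ := (hVd ζ (hV hζ)).mdifferentiableAt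
      (hVo.mem_nhds (hV hζ))
    filter_upwards [hVo.mem_nhds (hV hζ), hd.continuousAt.eventually (e.open_source.mem_nhds hsrc)]
      with x hx hx'
    exact mdifferentiableAt_iff_differentiableAt.1 ((mdifferentiableAt_coord hc.mem_atlas hx').comp x
      ((hVd x hx).mdifferentiableAt (hVo.mem_nhds hx)))
  refine (contDiffAt_two_comp_analyticAt (φ := fun x => e (Φ x)) h7 han).congr_of_eventuallyEq ?_
  filter_upwards [h5] with x hx
  rw [← hx]

/-- The coordinate `w` on a natural half-plane. -/
theorem IsNaturalHalfPlane.exists_developing {Φ : ℂ → X} (hc : IsCoordinate P p e a)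
    (hΦ : IsNaturalHalfPlane b p (puncturedDisk e a) Φ) {m : ℝ} {A : ℂ} (hm : 0 < m)
    (hb : ∀ w : ℂ, Real.exp (-w.re) < a → Complex.exp (-w) ^ 3 *
        pullCubic b.toFun e.symm (Complex.exp (-w)) = (Complex.exp (m * w) + A) ^ 3) :
    ∃ (c d : ℂ) (w : ℂ → ℂ), ‖c‖ ^ 3 = 2 ∧ IsDeveloping m A c d w ∧
      ∀ ζ : ℂ, 0 < ζ.re → Complex.exp (-w ζ) = e (Φ ζ) := by
  obtain ⟨w, hw⟩ := exists_log_rightHalfPlane (z := fun ζ => e (Φ ζ))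
    (fun ζ hζ => (hΦ.coord hc (le_of_lt hζ)).2.2.2.1.differentiableWithinAt)
    (fun ζ hζ => norm_pos_iff.1 (hΦ.coord hc hζ.le).1)
  -- The sign comes from `z = exp (-w)`: `z' = -z w'`, so `z'³ f(z) = 2` becomes `-((exp (m w) + A)
  -- w')³ = 2`.
  have hcube : ∀ ζ : ℂ, 0 < ζ.re → ((Complex.exp (m * w ζ) + A) * deriv w ζ) ^ 3 = -2 := by
    intro ζ hζ
    obtain ⟨-, h2, -, -, -, h6⟩ := hΦ.coord hc hζ.le
    obtain ⟨hwd, hwe⟩ := hw ζ hζ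
    have hev : (fun x => e (Φ x)) =ᶠ[𝓝 ζ] fun x => Complex.exp (-w x) := by
      filter_upwards [isOpen_rightHalfPlane.mem_nhds hζ] with x hx using (hw x hx).2.symm
    have hd : deriv (fun x => e (Φ x)) ζ = Complex.exp (-w ζ) * -deriv w ζ := by
      rw [hev.deriv_eq]; exact hwd.hasDerivAt.neg.cexp.deriv
    have hlt : Real.exp (-(w ζ).re) < a := by rw [← norm_exp_neg, hwe]; exact h2
    rw [hd, ← hwe] at h6
    rw [mul_pow, ← hb _ hlt]
    linear_combination -h6
  obtain ⟨c, d, hc3, hdev⟩ := exists_isDeveloping hm (by norm_num : (-2 : ℂ) ≠ 0)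
    (fun ζ hζ => (hw ζ hζ).1) hcube (fun S => by
      obtain ⟨R, hR⟩ := hΦ.exists_norm_lt hc (Real.exp_pos (-S))
      refine ⟨R, fun ζ hζ hn => ?_⟩
      have h1 := hR ζ hζ.le hn
      rw [← (hw ζ hζ).2, norm_exp_neg, Real.exp_lt_exp] at h1
      linarith)
  refine ⟨c, d, w, ?_, hdev, fun ζ hζ => (hw ζ hζ).2⟩
  rw [← norm_pow, hc3]; simp

variable [T2Space X] [CompactSpace X] [IsManifold 𝓘(ℂ) ω X]

theorem exists_decay_halfPlane (hP : P.Finite) (hg : IsWangMetric g b) (hp : p ∈ P) {n : ℕ}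
    (hn : 1 ≤ n) (hc : IsCoordinate P p e a) (hb : HasNormalForm b n e a) {Φ : ℂ → X}
    (hΦ : IsNaturalHalfPlane b p (puncturedDisk e a) Φ) :
    ∃ C : ℝ, ∀ ζ : ℂ, 0 < ζ.re →
      0 ≤ logRatio g b (Φ ζ) ∧
      logRatio g b (Φ ζ) ≤ C * (‖ζ‖ ^ (-(1 / 2) : ℝ) * Real.exp (-2 * Real.sqrt 3 * ‖ζ‖)) ∧
      ‖dWirtinger (fun w => logRatio g b (Φ w)) ζ‖ ≤
        C * (‖ζ‖ ^ (-(1 / 2) : ℝ) * Real.exp (-2 * Real.sqrt 3 * ‖ζ‖)) := by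
  obtain ⟨m, A, hm, hmA, hord, hform⟩ := exists_cone_form hn hc hb
  obtain ⟨c, d, w, hc3, hdev, hwe⟩ := hΦ.exists_developing hc hm hform
  have hcn : 0 < ‖c‖ := by
    refine lt_of_le_of_ne (norm_nonneg c) fun h => ?_
    rw [← h] at hc3; norm_num at hc3
  have hc0 : c ≠ 0 := norm_pos_iff.1 hcn
  have hpos : ∀ ζ : ℂ, 0 < ζ.re → 0 ≤ logRatio g b (Φ ζ) := by
    intro ζ hζ
    obtain ⟨h1, h2, h3, -, -, h6⟩ := hΦ.coord hc hζ.le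
    rw [← h3]
    refine logRatio_nonneg hP hg hc.mem_atlas (hc.mem_target h2) (hc.notMem _ h1 h2) fun h => ?_
    rw [h, mul_zero] at h6; exact two_ne_zero h6.symm
  have hexpA : ∀ᶠ s : ℝ in atTop, ‖A‖ < Real.exp (m * s) :=
    (Real.tendsto_exp_atTop.comp (tendsto_id.const_mul_atTop hm)).eventually_gt_atTop ‖A‖
  have hexpa : ∀ᶠ s : ℝ in atTop, Real.exp (-s) < a :=
    Real.tendsto_exp_neg_atTop_nhds_zero.eventually (gt_mem_nhds hc.radius_pos)
  obtain ⟨s, hs⟩ := eventually_atTop.1 (hexpA.and hexpa)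
  have hne : ∀ w : ℂ, s ≤ w.re → pullCubic b.toFun e.symm (Complex.exp (-w)) ≠ 0 := by
    intro w hw h0
    have h1 := hform w (hs _ hw).2
    rw [h0, mul_zero] at h1
    have h2 : Complex.exp (m * w) + A = 0 := by simpa using h1.symm
    have h3 : ‖Complex.exp (m * w)‖ = ‖A‖ := by rw [eq_neg_of_add_eq_zero_left h2, norm_neg]
    rw [Complex.norm_exp, Complex.re_ofReal_mul] at h3
    linarith [(hs _ hw).1]
  obtain ⟨M, hM⟩ := exists_cylinderRatio_le hP.isClosed hg hp hc hord (s := s) (hs s le_rfl).2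
    (fun z h1 h2 => by
      have h3 : Complex.exp (-(-Complex.log z)) = z := by
        rw [neg_neg, Complex.exp_log (norm_pos_iff.1 h1)]
      have h4 := hne (-Complex.log z) (by
        rw [Complex.neg_re, Complex.log_re]
        have := (Real.log_le_iff_le_exp h1).2 h2
        linarith)
      rwa [h3] at h4)
  -- Since `‖c‖³ = 2`, dividing `|exp (m w) + A|³` by `2` amounts to scaling by `c₀`. The rate `2√3
  -- c₀` on the cylinder is then `2√3` in terms of `ζ`.
  set c₀ := ‖c‖⁻¹ with hc₀
  have hc₀pos : 0 < c₀ := inv_pos.2 hcn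
  have hu : ∀ w : ℂ, s ≤ w.re → IsWangSolutionAt
      (fun w => c₀ ^ 2 * ‖Complex.exp (m * w) + A‖ ^ 2) (cylinderRatio g b e) w := by
    intro w hw
    refine cylinderRatio_isWangSolutionAt hP hg hc (hs _ hw).2 (hne w hw) ?_
    have h1 : ‖(Complex.exp (m * w) + A) ^ 3‖ / 2 = (c₀ * ‖Complex.exp (m * w) + A‖) ^ 3 := by
      rw [norm_pow, ← hc3, hc₀]; field_simp
    rw [hform w (hs _ hw).2, h1, ← mul_pow, ← Real.rpow_natCast, ← Real.rpow_natCast,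
      ← Real.rpow_mul (by positivity)]
    norm_num
  obtain ⟨C, s₁, hs₁, hC0, hC⟩ := exists_decay_of_cone hm hc₀pos hmA hu
    (fun w => cylinderRatio_periodic w) hM
  obtain ⟨S, hS⟩ := hdev.exists_norm_deriv_le hm
  obtain ⟨R₁, K, hK⟩ := hdev.exists_le_conePhase hm (κ := 2 * Real.sqrt 3 * c₀) (by positivity) hc0
  obtain ⟨R₂, hR₂⟩ := hdev.tendsto (max s₁ S)
  set R := max (max R₁ R₂) 1 with hR
  have hR0 : 0 < R := lt_max_of_lt_right one_pos
  set Ψ : ℂ → ℝ := fun ζ => ‖ζ‖ ^ (-(1 / 2) : ℝ) * Real.exp (-2 * Real.sqrt 3 * ‖ζ‖) with hΨ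
  have hΨ0 : ∀ ζ, 0 ≤ Ψ ζ := fun ζ => by positivity
  have hphase : ∀ ζ : ℂ, 0 < ζ.re → R < ‖ζ‖ →
      Real.exp (-conePhase (2 * Real.sqrt 3 * c₀) m A (w ζ)) ≤ Real.exp K * Ψ ζ := by
    intro ζ hζ hn
    have h1 := hK ζ hζ (((le_max_left _ _).trans (le_max_left _ _)).trans_lt hn)
    have h2 : 0 < ‖ζ‖ := hR0.trans hn
    have h3 : 2 * Real.sqrt 3 * c₀ * ‖c‖ = 2 * Real.sqrt 3 := by rw [hc₀]; field_simp
    rw [h3] at h1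
    simp only [hΨ]
    rw [Real.rpow_def_of_pos h2, ← Real.exp_add, ← Real.exp_add]
    exact Real.exp_le_exp.2 (by linarith)
  have hfar : ∀ ζ : ℂ, 0 < ζ.re → R < ‖ζ‖ →
      logRatio g b (Φ ζ) ≤ C * Real.exp K * Ψ ζ ∧
      ‖dWirtinger (fun w => logRatio g b (Φ w)) ζ‖ ≤ C * Real.exp K * (2 * ‖c‖) * Ψ ζ := by
    intro ζ hζ hn
    have h1 := hR₂ ζ hζ (((le_max_right _ _).trans (le_max_left _ _)).trans_lt hn)
    have hw1 : s₁ ≤ (w ζ).re := (le_max_left _ _).trans h1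
    have hwS : S ≤ (w ζ).re := (le_max_right _ _).trans h1
    obtain ⟨h2, h3⟩ := hC (w ζ) hw1
    have h4 := hphase ζ hζ hn
    have heq : ∀ x : ℂ, 0 < x.re → logRatio g b (Φ x) = cylinderRatio g b e (w x) := by
      intro x hx
      rw [cylinderRatio, hwe x hx, (hΦ.coord hc hx.le).2.2.1]
    have h5 := mul_le_mul_of_nonneg_left h4 hC0
    constructor
    · rw [heq ζ hζ]
      linarith
    · have hev : (fun x => logRatio g b (Φ x)) =ᶠ[𝓝 ζ] fun x => cylinderRatio g b e (w x) := by
        filter_upwards [isOpen_rightHalfPlane.mem_nhds hζ] with x hx using heq x hx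
      refine (norm_dWirtinger_comp_le hev
        ((hu (w ζ) (hs₁.trans hw1)).contDiffAt.differentiableAt (by simp))
        (hdev.differentiableAt ζ hζ)).trans ?_
      have h6 := hS ζ hζ hwS
      -- The growth `exp (m Re w)` of the gradient bound in `w` is cancelled by the factor `exp (-m
      -- Re w)` bounding `|w'|`.
      calc _ ≤ (C * Real.exp (m * (w ζ).re) *
            Real.exp (-conePhase (2 * Real.sqrt 3 * c₀) m A (w ζ))) *
            (2 * ‖c‖ * Real.exp (-(m * (w ζ).re))) :=
            mul_le_mul h3 h6 (norm_nonneg _) (by positivity)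
        _ = C * Real.exp (-conePhase (2 * Real.sqrt 3 * c₀) m A (w ζ)) * (2 * ‖c‖) := by
            rw [Real.exp_neg (m * (w ζ).re)]
            field_simp
        _ ≤ C * (Real.exp K * Ψ ζ) * (2 * ‖c‖) := by gcongr
        _ = _ := by ring
  -- For `‖ζ‖ ≤ R` the function and its derivative are bounded on the closed half-disk, while the
  -- majorant `Ψ`, decreasing in `‖ζ‖`, is at least its value `N` at radius `R`.
  have hK : IsCompact ({ζ : ℂ | 0 ≤ ζ.re} ∩ Metric.closedBall 0 R) :=
    (isCompact_closedBall (0 : ℂ) R).inter_left (isClosed_le continuous_const Complex.continuous_re)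
  have hcd : ∀ ζ : ℂ, 0 ≤ ζ.re → ContDiffAt ℝ 2 (fun x => logRatio g b (Φ x)) ζ := fun ζ hζ =>
    hΦ.contDiffAt_logRatio hP.isClosed hc hζ
  obtain ⟨B₁, hB₁⟩ := hK.exists_bound_of_continuousOn (f := fun x => logRatio g b (Φ x))
    fun ζ hζ => (hcd ζ hζ.1).continuousAt.continuousWithinAt
  obtain ⟨B₂, hB₂⟩ := hK.exists_bound_of_continuousOn (f := fderiv ℝ fun x => logRatio g b (Φ x))
    fun ζ hζ => ((hcd ζ hζ.1).fderiv_right (m := 1) (by norm_num)).continuousAt.continuousWithinAt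
  set N := R ^ (-(1 / 2) : ℝ) * Real.exp (-2 * Real.sqrt 3 * R) with hN
  have hN0 : 0 < N := by positivity
  have hΨN : ∀ ζ : ℂ, 0 < ζ.re → ‖ζ‖ ≤ R → N ≤ Ψ ζ := by
    intro ζ hζ hn
    have h1 : 0 < ‖ζ‖ := hζ.trans_le ((le_abs_self _).trans (Complex.abs_re_le_norm ζ))
    refine mul_le_mul ?_ ?_ (Real.exp_pos _).le (by positivity)
    · exact Real.rpow_le_rpow_of_nonpos h1 hn (by norm_num)
    · have := mul_le_mul_of_nonneg_left hn (by positivity : 0 ≤ 2 * Real.sqrt 3)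
      exact Real.exp_le_exp.2 (by linarith)
  set T := C * Real.exp K + C * Real.exp K * (2 * ‖c‖) + |B₁| / N + |B₂| / N with hT
  have t1 : 0 ≤ C * Real.exp K := by positivity
  have t2 : 0 ≤ C * Real.exp K * (2 * ‖c‖) := by positivity
  have t3 : 0 ≤ |B₁| / N := by positivity
  have t4 : 0 ≤ |B₂| / N := by positivity
  have hT0 : 0 ≤ T := by rw [hT]; positivity
  refine ⟨T, fun ζ hζ => ⟨hpos ζ hζ, ?_⟩⟩
  change logRatio g b (Φ ζ) ≤ T * Ψ ζ ∧ _ ≤ T * Ψ ζ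
  rcases lt_or_ge R ‖ζ‖ with hn | hn
  · obtain ⟨h1, h2⟩ := hfar ζ hζ hn
    exact ⟨h1.trans (mul_le_mul_of_nonneg_right (by linarith) (hΨ0 ζ)),
      h2.trans (mul_le_mul_of_nonneg_right (by linarith) (hΨ0 ζ))⟩
  · have hmem : ζ ∈ {ζ : ℂ | 0 ≤ ζ.re} ∩ Metric.closedBall 0 R := ⟨hζ.le, by simpa using hn⟩
    have hbound : ∀ x B : ℝ, x ≤ B → |B| / N ≤ T → x ≤ T * Ψ ζ := by
      intro x B hx hB
      have h1 : |B| = |B| / N * N := by field_simp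
      calc x ≤ |B| := hx.trans (le_abs_self B)
        _ = |B| / N * N := h1
        _ ≤ T * Ψ ζ := mul_le_mul hB (hΨN ζ hζ hn) hN0.le hT0
    exact ⟨hbound _ B₁ ((le_abs_self _).trans (hB₁ ζ hmem)) (by linarith),
      hbound _ B₂ ((norm_dWirtinger_le _ _).trans (hB₂ ζ hmem)) (by linarith)⟩

end HigherOrder

end WangEq

end

open WangEq in
theorem theorem5p3
    {X : Type*} [TopologicalSpace X] [T2Space X] [CompactSpace X] [ConnectedSpace X]
    [ChartedSpace ℂ X] [IsManifold 𝓘(ℂ) ω X]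
    (P : Set X) (hP : P.Finite)
    (b : CubicDifferential X P)
    (hb_ne : ∃ x, x ∉ P ∧ ∃ v : TangentSpace 𝓘(ℂ) x, b.toFun x v ≠ 0)
    (hb_mer : ∀ p ∈ P, b.MeromorphicAt p)
    (g : ConformalMetric X P) (hg : IsWangMetric g b)
    (p : X) (hp : p ∈ P) :
    (∀ (n : ℕ), 1 ≤ n → ∀ (e : OpenPartialHomeomorph X ℂ) (a : ℝ),
      IsCoordinate P p e a → HasNormalForm b n e a →
      ∀ Φ : ZMod n → ℂ → X, (∀ k, IsNaturalHalfPlane b p (puncturedDisk e a) (Φ k)) →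
      ∃ C : ℝ, ∀ (k : ZMod n) (ζ : ℂ), 0 < ζ.re →
        0 ≤ logRatio g b (Φ k ζ) ∧
        logRatio g b (Φ k ζ) ≤
          C * ‖ζ‖ ^ (-(1 / 2) : ℝ) * Real.exp (-2 * Real.sqrt 3 * ‖ζ‖) ∧
        ‖dWirtinger (fun w => logRatio g b (Φ k w)) ζ‖ ≤
          C * ‖ζ‖ ^ (-(1 / 2) : ℝ) * Real.exp (-2 * Real.sqrt 3 * ‖ζ‖)) ∧
    (∀ (R : ℂ), R ≠ 0 → ∀ (e : OpenPartialHomeomorph X ℂ) (a : ℝ), 1 < a →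
      IsCoordinate P p e a → HasNormalFormThree b R e a →
      ∀ r : ℂ, r ^ 3 = R / 2 →
      ∃ C : ℝ, ∀ ζ ∈ rotatedHalfPlane r,
        0 ≤ logRatio g b (thirdOrderModel e r ζ) ∧
        logRatio g b (thirdOrderModel e r ζ) ≤
          C * Real.exp (-2 * Real.sqrt 3 * Metric.infDist ζ (frontier (rotatedHalfPlane r))) ∧
        ‖dWirtinger (fun w => logRatio g b (thirdOrderModel e r w)) ζ‖ ≤
          C * Real.exp (-2 * Real.sqrt 3 * Metric.infDist ζ (frontier (rotatedHalfPlane r)))) := by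
  refine ⟨fun n hn e a hc hb Φ hΦ => ?_, fun R hR e a ha hc hb r hr =>
    exists_decay_thirdOrder hP hg hp hR ha hc hb hr⟩
  -- For `n ≥ 1` the index set is finite, so the sum of the absolute constants serves all
  -- half-planes at once.
  have : NeZero n := ⟨by omega⟩
  choose C hC using fun k => exists_decay_halfPlane hP hg hp hn hc hb (hΦ k)
  refine ⟨∑ k, |C k|, fun k ζ hζ => ?_⟩
  obtain ⟨h1, h2, h3⟩ := hC k ζ hζ
  have hle : C k ≤ ∑ k, |C k| := (le_abs_self _).trans
    (Finset.single_le_sum (f := fun k => |C k|) (fun i _ => abs_nonneg _) (Finset.mem_univ k))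
  have hmul := mul_le_mul_of_nonneg_right hle
    (by positivity : 0 ≤ ‖ζ‖ ^ (-(1 / 2) : ℝ) * Real.exp (-2 * Real.sqrt 3 * ‖ζ‖))
  rw [mul_assoc]
  exact ⟨h1, h2.trans hmul, h3.trans hmul⟩
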